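/- Let $n,d\ge 1$ and let $B=(b_{ij})\in\mathbb R^{n\times n}$ be symmetric positive semidefinite with $b_{ij}\ge 0$ for all $i,j$ and $b_{ii}>0$ for all $i$. Put $L=\ker B$, let $P_L$, $P_{L^\perp}$ be the orthogonal projections onto $L$, $L^\perp$, write $\widehat s=P_{L^\perp}s$ for $s\in\mathbb R^n$, and let $W=[0,\infty)^n\times(L^\perp)^d$. Elements of $W$ are written $(s,p)$ with $p=(p_1,\dots,p_d)$, $p_k\in L^\perp$; $(Bp)_i=((Bp_k)_i)_{k=1}^d\in\mathbb R^d$ and $|B^{1/2}p|^2=\sum_{k=1}^d p_k^{T}Bp_k$. For a probability measure $\nu$ on $W$ write $\langle\nu,f\rangle=\int_W f(s,p)\,d\nu(s,p)$. Let $$h_S(s)=\sum_{i=1}^n\big(s_i(\log s_i-1)+1\big),\qquad h_R(s)=\tfrac12\sum_{i,j=1}^n b_{ij}s_is_j .$$ Let $\Omega\subset\mathbb R^d$ be a bounded domain with Lipschitz boundary and $T>0$. Consider the cross-diffusion system $$\partial_t u_i=\operatorname{div}\big(u_i\nabla (Bu)_i\big)\ \text{ in }\Omega,\qquad u_i\nabla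 (Bu)_i\cdot\nu=0\ \text{ on }\partial\Omega,\qquad u_i(0)=u_i^{\rm in}\qquad(i=1,\dots,n).\tag{1}$$ **Dissipative measure-valued solutions.** Let $u^{\rm in}\in L^2(\Omega;[0,\infty)^n)$. A weakly-$*$ measurable family $\mu=(\mu_{x,t})_{(x,t)\in\Omega\times[0,\infty)}$ of probability measures on $W$ with (well-defined) barycenters $u=\langle\mu,s\rangle$, $y=\langle\mu,p\rangle$ is a dissipative measure-valued solution of (1) if * for all $i$: $u_i\in L^\infty(0,\infty;L^2(\Omega))$ and $\partial_tu_i\in L^2(0,\infty;W^{1,4}(\Omega)^*)$; moreover $y\in L^2(\Omega\times(0,T');(L^\perp)^d)$ for all $T'>0$, and $y=\nabla\widehat u$ in the sense of distributions; * for all $f\in C_0(\mathbb R^n\times(L^\perp)^d)$ and a.e. $(x,t)\in\Omega\times(0,\infty)$: $\langle\mu_{x,t},f(s,p)\rangle=\langle\mu_{x,t},f(\widehat u(x,t)+P_Ls,p)\rangle$; * for a.e. $t>0$: $$\int_\Omega\langle\mu_{x,t},h_S(s)\rangle\,dx+\int_0^t\!\!\int_\Omega\langle\mu_{x,\tau},|B^{1/2}p|^2\rangle\,dx\,d\tau\le\int_\Omega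 h_S(u^{\rm in})\,dx,$$ $$\int_\Omega h_R(u(x,t))\,dx+\sum_{i=1}^n\int_0^t\!\!\int_\Omega\langle\mu_{x,\tau},s_i|(Bp)_i|^2\rangle\,dx\,d\tau\le\int_\Omega h_R(u^{\rm in})\,dx;$$ * for all $T'>0$, $i=1,\dots,n$ and $\phi\in C^1_c(\overline\Omega\times[0,T'))$: $$\int_0^{T'}\!\!\int_\Omega u_i\,\partial_t\phi\,dx\,dt+\int_\Omega u_i^{\rm in}\phi(x,0)\,dx=\int_0^{T'}\!\!\int_\Omega\langle\mu_{x,t},s_i(Bp)_i\rangle\cdot\nabla\phi\,dx\,dt .$$ **Theorem (weak–strong uniqueness).** Let $v\in C^1(\overline\Omega\times[0,T];[0,\infty)^n)$ satisfy $v_i>0$ on $\overline\Omega\times[0,T]$ for all $i$ and $v(\cdot,0)=u^{\rm in}$ a.e. in $\Omega$, and let $v$ be a solution of (1) on $[0,T]$ in the weak sense, that is, $$\int_0^T\!\!\int_\Omega v_i\,\partial_t\phi\,dx\,dt+\int_\Omega u_i^{\rm in}\phi(x,0)\,dx=\int_0^T\!\!\int_\Omega v_i\nabla (Bv)_i\cdot\nabla\phi\,dx\,dt$$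 for all $i=1,\dots,n$ and $\phi\in C^1_c(\overline\Omega\times[0,T))$. Let $\mu$ be any dissipative measure-valued solution of (1) with the same initial datum $u^{\rm in}$. Then $$\mu_{x,t}=\delta_{v(x,t)}\otimes\delta_{\nabla\widehat v(x,t)}\qquad\text{for a.e. }(x,t)\in\Omega\times(0,T).$$ -/

import Mathlib

open MeasureTheory Set
open scoped NNReal ENNReal ContDiff ZeroAtInfty RealInnerProductSpace

namespace SegCD

/-- Euclidean space `ℝ^m`. -/
abbrev E (m : ℕ) : Type := EuclideanSpace ℝ (Fin m)

/-! ### Lipschitz domains and differentiation in space-time -/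

/-- `Ω` has a Lipschitz boundary: near every boundary point, in a suitable direction `e`,
`Ω` is the strict epigraph of a Lipschitz function on the hyperplane orthogonal to `e`. -/
def HasLipschitzBoundary {d : ℕ} (Ω : Set (E d)) : Prop :=
  ∀ x ∈ frontier Ω, ∃ (e : E d) (r : ℝ) (K : ℝ≥0) (γ : ((ℝ ∙ e)ᗮ : Submodule ℝ (E d)) → ℝ),
    ‖e‖ = 1 ∧ 0 < r ∧ LipschitzWith K γ ∧
      ∀ y ∈ Metric.ball x r,
        (y ∈ Ω ↔ γ ((ℝ ∙ e)ᗮ.orthogonalProjectionOnto y) < ⟪e, y⟫)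

/-- A bounded domain (nonempty, open, connected set) with Lipschitz boundary. -/
structure IsBoundedLipschitzDomain {d : ℕ} (Ω : Set (E d)) : Prop where
  isOpen : IsOpen Ω
  isConnected : IsConnected Ω
  isBounded : Bornology.IsBounded Ω
  lipschitz : HasLipschitzBoundary Ω

/-- Time derivative at `z = (x, t)`. -/
noncomputable def dt {d : ℕ} {F : Type*} [NormedAddCommGroup F] [NormedSpace ℝ F]
    (f : E d × ℝ → F) (z : E d × ℝ) : F :=
  fderiv ℝ f z (0, 1)

/-- Partial derivative in the `k`-th space direction at `z = (x, t)`. -/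
noncomputable def dx {d : ℕ} {F : Type*} [NormedAddCommGroup F] [NormedSpace ℝ F]
    (k : Fin d) (f : E d × ℝ → F) (z : E d × ℝ) : F :=
  fderiv ℝ f z (EuclideanSpace.single k 1, 0)

/-! ### The Sobolev space `W^{1,p}(Ω)` and time derivatives with values in its dual -/

/-- `g` is the weak gradient of `f` in `Ω`. -/
def IsWeakGradient {d : ℕ} (Ω : Set (E d)) (f : E d → ℝ) (g : E d → E d) : Prop :=
  ∀ φ : E d → ℝ, ContDiff ℝ ∞ φ → HasCompactSupport φ → tsupport φ ⊆ Ω → ∀ k : Fin d,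
    ∫ x in Ω, fderiv ℝ φ x (EuclideanSpace.single k 1) * f x = - ∫ x in Ω, φ x * g x k

lemma integrable_test_mul {d : ℕ} {Ω : Set (E d)} {p : ℝ≥0∞} (hp : 1 ≤ p) {f : E d → ℝ}
    (hf : MemLp f p (volume.restrict Ω)) {φ : E d → ℝ} (hφ : Continuous φ)
    (hc : HasCompactSupport φ) : Integrable (fun x => φ x * f x) (volume.restrict Ω) := by
  have h := (hf.locallyIntegrable hp).integrable_smul_left_of_hasCompactSupport hφ hc
  simpa [smul_eq_mul] using h

lemma memLp_coord {d : ℕ} {m : Measure (E d)} {p : ℝ≥0∞} {g : E d → E d}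
    (hg : MemLp g p m) (k : Fin d) : MemLp (fun x => g x k) p m :=
  (EuclideanSpace.proj (𝕜 := ℝ) k : E d →L[ℝ] ℝ).comp_memLp' hg

lemma continuous_partial {d : ℕ} {φ : E d → ℝ} (hφ : ContDiff ℝ ∞ φ) (v : E d) :
    Continuous (fun x => fderiv ℝ φ x v) :=
  (hφ.continuous_fderiv (by simp)).clm_apply continuous_const

/-- The Sobolev space `W^{1,p}(Ω)`, realised as the space of pairs `(f, ∇f)` in
`L^p(Ω) × L^p(Ω; ℝ^d)`, whose norm is equivalent to the usual Sobolev norm. -/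
def sobolevW1 {d : ℕ} (p : ℝ≥0∞) [hp : Fact (1 ≤ p)] (Ω : Set (E d)) :
    Submodule ℝ (Lp ℝ p (volume.restrict Ω) × Lp (E d) p (volume.restrict Ω)) where
  carrier := {w | IsWeakGradient Ω w.1 w.2}
  zero_mem' := by
    intro φ _ _ _ k
    have h1 : (fun x => fderiv ℝ φ x (EuclideanSpace.single k 1) *
        (0 : Lp ℝ p (volume.restrict Ω)) x) =ᵐ[volume.restrict Ω] fun _ => 0 := by
      filter_upwards [Lp.coeFn_zero ℝ p (volume.restrict Ω)] with x hx
      rw [hx, Pi.zero_apply, mul_zero]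
    have h2 : (fun x => φ x * (0 : Lp (E d) p (volume.restrict Ω)) x k)
        =ᵐ[volume.restrict Ω] fun _ => 0 := by
      filter_upwards [Lp.coeFn_zero (E d) p (volume.restrict Ω)] with x hx
      rw [hx, Pi.zero_apply, PiLp.zero_apply, mul_zero]
    simp only [Prod.fst_zero, Prod.snd_zero]
    rw [integral_congr_ae h1, integral_congr_ae h2]
    simp
  add_mem' := by
    intro a b ha hb φ h1 h2 h3 k
    have i1 := integrable_test_mul hp.out (Lp.memLp a.1)
      (continuous_partial h1 (EuclideanSpace.single k 1)) (h2.fderiv_apply (𝕜 := ℝ) _)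
    have i2 := integrable_test_mul hp.out (Lp.memLp b.1)
      (continuous_partial h1 (EuclideanSpace.single k 1)) (h2.fderiv_apply (𝕜 := ℝ) _)
    have j1 := integrable_test_mul hp.out (memLp_coord (Lp.memLp a.2) k) h1.continuous h2
    have j2 := integrable_test_mul hp.out (memLp_coord (Lp.memLp b.2) k) h1.continuous h2
    have e1 : (fun x => fderiv ℝ φ x (EuclideanSpace.single k 1) * (a + b).1 x)
        =ᵐ[volume.restrict Ω] fun x => fderiv ℝ φ x (EuclideanSpace.single k 1) * a.1 x
          + fderiv ℝ φ x (EuclideanSpace.single k 1) * b.1 x := by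
      filter_upwards [Lp.coeFn_add a.1 b.1] with x hx
      rw [Prod.fst_add, hx, Pi.add_apply, mul_add]
    have e2 : (fun x => φ x * (a + b).2 x k)
        =ᵐ[volume.restrict Ω] fun x => φ x * a.2 x k + φ x * b.2 x k := by
      filter_upwards [Lp.coeFn_add a.2 b.2] with x hx
      rw [Prod.snd_add, hx, Pi.add_apply, PiLp.add_apply, mul_add]
    rw [integral_congr_ae e1, integral_congr_ae e2, integral_add i1 i2, integral_add j1 j2,
      ha φ h1 h2 h3 k, hb φ h1 h2 h3 k]
    ring
  smul_mem' := by
    intro c a ha φ h1 h2 h3 k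
    have e1 : (fun x => fderiv ℝ φ x (EuclideanSpace.single k 1) * (c • a).1 x)
        =ᵐ[volume.restrict Ω] fun x => c * (fderiv ℝ φ x (EuclideanSpace.single k 1) * a.1 x) := by
      filter_upwards [Lp.coeFn_smul c a.1] with x hx
      simp only [Prod.smul_fst, hx, Pi.smul_apply, smul_eq_mul]
      ring
    have e2 : (fun x => φ x * (c • a).2 x k)
        =ᵐ[volume.restrict Ω] fun x => c * (φ x * a.2 x k) := by
      filter_upwards [Lp.coeFn_smul c a.2] with x hx
      simp only [Prod.smul_snd, hx, Pi.smul_apply, PiLp.smul_apply, smul_eq_mul]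
      ring
    rw [integral_congr_ae e1, integral_congr_ae e2, integral_const_mul, integral_const_mul,
      ha φ h1 h2 h3 k]
    ring

instance fact_one_le_four : Fact ((1 : ℝ≥0∞) ≤ 4) := ⟨by norm_num⟩

/-- `∂ₜ u ∈ L²(0,∞; W^{1,4}(Ω)^*)`: the distributional time derivative of
`t ↦ (w ↦ ∫_Ω u(x,t) w(x) dx) ∈ W^{1,4}(Ω)^*` on `(0,∞)` is represented by a strongly measurable
square-integrable function `ξ` with values in `W^{1,4}(Ω)^*`. -/
def HasDualTimeDerivative {d : ℕ} (Ω : Set (E d)) (u : E d × ℝ → ℝ) : Prop :=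
  ∃ ξ : ℝ → StrongDual ℝ (sobolevW1 4 Ω),
    MemLp ξ 2 (volume.restrict (Ioi 0)) ∧
    ∀ θ : ℝ → ℝ, ContDiff ℝ ∞ θ → HasCompactSupport θ → tsupport θ ⊆ Ioi 0 →
      ∀ w : sobolevW1 4 Ω,
        ∫ t in Ioi (0 : ℝ), deriv θ t * ∫ x in Ω, u (x, t) * w.1.1 x
          = - ∫ t in Ioi (0 : ℝ), θ t * ξ t w

/-! ### The coefficient matrix, the state space, and the entropies -/

/-- Admissible diffusion matrices: entrywise nonnegative, symmetric positive semidefinite,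
with positive diagonal. -/
structure IsAdmissible {n : ℕ} (B : Matrix (Fin n) (Fin n) ℝ) : Prop where
  nonneg : ∀ i j, 0 ≤ B i j
  posSemidef : B.PosSemidef
  diag_pos : ∀ i, 0 < B i i

/-- `L = ker B`. -/
noncomputable def kerB {n : ℕ} (B : Matrix (Fin n) (Fin n) ℝ) : Submodule ℝ (E n) :=
  LinearMap.ker (Matrix.toEuclideanLin B)

/-- `L^⊥`, the orthogonal complement of `ker B`. -/
noncomputable abbrev perpB {n : ℕ} (B : Matrix (Fin n) (Fin n) ℝ) : Submodule ℝ (E n) :=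
  (kerB B)ᗮ

/-- The state space `W = [0,∞)^n × (L^⊥)^d`. -/
abbrev W {n : ℕ} (B : Matrix (Fin n) (Fin n) ℝ) (d : ℕ) : Type :=
  (Fin n → ℝ≥0) × (Fin d → perpB B)

/-- `[0,∞)^n` as a subset of Euclidean space. -/
noncomputable def vec {n : ℕ} (s : Fin n → ℝ≥0) : E n := WithLp.toLp 2 (fun i => (s i : ℝ))

/-- `(B s)_i = ∑ j, b_ij s_j`. -/
noncomputable def mulB {n : ℕ} (B : Matrix (Fin n) (Fin n) ℝ) (s : E n) (i : Fin n) : ℝ :=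
  ∑ j, B i j * s j

/-- The projection `ŝ = P_{L^⊥} s`. -/
noncomputable def hat {n : ℕ} (B : Matrix (Fin n) (Fin n) ℝ) (s : E n) : perpB B :=
  (perpB B).orthogonalProjectionOnto s

/-- The Shannon entropy density. -/
noncomputable def shannon {n : ℕ} (s : Fin n → ℝ≥0) : ℝ :=
  ∑ i, ((s i : ℝ) * (Real.log (s i) - 1) + 1)

/-- The Rao entropy density. -/
noncomputable def rao {n : ℕ} (B : Matrix (Fin n) (Fin n) ℝ) (s : E n) : ℝ :=
  (1 / 2) * ∑ i, ∑ j, B i j * s i * s j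

/-- `|B^{1/2} p|² = ∑ k, p_k^T B p_k` for `p = (p_1, …, p_d) ∈ (L^⊥)^d`. -/
noncomputable def normSqSqrtB {n d : ℕ} (B : Matrix (Fin n) (Fin n) ℝ)
    (p : Fin d → perpB B) : ℝ :=
  ∑ k, ∑ i, ∑ j, B i j * (p k : E n) i * (p k : E n) j

/-! ### Weak formulation -/

/-- The test functions `C^1_c(Ω̄ × [0,T))`. -/
def IsTest {d : ℕ} (Ω : Set (E d)) (T : ℝ) (φ : E d × ℝ → ℝ) : Prop :=
  ContDiffOn ℝ 1 φ (closure Ω ×ˢ Ico 0 T) ∧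
    ∃ K : Set (E d × ℝ), IsCompact K ∧ K ⊆ closure Ω ×ˢ Ico 0 T ∧
      ∀ z ∈ closure Ω ×ˢ Ico 0 T, z ∉ K → φ z = 0

/-- Weak form on `Ω × (0,T)` of `∂ₜ u = div q` with `q · ν = 0` on `∂Ω` and `u(0) = u₀`. -/
def IsWeakContinuityEq {d : ℕ} (Ω : Set (E d)) (T : ℝ) (u : E d × ℝ → ℝ)
    (q : Fin d → E d × ℝ → ℝ) (u₀ : E d → ℝ) : Prop :=
  ∀ φ : E d × ℝ → ℝ, IsTest Ω T φ →
    (∫ z in Ω ×ˢ Ioo 0 T, u z * dt φ z) + ∫ x in Ω, u₀ x * φ (x, 0)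
      = ∫ z in Ω ×ˢ Ioo 0 T, ∑ k, q k z * dx k φ z

/-- `v` is a positive solution, of class `C^1(Ω̄ × [0,T]; [0,∞)^n)`, to
`∂ₜ v_i = div (v_i ∇(Bv)_i)` with no-flux boundary conditions (in the weak sense) and initial
datum `uin`. -/
structure IsPositiveC1Solution {n d : ℕ} (B : Matrix (Fin n) (Fin n) ℝ) (Ω : Set (E d)) (T : ℝ)
    (uin : E d → Fin n → ℝ≥0) (v : E d × ℝ → Fin n → ℝ≥0) : Prop where
  contDiffOn : ∀ i, ContDiffOn ℝ 1 (fun z => (v z i : ℝ)) (closure Ω ×ˢ Icc 0 T)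
  pos : ∀ z ∈ closure Ω ×ˢ Icc 0 T, ∀ i, 0 < v z i
  initial : ∀ᵐ x ∂(volume.restrict Ω), v (x, 0) = uin x
  weak : ∀ i, IsWeakContinuityEq Ω T (fun z => (v z i : ℝ))
    (fun k z => (v z i : ℝ) * dx k (fun z' => mulB B (vec (v z')) i) z) (fun x => (uin x i : ℝ))

/-! ### Dissipative measure-valued solutions -/

section MeasureValued

variable {n d : ℕ} {B : Matrix (Fin n) (Fin n) ℝ}

/-- The barycenter `u = ⟨μ, s⟩`. -/
noncomputable def baryS (μ : E d × ℝ → ProbabilityMeasure (W B d)) (z : E d × ℝ) : E n :=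
  WithLp.toLp 2 (fun i => ∫ w : W B d, (w.1 i : ℝ) ∂(μ z : Measure (W B d)))

/-- The barycenter `y = ⟨μ, p⟩`. -/
noncomputable def baryP (μ : E d × ℝ → ProbabilityMeasure (W B d)) (k : Fin d) (z : E d × ℝ) :
    perpB B :=
  ∫ w : W B d, w.2 k ∂(μ z : Measure (W B d))

/-- The flux `⟨μ, s_i (B p)_i⟩`, with components `⟨μ, s_i (B p_k)_i⟩`, `k = 1, …, d`. -/
noncomputable def flux (μ : E d × ℝ → ProbabilityMeasure (W B d)) (i : Fin n) (k : Fin d)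
    (z : E d × ℝ) : ℝ :=
  ∫ w : W B d, (w.1 i : ℝ) * mulB B (w.2 k : E n) i ∂(μ z : Measure (W B d))

/-- Dissipative measure-valued solutions of `∂ₜ u_i = div (u_i ∇(Bu)_i)` with no-flux boundary
conditions and initial datum `uin`. The dual pairings with the nonnegative (possibly
non-integrable) functions in the entropy inequalities are `[0,∞]`-valued integrals. -/
structure IsDissipativeMVSolution (Ω : Set (E d)) (uin : E d → Fin n → ℝ≥0)
    (μ : E d × ℝ → ProbabilityMeasure (W B d)) : Prop where
  /-- The initial datum is in `L²(Ω; [0,∞)^n)`. -/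
  initial_memLp : ∀ i, MemLp (fun x => (uin x i : ℝ)) 2 (volume.restrict Ω)
  /-- `μ` is weakly-* measurable on `Ω × (0,∞)`. -/
  weakStarMeasurable : ∀ f : C₀(W B d, ℝ),
    AEStronglyMeasurable (fun z => ∫ w, f w ∂(μ z : Measure (W B d)))
      (volume.restrict (Ω ×ˢ Ioi 0))
  /-- The barycenters exist. -/
  integrable_s : ∀ᵐ z ∂(volume.restrict (Ω ×ˢ Ioi 0)), ∀ i,
    Integrable (fun w : W B d => (w.1 i : ℝ)) (μ z : Measure (W B d))
  integrable_p : ∀ᵐ z ∂(volume.restrict (Ω ×ˢ Ioi 0)), ∀ k,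
    Integrable (fun w : W B d => w.2 k) (μ z : Measure (W B d))
  /-- `u_i ∈ L^∞(0,∞; L²(Ω))`. -/
  density_bound : ∀ i, ∃ C : ℝ≥0, ∀ᵐ t ∂(volume.restrict (Ioi (0 : ℝ))),
    MemLp (fun x => baryS μ (x, t) i) 2 (volume.restrict Ω) ∧
      eLpNorm (fun x => baryS μ (x, t) i) 2 (volume.restrict Ω) ≤ C
  /-- `∂ₜ u_i ∈ L²(0,∞; W^{1,4}(Ω)^*)`. -/
  time_derivative : ∀ i, HasDualTimeDerivative Ω (fun z => baryS μ z i)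
  /-- `y ∈ L²(Ω × (0,T); (L^⊥)^d)` for all `T`. -/
  gradient_memLp : ∀ T : ℝ, 0 < T → ∀ k,
    MemLp (baryP μ k) 2 (volume.restrict (Ω ×ˢ Ioo 0 T))
  /-- `y = ∇û` in the sense of distributions on `Ω × (0,∞)`. -/
  gradient_eq : ∀ φ : E d × ℝ → ℝ, ContDiff ℝ ∞ φ → HasCompactSupport φ →
    tsupport φ ⊆ Ω ×ˢ Ioi 0 → ∀ k,
      ∫ z in Ω ×ˢ Ioi (0 : ℝ), dx k φ z • hat B (baryS μ z)
        = - ∫ z in Ω ×ˢ Ioi (0 : ℝ), φ z • baryP μ k z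
  /-- `⟨μ, f(s,p)⟩ = ⟨μ, f(û + P_L s, p)⟩`. -/
  separation : ∀ f : C₀(E n × (Fin d → perpB B), ℝ),
    ∀ᵐ z ∂(volume.restrict (Ω ×ˢ Ioi 0)),
      ∫ w : W B d, f (vec w.1, w.2) ∂(μ z : Measure (W B d))
        = ∫ w : W B d, f ((hat B (baryS μ z) : E n) + (kerB B).starProjection (vec w.1), w.2)
            ∂(μ z : Measure (W B d))
  /-- The Shannon entropy inequality. -/
  shannon_le : ∀ᵐ t ∂(volume.restrict (Ioi (0 : ℝ))),
    (∫⁻ x in Ω, ∫⁻ w, ENNReal.ofReal (shannon w.1) ∂(μ (x, t) : Measure (W B d)))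
      + (∫⁻ z in Ω ×ˢ Ioo 0 t, ∫⁻ w, ENNReal.ofReal (normSqSqrtB B w.2)
          ∂(μ z : Measure (W B d)))
      ≤ ∫⁻ x in Ω, ENNReal.ofReal (shannon (uin x))
  /-- The Rao entropy inequality. -/
  rao_le : ∀ᵐ t ∂(volume.restrict (Ioi (0 : ℝ))),
    (∫⁻ x in Ω, ENNReal.ofReal (rao B (baryS μ (x, t))))
      + (∑ i, ∫⁻ z in Ω ×ˢ Ioo 0 t, ∫⁻ w,
          ENNReal.ofReal ((w.1 i : ℝ) * ∑ k, (mulB B (w.2 k : E n) i) ^ 2)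
          ∂(μ z : Measure (W B d)))
      ≤ ∫⁻ x in Ω, ENNReal.ofReal (rao B (vec (uin x)))
  /-- The evolution equation. -/
  evolution : ∀ T : ℝ, 0 < T → ∀ i, IsWeakContinuityEq Ω T (fun z => baryS μ z i)
    (fun k z => flux μ i k z) (fun x => (uin x i : ℝ))

end MeasureValued

/-- `∇v̂ ∈ (L^⊥)^d` at a point of space-time. -/
noncomputable def gradHat {n d : ℕ} (B : Matrix (Fin n) (Fin n) ℝ) (v : E d × ℝ → Fin n → ℝ≥0)
    (z : E d × ℝ) : Fin d → perpB B :=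
  fun k => dx k (fun z' => hat B (vec (v z'))) z

end SegCD

open SegCD

/-! The proof is a relative entropy argument that uses the Shannon and the Rao entropy together. The
distance of `μ` to `v` is measured by E(t) = ∫_Ω ⟨μ, ∑ᵢ sᵢ log(sᵢ/vᵢ) - sᵢ + vᵢ⟩ dx. The Rao
counterpart ½ ∫_Ω (u-v)ᵀB(u-v) dx enters only through its sign at time t and its vanishing at time
0.

Write G = ∇v. Adding the two relative entropy inequalities bounds E(t) by the integral over Ω ×
(0,t) of the average under `μ` of -|B^{1/2}(p-G)|² - ∑ᵢ sᵢ|(B(p-G))ᵢ|² + ∑ᵢ (sᵢ-vᵢ) (B(p-G))ᵢ ·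
∇(log vᵢ - (Bv)ᵢ), which is `production`. The last term is the difficulty: the relative Shannon
entropy grows only like s log s and cannot control (sᵢ-vᵢ)². Splitting s-v = (√s-√v)(√s+√v) and
using Young's inequality (`cross_term_le`) leaves three pieces. The one with weight sᵢ is absorbed
by the Rao dissipation. The one with weight vᵢ is absorbed by the Shannon dissipation, because v is
bounded and (Bz)ᵢ² ≤ bᵢᵢ zᵀBz (`mulB_sq_le`). The one with (√s-√v)² is bounded by the relative
entropy density (`sq_sqrt_sub_sqrt_le_relEnt`). Thus `exists_production_le` gives E(t) + ½ ∫∫ ⟨μ,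
|B^{1/2}(p-G)|²⟩ ≤ C ∫₀ᵗ E, and Gronwall's inequality makes E and the dissipation vanish. Then s = v
almost surely, and p - ∇v lies in ker B. As p takes values in L^⊥, p = ∇v̂
(`FiniteMoments.eq_dirac`).

To derive the bound on E one must integrate by parts against u, of which only û has a weak gradient,
while v is merely C¹. Testing the equation of v with φ/vᵢ shows that ∇(Bv)ᵢ has zero normal flux and
the bounded weak divergence `lapPot` (`isZeroFlux_pot`). The vector of these divergences is
orthogonal to ker B, so u may be replaced by û (`sum_mul_lapPot_hat`). Finally, the weak gradient of
û is tested only with functions compactly supported in the open cylinder, whereas ∇(Bv)ᵢ need not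
vanish near ∂Ω. `integral_pairing_eq_zero` bridges this gap by mollifying the field with kernels
shifted into the Lipschitz domain. -/

lemma MeasureTheory.Integrable.fun_sub {α : Type*} [MeasurableSpace α] {m : Measure α}
    {f g : α → ℝ} (hf : Integrable f m) (hg : Integrable g m) :
    Integrable (fun x => f x - g x) m :=
  hf.sub hg

namespace SegCD

/-! ### The relative entropy density -/

/-- The relative Shannon entropy density `s log (s / v) - s + v`, in expanded form. -/
noncomputable def relEnt (s v : ℝ) : ℝ := (s * (Real.log s - 1) + 1) - s * Real.log v + (v - 1)

/-- This is log x ≤ x - 1 at x = √v/√s, multiplied by 2s. The Hellinger-type quantity on the left is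
as much of a square as an entropy of growth s log s can control globally in s. -/
lemma sq_sqrt_sub_sqrt_le_relEnt {s v : ℝ} (hs : 0 ≤ s) (hv : 0 < v) :
    (√s - √v) ^ 2 ≤ relEnt s v := by
  have hsq : (√s - √v) ^ 2 = s - 2 * (√s * √v) + v := by
    rw [sub_sq, Real.sq_sqrt hs, Real.sq_sqrt hv.le]; ring
  rw [hsq, relEnt]
  -- At s = 0 the logarithm is multiplied by zero, so its default value is harmless and both sides
  -- equal v.
  rcases hs.eq_or_lt with rfl | hs
  · simp
  have h := Real.log_le_sub_one_of_pos (x := √v / √s) (by positivity)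
  rw [Real.log_div (by positivity) (by positivity), Real.log_sqrt hv.le, Real.log_sqrt hs.le] at h
  have h2 : s * (√v / √s) = √s * √v := by
    field_simp
    rw [Real.sq_sqrt hs.le]
  nlinarith [mul_le_mul_of_nonneg_left h hs.le]

lemma relEnt_nonneg {s v : ℝ} (hs : 0 ≤ s) (hv : 0 < v) : 0 ≤ relEnt s v :=
  (sq_nonneg _).trans (sq_sqrt_sub_sqrt_le_relEnt hs hv)

lemma eq_of_relEnt_eq_zero {s v : ℝ} (hs : 0 ≤ s) (hv : 0 < v) (h : relEnt s v = 0) : s = v := by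
  have h1 := sq_sqrt_sub_sqrt_le_relEnt hs hv
  rw [h] at h1
  have h2 : √s - √v = 0 := pow_eq_zero_iff two_ne_zero |>.1 (le_antisymm h1 (sq_nonneg _))
  exact (Real.sqrt_inj hs hv.le).1 (sub_eq_zero.1 h2)

/-- With a = √s and b = √v, factor s - v = (a-b)(a+b), complete the square, and use (a+b)² ≤
2(a²+b²). The weight s + v on q² is what the two dissipations can absorb: s by Rao, v by Shannon. -/
lemma cross_term_le {s v δ : ℝ} (hs : 0 ≤ s) (hv : 0 ≤ v) (hδ : 0 < δ) (q r : ℝ) :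
    (s - v) * (q * r) ≤ δ * (s + v) * q ^ 2 + 1 / (2 * δ) * r ^ 2 * (√s - √v) ^ 2 := by
  set a := √s
  set b := √v
  have ha : s = a ^ 2 := (Real.sq_sqrt hs).symm
  have hb : v = b ^ 2 := (Real.sq_sqrt hv).symm
  rw [ha, hb]
  have h1 : (a ^ 2 - b ^ 2) * (q * r) ≤ δ * (a + b) ^ 2 / 2 * q ^ 2
      + 1 / (2 * δ) * r ^ 2 * (a - b) ^ 2 := by
    have : δ * (a + b) ^ 2 / 2 * q ^ 2 + 1 / (2 * δ) * r ^ 2 * (a - b) ^ 2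
        - (a ^ 2 - b ^ 2) * (q * r) = 1 / (2 * δ) * (δ * (a + b) * q - r * (a - b)) ^ 2 := by
      field_simp; ring
    have h0 : 0 ≤ 1 / (2 * δ) * (δ * (a + b) * q - r * (a - b)) ^ 2 := by positivity
    linarith
  have h2 : δ * (a + b) ^ 2 / 2 * q ^ 2 ≤ δ * (a ^ 2 + b ^ 2) * q ^ 2 := by
    have : 0 ≤ δ * (a - b) ^ 2 / 2 * q ^ 2 := by positivity
    nlinarith
  linarith

/-! ### The quadratic form of the diffusion matrix -/

section Quad

variable {n d : ℕ} {B : Matrix (Fin n) (Fin n) ℝ}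

/-- The quadratic form `z^T B z`. -/
noncomputable def quad (B : Matrix (Fin n) (Fin n) ℝ) (z : E n) : ℝ :=
  ∑ i, mulB B z i * z i

lemma mulB_sub (z w : E n) (i : Fin n) : mulB B (z - w) i = mulB B z i - mulB B w i := by
  simp [mulB, mul_sub, Finset.sum_sub_distrib]

lemma mulB_smul (c : ℝ) (z : E n) (i : Fin n) : mulB B (c • z) i = c * mulB B z i := by
  simp only [mulB, PiLp.smul_apply, smul_eq_mul, Finset.mul_sum]
  exact Finset.sum_congr rfl fun j _ => by ring

lemma sum_mulB_comm (hB : B.IsHermitian) (z w : E n) :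
    ∑ i, mulB B z i * w i = ∑ i, mulB B w i * z i := by
  simp only [mulB, Finset.sum_mul]
  rw [Finset.sum_comm]
  refine Finset.sum_congr rfl fun i _ => Finset.sum_congr rfl fun j _ => ?_
  have : B j i = B i j := by simpa using hB.apply i j
  rw [this]; ring

lemma quad_eq_sum (z : E n) : quad B z = ∑ i, ∑ j, B i j * z i * z j := by
  simp only [quad, mulB, Finset.sum_mul]
  exact Finset.sum_congr rfl fun i _ => Finset.sum_congr rfl fun j _ => by ring

lemma quad_eq_dotProduct (z : E n) : quad B z = z.ofLp ⬝ᵥ B.mulVec z.ofLp := by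
  simp only [quad, mulB, dotProduct, Matrix.mulVec]
  exact Finset.sum_congr rfl fun i _ => mul_comm _ _

lemma quad_nonneg (hB : B.PosSemidef) (z : E n) : 0 ≤ quad B z := by
  rw [quad_eq_dotProduct]
  simpa using hB.dotProduct_mulVec_nonneg z.ofLp

lemma quad_sub (hB : B.IsHermitian) (z w : E n) :
    quad B (z - w) = quad B z - 2 * ∑ i, mulB B z i * w i + quad B w := by
  have h : ∑ i, mulB B z i * w i = ∑ i, mulB B w i * z i := sum_mulB_comm hB z w
  have : quad B (z - w) = quad B z - ∑ i, mulB B z i * w i - ∑ i, mulB B w i * z i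
      + quad B w := by
    simp only [quad, mulB_sub, PiLp.sub_apply]
    rw [← Finset.sum_sub_distrib, ← Finset.sum_sub_distrib, ← Finset.sum_add_distrib]
    exact Finset.sum_congr rfl fun i _ => by ring
  rw [this, ← h]; ring

lemma mem_kerB_iff {z : E n} : z ∈ kerB B ↔ ∀ i, mulB B z i = 0 := by
  rw [kerB, LinearMap.mem_ker]
  constructor
  · intro h i
    have := congrArg (fun f : E n => f i) h
    simpa [mulB, Matrix.mulVec, dotProduct] using this
  · intro h
    ext i
    simpa [mulB, Matrix.mulVec, dotProduct] using h i

lemma mem_kerB_of_quad_eq_zero (hB : B.PosSemidef) {z : E n} (h : quad B z = 0) : z ∈ kerB B := by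
  rw [quad_eq_dotProduct] at h
  have := (hB.dotProduct_mulVec_zero_iff z.ofLp).1 (by simpa using h)
  rw [mem_kerB_iff]
  intro i
  have h2 := congrFun this i
  simpa [mulB, Matrix.mulVec, dotProduct] using h2

/-- Cauchy-Schwarz for the quadratic form, tested with a coordinate vector. -/
lemma mulB_sq_le (hB : B.PosSemidef) (hd : ∀ i, 0 < B i i) (z : E n) (i : Fin n) :
    mulB B z i ^ 2 ≤ B i i * quad B z := by
  set e : E n := EuclideanSpace.single i (1 : ℝ)
  have he : quad B e = B i i := by
    simp [quad, mulB, e]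
  have hz : ∑ j, mulB B z j * e j = mulB B z i := by
    simp [e]
  -- The multiple of the coordinate vector is the one minimising the quadratic form, so
  -- nonnegativity is already the Cauchy-Schwarz inequality.
  have h := quad_nonneg hB (z - (mulB B z i / B i i) • e)
  rw [quad_sub hB.1] at h
  have h1 : ∑ j, mulB B z j * ((mulB B z i / B i i) • e) j = mulB B z i / B i i * mulB B z i := by
    rw [← hz, Finset.mul_sum]
    refine Finset.sum_congr rfl fun j _ => ?_
    rw [PiLp.smul_apply, smul_eq_mul, hz]; ring
  have h2 : quad B ((mulB B z i / B i i) • e) = (mulB B z i / B i i) ^ 2 * B i i := by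
    rw [← he, quad, quad, Finset.mul_sum]
    refine Finset.sum_congr rfl fun j _ => ?_
    rw [mulB_smul, PiLp.smul_apply, smul_eq_mul]; ring
  rw [h1, h2] at h
  have hb := hd i
  have h3 : (mulB B z i / B i i) ^ 2 * B i i = mulB B z i ^ 2 / B i i := by
    field_simp
  have h4 : mulB B z i / B i i * mulB B z i = mulB B z i ^ 2 / B i i := by
    field_simp
  rw [h3, h4] at h
  have h5 : mulB B z i ^ 2 / B i i ≤ quad B z := by linarith
  rw [div_le_iff₀ hb] at h5
  linarith

lemma normSqSqrtB_eq (p : Fin d → perpB B) : normSqSqrtB B p = ∑ k, quad B (p k : E n) := by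
  simp only [normSqSqrtB, quad_eq_sum]

lemma rao_eq (z : E n) : rao B z = 1 / 2 * quad B z := by
  rw [rao, quad_eq_sum]

lemma shannon_nonneg (s : Fin n → ℝ≥0) : 0 ≤ shannon s := by
  refine Finset.sum_nonneg fun i _ => ?_
  have := relEnt_nonneg (s i).2 one_pos
  simpa [relEnt] using this

/-- The relative entropy of a state with respect to a positive vector. -/
lemma sum_relEnt (s : Fin n → ℝ≥0) (V : Fin n → ℝ) :
    ∑ i, relEnt (s i) (V i) = shannon s - ∑ i, (s i : ℝ) * Real.log (V i) + ∑ i, (V i - 1) := by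
  simp only [relEnt, shannon, Finset.sum_add_distrib, Finset.sum_sub_distrib]

/-! ### The entropy production -/

/-- The total entropy production density at a state `(s, p)` relative to a positive vector `V` with
gradient `G`. -/
noncomputable def production (B : Matrix (Fin n) (Fin n) ℝ) (V : Fin n → ℝ) (G : Fin d → E n)
    (s : Fin n → ℝ) (p : Fin d → E n) : ℝ :=
  -∑ k, quad B (p k - G k) - ∑ i, s i * ∑ k, mulB B (p k - G k) i ^ 2
    + ∑ i, ∑ k, (s i - V i) * (mulB B (p k - G k) i * (G k i / V i - mulB B (G k) i))

/-- In the expanded form, each term is an entropy production, a multiple of a flux sᵢ(Bp)ᵢ, or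
affine in s or p alone. Its average is therefore expressed by the moments occurring in the
definition of a dissipative solution, with no need to factor averages of products. -/
lemma production_eq (hB : B.IsHermitian) {V : Fin n → ℝ} (hV : ∀ i, V i ≠ 0) (G : Fin d → E n)
    (s : Fin n → ℝ) (p : Fin d → E n) :
    production B V G s p = -∑ k, quad B (p k) + ∑ k, ∑ i, mulB B (p k) i * G k i
      + ∑ i, ∑ k, (s i * mulB B (p k) i - s i * mulB B (G k) i) * (G k i / V i)
      - ∑ i, s i * ∑ k, mulB B (p k) i ^ 2 + ∑ i, ∑ k, s i * mulB B (p k) i * mulB B (G k) i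
      + ∑ i, ∑ k, V i * mulB B (G k) i * (mulB B (p k) i - mulB B (G k) i) := by
  have hq : ∀ k, quad B (p k - G k)
      = quad B (p k) - ∑ i, (2 * (mulB B (p k) i * G k i) - mulB B (G k) i * G k i) := by
    intro k
    rw [quad_sub hB, Finset.sum_sub_distrib, Finset.mul_sum, quad, quad]
    ring
  have hc1 : ∑ k, ∑ i, mulB B (p k) i * G k i = ∑ i, ∑ k, mulB B (p k) i * G k i :=
    Finset.sum_comm
  rw [production, Finset.sum_congr rfl fun k _ => hq k, Finset.sum_sub_distrib, hc1,
    Finset.sum_comm (f := fun k i => 2 * (mulB B (p k) i * G k i) - mulB B (G k) i * G k i)]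
  have hc2 : ∀ (f : Fin d → ℝ) (i : Fin n), s i * ∑ k, f k = ∑ k, s i * f k :=
    fun f i => Finset.mul_sum _ _ _
  simp only [hc2, mulB_sub]
  rw [← sub_eq_zero]
  -- After symmetry of B has removed the quadratic forms of p, the identity holds separately for
  -- each pair (i, k).
  have key : ∀ i k, (2 * (mulB B (p k) i * G k i) - mulB B (G k) i * G k i)
      - s i * (mulB B (p k) i - mulB B (G k) i) ^ 2
      + (s i - V i) * ((mulB B (p k) i - mulB B (G k) i) * (G k i / V i - mulB B (G k) i))
      - mulB B (p k) i * G k i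
      - (s i * mulB B (p k) i - s i * mulB B (G k) i) * (G k i / V i)
      + s i * mulB B (p k) i ^ 2 - s i * mulB B (p k) i * mulB B (G k) i
      - V i * mulB B (G k) i * (mulB B (p k) i - mulB B (G k) i) = 0 := by
    intro i k
    have := hV i
    field_simp
    ring
  have hsum := Finset.sum_eq_zero fun i (_ : i ∈ Finset.univ) =>
    Finset.sum_eq_zero fun k (_ : k ∈ Finset.univ) => key i k
  simp only [Finset.sum_add_distrib, Finset.sum_sub_distrib] at hsum ⊢
  linarith

/-- The total entropy production is dominated by the relative entropy. -/
lemma exists_production_le (hB : IsAdmissible B) {M N : ℝ} (hM : 0 ≤ M) :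
    ∃ C : ℝ, 0 ≤ C ∧ ∀ (V : Fin n → ℝ) (G : Fin d → E n), (∀ i, 0 < V i) → (∀ i, V i ≤ M) →
      (∀ i k, |G k i / V i - mulB B (G k) i| ≤ N) →
      ∀ (s : Fin n → ℝ) (p : Fin d → E n), (∀ i, 0 ≤ s i) →
        production B V G s p
          ≤ -(1 / 2 * ∑ k, quad B (p k - G k)) + C * ∑ i, relEnt (s i) (V i) := by
  obtain ⟨b, hbB⟩ : ∃ b, b = ∑ i, B i i := ⟨_, rfl⟩
  have hb : 0 ≤ b := hbB ▸ Finset.sum_nonneg fun i _ => (hB.diag_pos i).le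
  -- One choice meets two demands: δ ≤ 1/2 lets the Rao dissipation absorb the part with weight s,
  -- and δ M tr B ≤ 1/2 lets half of the Shannon dissipation absorb the part with weight v.
  set δ := 1 / (2 * (1 + M * b))
  have hδ : 0 < δ := by positivity
  have hδ1 : δ ≤ 1 / 2 := by
    apply one_div_le_one_div_of_le (by norm_num)
    nlinarith [mul_nonneg hM hb]
  have hδ2 : δ * (M * b) ≤ 1 / 2 := by
    have : 0 ≤ M * b := by positivity
    rw [show δ = 1 / (2 * (1 + M * b)) from rfl]
    rw [div_mul_eq_mul_div, div_le_iff₀ (by positivity)]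
    linarith
  -- The factor d appears because the relative entropy is picked up once for every space direction
  -- k.
  refine ⟨d * (1 / (2 * δ) * N ^ 2), by positivity, fun V G hV hVM hN s p hs => ?_⟩
  have h1 : ∀ i k, (s i - V i) * (mulB B (p k - G k) i * (G k i / V i - mulB B (G k) i))
      ≤ 1 / 2 * (s i * mulB B (p k - G k) i ^ 2) + δ * M * (B i i * quad B (p k - G k))
        + 1 / (2 * δ) * N ^ 2 * relEnt (s i) (V i) := by
    intro i k
    refine (cross_term_le (hs i) (hV i).le hδ _ _).trans ?_
    have e1 : δ * (s i + V i) * mulB B (p k - G k) i ^ 2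
        = δ * (s i * mulB B (p k - G k) i ^ 2) + δ * V i * mulB B (p k - G k) i ^ 2 := by ring
    have e2 : δ * (s i * mulB B (p k - G k) i ^ 2) ≤ 1 / 2 * (s i * mulB B (p k - G k) i ^ 2) :=
      mul_le_mul_of_nonneg_right hδ1 (mul_nonneg (hs i) (sq_nonneg _))
    have e3 : δ * V i * mulB B (p k - G k) i ^ 2 ≤ δ * M * (B i i * quad B (p k - G k)) :=
      mul_le_mul (mul_le_mul_of_nonneg_left (hVM i) hδ.le)
        (mulB_sq_le hB.posSemidef hB.diag_pos _ _) (sq_nonneg _) (by positivity)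
    have e4 : 1 / (2 * δ) * (G k i / V i - mulB B (G k) i) ^ 2 * (√(s i) - √(V i)) ^ 2
        ≤ 1 / (2 * δ) * N ^ 2 * relEnt (s i) (V i) := by
      refine mul_le_mul (mul_le_mul_of_nonneg_left ?_ (by positivity))
        (sq_sqrt_sub_sqrt_le_relEnt (hs i) (hV i)) (sq_nonneg _) (by positivity)
      exact sq_le_sq' (abs_le.1 (hN i k)).1 (abs_le.1 (hN i k)).2
    linarith
  have h2 := Finset.sum_le_sum fun i (_ : i ∈ Finset.univ) =>
    Finset.sum_le_sum fun k (_ : k ∈ Finset.univ) => h1 i k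
  simp only [Finset.sum_add_distrib, ← Finset.mul_sum, Finset.sum_const, Finset.card_univ,
    Fintype.card_fin, nsmul_eq_mul, ← Finset.sum_mul] at h2
  rw [production]
  have hD : 0 ≤ ∑ k, quad B (p k - G k) :=
    Finset.sum_nonneg fun k _ => quad_nonneg hB.posSemidef _
  have h3 : δ * M * (b * ∑ k, quad B (p k - G k)) ≤ 1 / 2 * ∑ k, quad B (p k - G k) := by
    have := mul_le_mul_of_nonneg_right hδ2 hD
    linarith
  -- The unused half of the Rao dissipation is discarded. Half of the Shannon dissipation is kept,
  -- as it will identify p.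
  have h4 : 0 ≤ ∑ i, s i * ∑ k, mulB B (p k - G k) i ^ 2 :=
    Finset.sum_nonneg fun i _ => mul_nonneg (hs i) (Finset.sum_nonneg fun k _ => sq_nonneg _)
  rw [← hbB] at h2
  simp only [← Finset.mul_sum] at h2 ⊢
  linarith

/-! ### Probability measures on the state space -/

/-- All moments entering the entropy inequalities are finite. -/
structure FiniteMoments (ν : Measure (W B d)) : Prop where
  density : ∀ i, Integrable (fun w : W B d => (w.1 i : ℝ)) ν
  gradient : ∀ k, Integrable (fun w : W B d => w.2 k) ν
  entropy : Integrable (fun w : W B d => shannon w.1) ν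
  shannonProd : Integrable (fun w : W B d => normSqSqrtB B w.2) ν
  raoProd : ∀ i, Integrable (fun w : W B d => (w.1 i : ℝ) * ∑ k, mulB B (w.2 k : E n) i ^ 2) ν

/-- `z ↦ (B z)_i` as a continuous linear functional. -/
noncomputable def mulBL (B : Matrix (Fin n) (Fin n) ℝ) (i : Fin n) : E n →L[ℝ] ℝ :=
  ∑ j, B i j • (EuclideanSpace.proj j : E n →L[ℝ] ℝ)

lemma mulBL_apply (i : Fin n) (z : E n) : mulBL B i z = mulB B z i := by
  simp [mulBL, mulB]

lemma continuous_mulB (i : Fin n) : Continuous fun z : E n => mulB B z i := by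
  simp only [← mulBL_apply]
  exact (mulBL B i).continuous

lemma continuous_quad : Continuous fun z : E n => quad B z := by
  unfold quad
  exact continuous_finsetSum _ fun i _ => (continuous_mulB i).mul (by fun_prop)

lemma continuous_density (i : Fin n) : Continuous fun w : W B d => (w.1 i : ℝ) := by fun_prop

lemma continuous_grad (k : Fin d) : Continuous fun w : W B d => (w.2 k : E n) := by fun_prop

lemma continuous_mulB_grad (i : Fin n) (k : Fin d) :
    Continuous fun w : W B d => mulB B (w.2 k : E n) i :=
  (continuous_mulB i).comp (continuous_grad k)

/-! ### Averages under a single probability measure with finite moments -/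

namespace FiniteMoments

variable {ν : Measure (W B d)}

lemma mulB_grad (h : FiniteMoments ν) (i : Fin n) (k : Fin d) :
    Integrable (fun w : W B d => mulB B (w.2 k : E n) i) ν := by
  have := ((mulBL B i).comp (perpB B).subtypeL).integrable_comp (h.gradient k)
  simpa [mulBL_apply] using this

lemma integral_mulB_grad (h : FiniteMoments ν) (i : Fin n) (k : Fin d) :
    ∫ w : W B d, mulB B (w.2 k : E n) i ∂ν = mulB B ((∫ w : W B d, w.2 k ∂ν : perpB B) : E n) i := by
  have := ((mulBL B i).comp (perpB B).subtypeL).integral_comp_comm (h.gradient k)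
  simpa [mulBL_apply] using this

lemma flux_sq (h : FiniteMoments ν) (i : Fin n) (k : Fin d) :
    Integrable (fun w : W B d => (w.1 i : ℝ) * mulB B (w.2 k : E n) i ^ 2) ν := by
  refine (h.raoProd i).mono' ?_ (Filter.Eventually.of_forall fun w => ?_)
  · exact ((continuous_density i).mul ((continuous_mulB_grad i k).pow 2)).aestronglyMeasurable
  · rw [Real.norm_of_nonneg (by positivity)]
    exact mul_le_mul_of_nonneg_left (Finset.single_le_sum
      (f := fun k => mulB B (w.2 k : E n) i ^ 2) (fun _ _ => sq_nonneg _) (Finset.mem_univ k))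
      (w.1 i).2

/-- Since |q| ≤ 1 + q², the flux is dominated by the density plus the Rao production. -/
lemma flux (h : FiniteMoments ν) (i : Fin n) (k : Fin d) :
    Integrable (fun w : W B d => (w.1 i : ℝ) * mulB B (w.2 k : E n) i) ν := by
  refine ((h.density i).add (h.flux_sq i k)).mono' ?_ (Filter.Eventually.of_forall fun w => ?_)
  · exact ((continuous_density i).mul (continuous_mulB_grad i k)).aestronglyMeasurable
  · rw [norm_mul, Real.norm_of_nonneg (NNReal.coe_nonneg _), Real.norm_eq_abs, Pi.add_apply]
    have h1 : |mulB B (w.2 k : E n) i| ≤ 1 + mulB B (w.2 k : E n) i ^ 2 := by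
      rw [abs_le]; constructor <;> nlinarith [sq_nonneg (mulB B (w.2 k : E n) i - 1),
        sq_nonneg (mulB B (w.2 k : E n) i + 1)]
    have h2 := mul_le_mul_of_nonneg_left h1 (w.1 i).2
    simp only [NNReal.val_eq_coe] at h2
    linarith

variable [IsProbabilityMeasure ν]

lemma quad_sum (h : FiniteMoments ν) (hB : B.IsHermitian) (G : Fin d → E n) :
    Integrable (fun w : W B d => ∑ k, quad B ((w.2 k : E n) - G k)) ν := by
  have e : (fun w : W B d => ∑ k, quad B ((w.2 k : E n) - G k)) = fun w =>
      normSqSqrtB B w.2 - ∑ k, 2 * ∑ i, mulB B (w.2 k : E n) i * G k i + ∑ k, quad B (G k) := by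
    funext w
    rw [normSqSqrtB_eq, ← Finset.sum_sub_distrib, ← Finset.sum_add_distrib]
    exact Finset.sum_congr rfl fun k _ => quad_sub hB _ _
  rw [e]
  exact (h.shannonProd.sub (integrable_finsetSum _ fun k _ => (integrable_finsetSum _ fun i _ =>
    (h.mulB_grad i k).mul_const _).const_mul _)).add (integrable_const _)

lemma relEnt_sum (h : FiniteMoments ν) (V : Fin n → ℝ) :
    Integrable (fun w : W B d => ∑ i, relEnt (w.1 i) (V i)) ν := by
  simp only [sum_relEnt]
  exact (h.entropy.sub (integrable_finsetSum _ fun i _ => (h.density i).mul_const _)).add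
    (integrable_const _)

lemma integral_relEnt_sum (h : FiniteMoments ν) (V : Fin n → ℝ) :
    ∫ w : W B d, ∑ i, relEnt (w.1 i) (V i) ∂ν = ∫ w : W B d, shannon w.1 ∂ν
      - ∑ i, (∫ w : W B d, (w.1 i : ℝ) ∂ν) * Real.log (V i) + ∑ i, (V i - 1) := by
  have h1 : ∀ i ∈ Finset.univ, Integrable (fun w : W B d => (w.1 i : ℝ) * Real.log (V i)) ν :=
    fun i _ => (h.density i).mul_const _
  simp only [sum_relEnt]
  rw [integral_add (h.entropy.fun_sub (integrable_finsetSum _ h1)) (integrable_const _),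
    integral_sub h.entropy (integrable_finsetSum _ h1), integral_finsetSum _ h1]
  simp [integral_mul_const]

/-- The averaged entropy production is dominated by the averaged relative entropy. -/
lemma averaged_production_le (h : FiniteMoments ν) (hB : IsAdmissible B) {V : Fin n → ℝ}
    (hV : ∀ i, 0 < V i) (G : Fin d → E n) {C : ℝ}
    (hC : ∀ (s : Fin n → ℝ) (p : Fin d → E n), (∀ i, 0 ≤ s i) → production B V G s p
      ≤ -(1 / 2 * ∑ k, quad B (p k - G k)) + C * ∑ i, relEnt (s i) (V i)) :
    -(∫ w : W B d, normSqSqrtB B w.2 ∂ν)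
      + ∑ k, ∑ i, mulB B ((∫ w : W B d, w.2 k ∂ν : perpB B) : E n) i * G k i
      + ∑ i, ∑ k, ((∫ w : W B d, (w.1 i : ℝ) * mulB B (w.2 k : E n) i ∂ν)
          - (∫ w : W B d, (w.1 i : ℝ) ∂ν) * mulB B (G k) i) * (G k i / V i)
      - ∑ i, (∫ w : W B d, (w.1 i : ℝ) * ∑ k, mulB B (w.2 k : E n) i ^ 2 ∂ν)
      + ∑ i, ∑ k, (∫ w : W B d, (w.1 i : ℝ) * mulB B (w.2 k : E n) i ∂ν) * mulB B (G k) i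
      + ∑ i, ∑ k, V i * mulB B (G k) i
          * (mulB B ((∫ w : W B d, w.2 k ∂ν : perpB B) : E n) i - mulB B (G k) i)
    ≤ -(1 / 2 * ∫ w : W B d, ∑ k, quad B ((w.2 k : E n) - G k) ∂ν)
      + C * ∫ w : W B d, ∑ i, relEnt (w.1 i) (V i) ∂ν := by
  have hs : ∀ {m : ℕ} {f : Fin m → W B d → ℝ}, (∀ i, Integrable (f i) ν) →
      Integrable (fun w => ∑ i, f i w) ν := fun hf => integrable_finsetSum _ fun i _ => hf i
  have i1 := h.shannonProd
  have i2 : Integrable (fun w : W B d => ∑ k, ∑ i, mulB B (w.2 k : E n) i * G k i) ν :=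
    hs fun k => hs fun i => (h.mulB_grad i k).mul_const _
  have i3' : ∀ i k, Integrable (fun w : W B d => ((w.1 i : ℝ) * mulB B (w.2 k : E n) i
      - (w.1 i : ℝ) * mulB B (G k) i) * (G k i / V i)) ν := fun i k =>
    ((h.flux i k).sub ((h.density i).mul_const _)).mul_const _
  have i4 : Integrable (fun w : W B d => ∑ i, (w.1 i : ℝ) * ∑ k, mulB B (w.2 k : E n) i ^ 2) ν :=
    hs h.raoProd
  have i5' : ∀ i k, Integrable (fun w : W B d => (w.1 i : ℝ) * mulB B (w.2 k : E n) i
      * mulB B (G k) i) ν := fun i k => (h.flux i k).mul_const _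
  have i6' : ∀ i k, Integrable (fun w : W B d => V i * mulB B (G k) i
      * (mulB B (w.2 k : E n) i - mulB B (G k) i)) ν := fun i k =>
    ((h.mulB_grad i k).sub (integrable_const _)).const_mul _
  have i3 := hs fun i => hs fun k => i3' i k
  have i5 := hs fun i => hs fun k => i5' i k
  have i6 := hs fun i => hs fun k => i6' i k
  have e3 : ∀ i k, ∫ w : W B d, ((w.1 i : ℝ) * mulB B (w.2 k : E n) i
      - (w.1 i : ℝ) * mulB B (G k) i) * (G k i / V i) ∂ν
      = ((∫ w : W B d, (w.1 i : ℝ) * mulB B (w.2 k : E n) i ∂ν)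
          - (∫ w : W B d, (w.1 i : ℝ) ∂ν) * mulB B (G k) i) * (G k i / V i) := fun i k => by
    rw [integral_mul_const, integral_sub (h.flux i k) ((h.density i).mul_const _),
      integral_mul_const]
  have e6 : ∀ i k, ∫ w : W B d, V i * mulB B (G k) i
      * (mulB B (w.2 k : E n) i - mulB B (G k) i) ∂ν = V i * mulB B (G k) i
          * (mulB B ((∫ w : W B d, w.2 k ∂ν : perpB B) : E n) i - mulB B (G k) i) := fun i k => by
    rw [integral_const_mul, integral_sub (h.mulB_grad i k) (integrable_const _),
      h.integral_mulB_grad]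
    simp
  -- The pointwise bound is averaged. Its left side, in the expanded form of `production_eq`, then
  -- turns term by term into moments.
  have hle := integral_mono (μ := ν)
    (f := fun w : W B d => production B V G (fun i => (w.1 i : ℝ)) (fun k => (w.2 k : E n)))
    (g := fun w : W B d => -(1 / 2 * ∑ k, quad B ((w.2 k : E n) - G k))
      + C * ∑ i, relEnt (w.1 i) (V i)) ?_ ?_ (fun w => hC _ _ fun i => (w.1 i).2)
  · rw [integral_add ((h.quad_sum hB.posSemidef.1 G).const_mul _).fun_neg
      ((h.relEnt_sum V).const_mul _), integral_neg, integral_const_mul, integral_const_mul] at hle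
    refine le_trans (le_of_eq ?_) hle
    simp only [production_eq hB.posSemidef.1 (fun i => (hV i).ne'), ← normSqSqrtB_eq]
    rw [integral_add ((((i1.fun_neg.fun_add i2).fun_add i3).fun_sub i4).fun_add i5) i6,
      integral_add (((i1.fun_neg.fun_add i2).fun_add i3).fun_sub i4) i5,
      integral_sub ((i1.fun_neg.fun_add i2).fun_add i3) i4, integral_add (i1.fun_neg.fun_add i2) i3,
      integral_add i1.fun_neg i2, integral_neg, integral_finsetSum _ fun i _ => h.raoProd i,
      integral_finsetSum _ fun i _ => hs (i3' i), integral_finsetSum _ fun i _ => hs (i5' i),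
      integral_finsetSum _ fun i _ => hs (i6' i),
      integral_finsetSum _ fun k _ => hs fun i => (h.mulB_grad i k).mul_const _]
    congr 1; congr 1; congr 1; congr 1; congr 1
    · refine Finset.sum_congr rfl fun k _ => ?_
      rw [integral_finsetSum _ fun i _ => (h.mulB_grad i k).mul_const _]
      exact Finset.sum_congr rfl fun i _ => by rw [integral_mul_const, h.integral_mulB_grad]
    · refine Finset.sum_congr rfl fun i _ => ?_
      rw [integral_finsetSum _ fun k _ => i3' i k]
      exact Finset.sum_congr rfl fun k _ => (e3 i k).symm
    · refine Finset.sum_congr rfl fun i _ => ?_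
      rw [integral_finsetSum _ fun k _ => i5' i k]
      exact Finset.sum_congr rfl fun k _ => (integral_mul_const _ _).symm
    · refine Finset.sum_congr rfl fun i _ => ?_
      rw [integral_finsetSum _ fun k _ => i6' i k]
      exact Finset.sum_congr rfl fun k _ => (e6 i k).symm
  · simp only [production_eq hB.posSemidef.1 (fun i => (hV i).ne'), ← normSqSqrtB_eq]
    exact (((((i1.fun_neg.fun_add i2).fun_add i3).fun_sub i4).fun_add i5).add i6)
  · exact ((h.quad_sum hB.posSemidef.1 G).const_mul _).neg.add ((h.relEnt_sum V).const_mul _)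

/-- If the relative entropy and the relative production vanish, the measure is a Dirac measure. -/
lemma eq_dirac (h : FiniteMoments ν) (hB : IsAdmissible B) {V : Fin n → ℝ≥0}
    (hV : ∀ i, 0 < V i) (G : Fin d → E n)
    (h0 : ∫ w : W B d, ∑ i, relEnt (w.1 i) (V i) ∂ν = 0)
    (h1 : ∫ w : W B d, ∑ k, quad B ((w.2 k : E n) - G k) ∂ν = 0) :
    ν = (Measure.dirac V).prod (Measure.dirac fun k => hat B (G k)) := by
  have hr : ∀ (w : W B d) i, 0 ≤ relEnt (w.1 i) (V i) := fun w i =>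
    relEnt_nonneg (w.1 i).2 (hV i)
  have hq : ∀ (w : W B d) k, 0 ≤ quad B ((w.2 k : E n) - G k) := fun w k =>
    quad_nonneg hB.posSemidef _
  rw [integral_eq_zero_iff_of_nonneg (fun w => Finset.sum_nonneg fun i _ => hr w i)
    (h.relEnt_sum _)] at h0
  rw [integral_eq_zero_iff_of_nonneg (fun w => Finset.sum_nonneg fun i _ => hq w i)
    (h.quad_sum hB.posSemidef.1 G)] at h1
  have hae : (id : W B d → W B d) =ᵐ[ν] fun _ => (V, fun k => hat B (G k)) := by
    filter_upwards [h0, h1] with w hw0 hw1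
    have hw0' := (Finset.sum_eq_zero_iff_of_nonneg fun i _ => hr w i).1 hw0
    have hw1' := (Finset.sum_eq_zero_iff_of_nonneg fun i _ => hq w i).1 hw1
    refine Prod.ext (funext fun i => ?_) (funext fun k => ?_)
    · exact NNReal.coe_injective (eq_of_relEnt_eq_zero (w.1 i).2 (hV i) (hw0' i (Finset.mem_univ _)))
    · have hk := mem_kerB_of_quad_eq_zero hB.posSemidef (hw1' k (Finset.mem_univ _))
      -- The dissipation determines p only modulo ker B. Projecting to L^⊥, where p already lives,
      -- removes the ambiguity.
      have h3 : hat B ((w.2 k : E n) - G k) = 0 := by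
        rw [hat]
        exact Submodule.orthogonalProjectionOnto_apply_of_mem_orthogonal
          (Submodule.le_orthogonal_orthogonal _ hk)
      rw [hat, map_sub, sub_eq_zero] at h3
      change w.2 k = hat B (G k)
      rw [hat, ← h3]
      exact (Submodule.orthogonalProjectionOnto_mem_subspace_eq_self _).symm
  rw [Measure.dirac_prod_dirac, ← Measure.map_id (μ := ν), Measure.map_congr hae,
    Measure.map_const, measure_univ, one_smul]

end FiniteMoments

end Quad


/-! ### Measurability of moments of a weakly-* measurable family -/

section WeakStar

variable {Z X : Type*} [MeasurableSpace Z] [MetricSpace X] [ProperSpace X] [MeasurableSpace X]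
  [BorelSpace X] {ρ : Measure Z} {μ : Z → ProbabilityMeasure X}

/-- Weak-* measurability is given only for functions vanishing at infinity. Since closed balls are
compact, a nonnegative continuous function is an increasing limit of compactly supported ones, and
monotone convergence carries measurability to the limit. -/
lemma aemeasurable_lintegral_of_weakStar
    (hμ : ∀ f : C₀(X, ℝ), AEStronglyMeasurable (fun z => ∫ w, f w ∂(μ z : Measure X)) ρ)
    {f : X → ℝ} (hf : Continuous f) (hf0 : ∀ w, 0 ≤ f w) :
    AEMeasurable (fun z => ∫⁻ w, ENNReal.ofReal (f w) ∂(μ z : Measure X)) ρ := by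
  rcases isEmpty_or_nonempty X with hX | ⟨⟨w₀⟩⟩
  · simp
  set χ : ℕ → X → ℝ := fun N w => max 0 (min 1 (N + 1 - dist w w₀))
  have hχc : ∀ N, Continuous (χ N) := fun N => by fun_prop
  have hχ0 : ∀ N w, 0 ≤ χ N w := fun N w => le_max_left _ _
  have hχs : ∀ N, HasCompactSupport (fun w => f w * χ N w) := fun N => by
    refine HasCompactSupport.intro (isCompact_closedBall w₀ (N + 1)) fun w hw => ?_
    have : (N + 1 : ℝ) < dist w w₀ := by simpa using hw
    have : χ N w = 0 := max_eq_left ((min_le_right _ _).trans (by linarith))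
    rw [this, mul_zero]
  let g : ℕ → C₀(X, ℝ) := fun N =>
    ⟨⟨fun w => f w * χ N w, hf.mul (hχc N)⟩, (hχs N).is_zero_at_infty⟩
  have hg : ∀ N z, ∫⁻ w, ENNReal.ofReal (f w * χ N w) ∂(μ z : Measure X)
      = ENNReal.ofReal (∫ w, g N w ∂(μ z : Measure X)) := fun N z => by
    rw [ofReal_integral_eq_lintegral_ofReal]
    · rfl
    · exact (hf.mul (hχc N)).integrable_of_hasCompactSupport (hχs N)
    · exact Filter.Eventually.of_forall fun w => mul_nonneg (hf0 w) (hχ0 N w)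
  refine aemeasurable_of_tendsto_metrizable_ae Filter.atTop
    (f := fun N z => ∫⁻ w, ENNReal.ofReal (f w * χ N w) ∂(μ z : Measure X)) (fun N => ?_)
    (Filter.Eventually.of_forall fun z => ?_)
  · simp only [hg]
    exact (hμ (g N)).aemeasurable.ennreal_ofReal
  · refine lintegral_tendsto_of_tendsto_of_monotone (fun N => ?_)
      (Filter.Eventually.of_forall fun w N M h => ?_) (Filter.Eventually.of_forall fun w => ?_)
    · exact (hf.mul (hχc N)).measurable.ennreal_ofReal.aemeasurable
    · refine ENNReal.ofReal_le_ofReal (mul_le_mul_of_nonneg_left ?_ (hf0 w))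
      refine max_le_max le_rfl (min_le_min le_rfl ?_)
      have : (N : ℝ) ≤ M := by exact_mod_cast h
      linarith
    · refine tendsto_const_nhds.congr' ?_
      obtain ⟨N₀, hN₀⟩ := exists_nat_ge (dist w w₀)
      filter_upwards [Filter.eventually_ge_atTop N₀] with N hN
      have : (N₀ : ℝ) ≤ N := by exact_mod_cast hN
      have : χ N w = 1 := by
        change max 0 (min 1 ((N : ℝ) + 1 - dist w w₀)) = 1
        rw [min_eq_left (by linarith)]; simp
      rw [this, mul_one]

lemma aestronglyMeasurable_integral_of_weakStar
    (hμ : ∀ f : C₀(X, ℝ), AEStronglyMeasurable (fun z => ∫ w, f w ∂(μ z : Measure X)) ρ)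
    {f : X → ℝ} (hf : Continuous f) (hi : ∀ᵐ z ∂ρ, Integrable f (μ z : Measure X)) :
    AEStronglyMeasurable (fun z => ∫ w, f w ∂(μ z : Measure X)) ρ := by
  have h1 := aemeasurable_lintegral_of_weakStar hμ (f := fun w => max (f w) 0) (by fun_prop)
    fun w => le_max_right _ _
  have h2 := aemeasurable_lintegral_of_weakStar hμ (f := fun w => max (-f w) 0) (by fun_prop)
    fun w => le_max_right _ _
  refine (h1.ennreal_toReal.sub h2.ennreal_toReal).aestronglyMeasurable.congr ?_
  filter_upwards [hi] with z hz
  rw [integral_eq_lintegral_pos_part_sub_lintegral_neg_part hz]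
  simp [ENNReal.ofReal_max]

end WeakStar

/-! ### Slices of product measures -/

lemma restrict_cylinder {d : ℕ} (Ω : Set (E d)) (I : Set ℝ) :
    (volume : Measure (E d × ℝ)).restrict (Ω ×ˢ I)
      = (volume.restrict Ω).prod (volume.restrict I) := by
  rw [Measure.prod_restrict]; rfl

lemma ae_slice {d : ℕ} {Ω : Set (E d)} {I : Set ℝ} {P : E d × ℝ → Prop}
    (h : ∀ᵐ z ∂(volume.restrict (Ω ×ˢ I)), P z) :
    ∀ᵐ t ∂(volume.restrict I), ∀ᵐ x ∂(volume.restrict Ω), P (x, t) := by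
  rw [restrict_cylinder] at h
  have h2 := Measure.prod_swap (μ := (volume : Measure ℝ).restrict I)
    (ν := (volume : Measure (E d)).restrict Ω)
  rw [← h2] at h
  exact Measure.ae_ae_of_ae_prod (ae_of_ae_map measurable_swap.aemeasurable h)

lemma integrable_cylinder_of_slices {d : ℕ} {Ω : Set (E d)} {T : ℝ} {f : E d × ℝ → ℝ}
    (hf : AEStronglyMeasurable f (volume.restrict (Ω ×ˢ Ioo 0 T))) {C : ℝ≥0}
    (hC : ∀ᵐ t ∂(volume.restrict (Ioo 0 T)), ∫⁻ x in Ω, ‖f (x, t)‖ₑ ≤ C) :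
    Integrable f (volume.restrict (Ω ×ˢ Ioo 0 T)) := by
  refine ⟨hf, ?_⟩
  rw [restrict_cylinder] at hf ⊢
  rw [HasFiniteIntegral, lintegral_prod_symm _ hf.enorm]
  calc _ ≤ ∫⁻ _ in Ioo 0 T, (C : ℝ≥0∞) := lintegral_mono_ae hC
    _ < ⊤ := by
      rw [lintegral_const, Measure.restrict_apply_univ, Real.volume_Ioo]
      exact ENNReal.mul_lt_top ENNReal.coe_lt_top ENNReal.ofReal_lt_top

/-! ### Moments of dissipative measure-valued solutions -/

/-- Passage from the [0,∞]-valued integrals of the entropy inequalities to ordinary integrals: a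
finite double integral makes almost every inner integral finite. -/
lemma integrable_moment {Z X : Type*} [MeasurableSpace Z] [MetricSpace X] [ProperSpace X]
    [MeasurableSpace X] [BorelSpace X] {ρ : Measure Z} {μ : Z → ProbabilityMeasure X}
    (hμ : ∀ f : C₀(X, ℝ), AEStronglyMeasurable (fun z => ∫ w, f w ∂(μ z : Measure X)) ρ)
    {f : X → ℝ} (hf : Continuous f) (hf0 : ∀ w, 0 ≤ f w)
    (hfin : ∫⁻ z, ∫⁻ w, ENNReal.ofReal (f w) ∂(μ z : Measure X) ∂ρ ≠ ⊤) :
    (∀ᵐ z ∂ρ, Integrable f (μ z : Measure X)) ∧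
      Integrable (fun z => ∫ w, f w ∂(μ z : Measure X)) ρ ∧
      ∫⁻ z, ∫⁻ w, ENNReal.ofReal (f w) ∂(μ z : Measure X) ∂ρ
        = ENNReal.ofReal (∫ z, ∫ w, f w ∂(μ z : Measure X) ∂ρ) := by
  have hm := aemeasurable_lintegral_of_weakStar hμ hf hf0
  have h1 : ∀ᵐ z ∂ρ, Integrable f (μ z : Measure X) := by
    filter_upwards [ae_lt_top' hm hfin] with z hz
    refine ⟨hf.aestronglyMeasurable, ?_⟩
    rwa [hasFiniteIntegral_iff_ofReal (Filter.Eventually.of_forall hf0)]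
  have h2 : (fun z => ∫⁻ w, ENNReal.ofReal (f w) ∂(μ z : Measure X))
      =ᵐ[ρ] fun z => ENNReal.ofReal (∫ w, f w ∂(μ z : Measure X)) := by
    filter_upwards [h1] with z hz
    exact (ofReal_integral_eq_lintegral_ofReal hz (Filter.Eventually.of_forall hf0)).symm
  have h0 : ∀ z, 0 ≤ ∫ w, f w ∂(μ z : Measure X) := fun z => integral_nonneg hf0
  rw [lintegral_congr_ae h2] at hfin ⊢
  have h3 : Integrable (fun z => ∫ w, f w ∂(μ z : Measure X)) ρ := by
    refine ⟨aestronglyMeasurable_integral_of_weakStar hμ hf h1, ?_⟩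
    rw [hasFiniteIntegral_iff_ofReal (Filter.Eventually.of_forall h0)]
    exact hfin.lt_top
  exact ⟨h1, h3, (ofReal_integral_eq_lintegral_ofReal h3 (Filter.Eventually.of_forall h0)).symm⟩

lemma exists_gt_of_ae_Ioi {P : ℝ → Prop} (h : ∀ᵐ t ∂(volume.restrict (Ioi (0 : ℝ))), P t)
    {T : ℝ} (hT : 0 < T) : ∃ t, T < t ∧ P t := by
  have h2 : ∀ᵐ t ∂(volume.restrict (Ioi T)), P t :=
    ae_mono (Measure.restrict_mono (Ioi_subset_Ioi hT.le) le_rfl) h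
  rw [ae_restrict_iff' measurableSet_Ioi] at h2
  have : (ae (volume.restrict (Ioi T))).NeBot := by
    rw [ae_neBot, Ne, Measure.restrict_eq_zero, Real.volume_Ioi]
    exact ENNReal.top_ne_zero
  have h3 := ((ae_restrict_iff' measurableSet_Ioi).2 h2).and (ae_restrict_mem (μ := volume)
    (measurableSet_Ioi (a := T)))
  obtain ⟨t, ht⟩ := h3.exists
  exact ⟨t, ht.2, ht.1⟩

lemma ae_Ioo_of_ae_Ioi {P : ℝ → Prop} (h : ∀ᵐ t ∂(volume.restrict (Ioi (0 : ℝ))), P t) {T : ℝ} :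
    ∀ᵐ t ∂(volume.restrict (Ioo 0 T)), P t :=
  ae_mono (Measure.restrict_mono Ioo_subset_Ioi_self le_rfl) h

section Moments

variable {n d : ℕ} {B : Matrix (Fin n) (Fin n) ℝ} {Ω : Set (E d)} {uin : E d → Fin n → ℝ≥0}
  {μ : E d × ℝ → ProbabilityMeasure (W B d)} {T : ℝ}

/-- The averaged Shannon entropy density `⟨μ, h_S⟩`. -/
noncomputable def entMoment (μ : E d × ℝ → ProbabilityMeasure (W B d)) (z : E d × ℝ) : ℝ :=
  ∫ w : W B d, shannon w.1 ∂(μ z : Measure (W B d))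

/-- The averaged Shannon entropy production `⟨μ, |B^{1/2} p|²⟩`. -/
noncomputable def shannonProdMoment (μ : E d × ℝ → ProbabilityMeasure (W B d)) (z : E d × ℝ) : ℝ :=
  ∫ w : W B d, normSqSqrtB B w.2 ∂(μ z : Measure (W B d))

/-- The averaged Rao entropy production `⟨μ, s_i |(B p)_i|²⟩`. -/
noncomputable def raoProdMoment (μ : E d × ℝ → ProbabilityMeasure (W B d)) (i : Fin n)
    (z : E d × ℝ) : ℝ :=
  ∫ w : W B d, (w.1 i : ℝ) * ∑ k, mulB B (w.2 k : E n) i ^ 2 ∂(μ z : Measure (W B d))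

lemma continuous_shannon : Continuous (shannon : (Fin n → ℝ≥0) → ℝ) := by
  have h : (shannon : (Fin n → ℝ≥0) → ℝ)
      = fun s => ∑ i, ((s i : ℝ) * Real.log (s i) - (s i : ℝ) + 1) := by
    funext s
    exact Finset.sum_congr rfl fun i _ => by ring
  rw [h]
  refine continuous_finsetSum _ fun i _ => ?_
  have h1 : Continuous fun s : Fin n → ℝ≥0 => (s i : ℝ) := by fun_prop
  exact ((Real.continuous_mul_log.comp h1).sub h1).add continuous_const

lemma continuous_normSqSqrtB : Continuous fun w : W B d => normSqSqrtB B w.2 := by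
  simp only [normSqSqrtB_eq]
  exact continuous_finsetSum _ fun k _ => continuous_quad.comp (continuous_grad k)

lemma normSqSqrtB_nonneg (hB : IsAdmissible B) (p : Fin d → perpB B) : 0 ≤ normSqSqrtB B p := by
  rw [normSqSqrtB_eq]
  exact Finset.sum_nonneg fun k _ => quad_nonneg hB.posSemidef _

lemma continuous_raoProd (i : Fin n) :
    Continuous fun w : W B d => (w.1 i : ℝ) * ∑ k, mulB B (w.2 k : E n) i ^ 2 :=
  (continuous_density i).mul (continuous_finsetSum _ fun k _ => (continuous_mulB_grad i k).pow 2)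

lemma raoProd_nonneg (i : Fin n) (w : W B d) :
    0 ≤ (w.1 i : ℝ) * ∑ k, mulB B (w.2 k : E n) i ^ 2 :=
  mul_nonneg (w.1 i).2 (Finset.sum_nonneg fun _ _ => sq_nonneg _)

lemma cylinder_mono {s t : ℝ} (h : s ≤ t) :
    (volume : Measure (E d × ℝ)).restrict (Ω ×ˢ Ioo 0 s) ≤ volume.restrict (Ω ×ˢ Ioo 0 t) :=
  Measure.restrict_mono (prod_mono le_rfl (Ioo_subset_Ioo_right h)) le_rfl

lemma cylinder_le (Ω : Set (E d)) (t : ℝ) :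
    (volume : Measure (E d × ℝ)).restrict (Ω ×ˢ Ioo 0 t) ≤ volume.restrict (Ω ×ˢ Ioi 0) :=
  Measure.restrict_mono (prod_mono le_rfl Ioo_subset_Ioi_self) le_rfl

lemma ae_cylinder_of_ae {P : E d × ℝ → Prop} (h : ∀ᵐ z ∂(volume.restrict (Ω ×ˢ Ioi 0)), P z) :
    ∀ᵐ z ∂(volume.restrict (Ω ×ˢ Ioo 0 T)), P z :=
  ae_mono (cylinder_le Ω T) h

namespace IsDissipativeMVSolution

lemma weakStar_cylinder (hμ : IsDissipativeMVSolution Ω uin μ) (T : ℝ) (f : C₀(W B d, ℝ)) :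
    AEStronglyMeasurable (fun z => ∫ w, f w ∂(μ z : Measure (W B d)))
      (volume.restrict (Ω ×ˢ Ioo 0 T)) :=
  (hμ.weakStarMeasurable f).mono_measure (cylinder_le Ω T)

lemma shannonProd_moment (hμ : IsDissipativeMVSolution Ω uin μ) (hB : IsAdmissible B) (hT : 0 < T)
    (hS : Integrable (fun x => shannon (uin x)) (volume.restrict Ω)) :
    (∀ᵐ z ∂(volume.restrict (Ω ×ˢ Ioo 0 T)),
      Integrable (fun w : W B d => normSqSqrtB B w.2) (μ z : Measure (W B d))) ∧
    Integrable (shannonProdMoment μ) (volume.restrict (Ω ×ˢ Ioo 0 T)) ∧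
    ∫⁻ z in Ω ×ˢ Ioo 0 T, ∫⁻ w, ENNReal.ofReal (normSqSqrtB B w.2) ∂(μ z : Measure (W B d))
      = ENNReal.ofReal (∫ z in Ω ×ˢ Ioo 0 T, shannonProdMoment μ z) := by
  -- The inequality is known only for almost every time, so a good time beyond T is used to bound
  -- the production on all of (0,T).
  obtain ⟨t, hTt, ht⟩ := exists_gt_of_ae_Ioi hμ.shannon_le hT
  refine integrable_moment (hμ.weakStar_cylinder T) continuous_normSqSqrtB
    (fun w => normSqSqrtB_nonneg hB w.2) (ne_top_of_le_ne_top ?_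
      ((lintegral_mono' (cylinder_mono hTt.le) le_rfl).trans (le_add_self.trans ht)))
  exact ((hasFiniteIntegral_iff_ofReal (Filter.Eventually.of_forall fun x =>
    shannon_nonneg _)).1 hS.2).ne

lemma raoProd_moment (hμ : IsDissipativeMVSolution Ω uin μ) (hT : 0 < T)
    (hR : ∫⁻ x in Ω, ENNReal.ofReal (rao B (vec (uin x))) ≠ ⊤) (i : Fin n) :
    (∀ᵐ z ∂(volume.restrict (Ω ×ˢ Ioo 0 T)),
      Integrable (fun w : W B d => (w.1 i : ℝ) * ∑ k, mulB B (w.2 k : E n) i ^ 2)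
        (μ z : Measure (W B d))) ∧
    Integrable (raoProdMoment μ i) (volume.restrict (Ω ×ˢ Ioo 0 T)) ∧
    ∫⁻ z in Ω ×ˢ Ioo 0 T, ∫⁻ w, ENNReal.ofReal ((w.1 i : ℝ) * ∑ k, (mulB B (w.2 k : E n) i) ^ 2)
        ∂(μ z : Measure (W B d))
      = ENNReal.ofReal (∫ z in Ω ×ˢ Ioo 0 T, raoProdMoment μ i z) := by
  obtain ⟨t, hTt, ht⟩ := exists_gt_of_ae_Ioi hμ.rao_le hT
  refine integrable_moment (hμ.weakStar_cylinder T) (continuous_raoProd i)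
    (raoProd_nonneg i) (ne_top_of_le_ne_top hR
      ((lintegral_mono' (cylinder_mono hTt.le) le_rfl).trans
        (le_trans ?_ (le_add_self.trans ht))))
  exact Finset.single_le_sum (f := fun i => ∫⁻ z in Ω ×ˢ Ioo 0 t, ∫⁻ w,
          ENNReal.ofReal ((w.1 i : ℝ) * ∑ k, (mulB B (w.2 k : E n) i) ^ 2)
          ∂(μ z : Measure (W B d))) (fun _ _ => zero_le) (Finset.mem_univ i)

/-- The entropy inequality bounds almost every time slice by the initial entropy. Integrating that
constant over the bounded interval (0,T) gives finiteness. -/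
lemma entropy_moment (hμ : IsDissipativeMVSolution Ω uin μ) (hS : Integrable (fun x => shannon (uin x)) (volume.restrict Ω)) :
    (∀ᵐ z ∂(volume.restrict (Ω ×ˢ Ioo 0 T)),
      Integrable (fun w : W B d => shannon w.1) (μ z : Measure (W B d))) ∧
    Integrable (entMoment μ) (volume.restrict (Ω ×ˢ Ioo 0 T)) := by
  have hc : Continuous fun w : W B d => shannon w.1 := continuous_shannon.comp continuous_fst
  have hm := aemeasurable_lintegral_of_weakStar (hμ.weakStar_cylinder T) hc
    fun w => shannon_nonneg w.1
  have h := integrable_moment (hμ.weakStar_cylinder T) hc (fun w => shannon_nonneg w.1) ?_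
  · exact ⟨h.1, h.2.1⟩
  rw [restrict_cylinder] at hm ⊢
  rw [lintegral_prod_symm _ hm]
  have hle : ∀ᵐ t ∂(volume.restrict (Ioo 0 T)),
      (∫⁻ x in Ω, ∫⁻ w, ENNReal.ofReal (shannon w.1) ∂(μ (x, t) : Measure (W B d)))
        ≤ ∫⁻ x in Ω, ENNReal.ofReal (shannon (uin x)) := by
    filter_upwards [ae_Ioo_of_ae_Ioi hμ.shannon_le] with t ht
    exact le_self_add.trans ht
  refine ne_top_of_le_ne_top ?_ (lintegral_mono_ae hle)
  rw [lintegral_const, Measure.restrict_apply_univ, Real.volume_Ioo]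
  exact ENNReal.mul_ne_top ((hasFiniteIntegral_iff_ofReal (Filter.Eventually.of_forall fun x =>
    shannon_nonneg _)).1 hS.2).ne ENNReal.ofReal_ne_top

lemma finiteMoments (hμ : IsDissipativeMVSolution Ω uin μ) (hB : IsAdmissible B) (hT : 0 < T)
    (hS : Integrable (fun x => shannon (uin x)) (volume.restrict Ω))
    (hR : ∫⁻ x in Ω, ENNReal.ofReal (rao B (vec (uin x))) ≠ ⊤) :
    ∀ᵐ z ∂(volume.restrict (Ω ×ˢ Ioo 0 T)), FiniteMoments (μ z : Measure (W B d)) := by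
  filter_upwards [ae_cylinder_of_ae hμ.integrable_s,
    ae_cylinder_of_ae hμ.integrable_p, (hμ.entropy_moment hS).1,
    (hμ.shannonProd_moment hB hT hS).1, ae_all_iff.2 fun i => (hμ.raoProd_moment hT hR i).1]
    with z h1 h2 h3 h4 h5
  exact ⟨h1, h2, h3, h4, h5⟩

lemma integrable_baryS (hμ : IsDissipativeMVSolution Ω uin μ) (hΩ : volume Ω ≠ ⊤) (i : Fin n) :
    Integrable (fun z => baryS μ z i) (volume.restrict (Ω ×ˢ Ioo 0 T)) := by
  have hm : AEStronglyMeasurable (fun z => baryS μ z i) (volume.restrict (Ω ×ˢ Ioo 0 T)) :=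
    aestronglyMeasurable_integral_of_weakStar (hμ.weakStar_cylinder T) (continuous_density i)
      ((ae_cylinder_of_ae hμ.integrable_s).mono fun z hz => hz i)
  obtain ⟨C, hC⟩ := hμ.density_bound i
  have hfin : (C : ℝ≥0∞) * volume Ω ^ (1 / 2 : ℝ) ≠ ⊤ :=
    ENNReal.mul_ne_top ENNReal.coe_ne_top (ENNReal.rpow_ne_top_of_nonneg (by norm_num) hΩ)
  refine integrable_cylinder_of_slices hm (C := (C * volume Ω ^ (1 / 2 : ℝ)).toNNReal) ?_
  filter_upwards [ae_Ioo_of_ae_Ioi hC]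
    with t ht
  rw [← eLpNorm_one_eq_lintegral_enorm, ENNReal.coe_toNNReal hfin]
  -- Cauchy-Schwarz on each slice: the L¹ norm is at most |Ω|^{1/2} times the uniformly bounded L²
  -- norm.
  refine (eLpNorm_le_eLpNorm_mul_rpow_measure_univ (p := 1) (q := 2) (by norm_num)
    ht.1.1).trans ?_
  rw [Measure.restrict_apply_univ]
  refine mul_le_mul' ht.2 (le_of_eq ?_)
  norm_num

lemma integrable_baryP (hμ : IsDissipativeMVSolution Ω uin μ) (hΩ : volume Ω ≠ ⊤) (hT : 0 < T) (k : Fin d) :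
    Integrable (baryP μ k) (volume.restrict (Ω ×ˢ Ioo 0 T)) := by
  have : IsFiniteMeasure ((volume : Measure (E d × ℝ)).restrict (Ω ×ˢ Ioo 0 T)) := by
    have : IsFiniteMeasure ((volume : Measure (E d)).restrict Ω) :=
      ⟨by rw [Measure.restrict_apply_univ]; exact hΩ.lt_top⟩
    rw [restrict_cylinder]
    infer_instance
  exact (hμ.gradient_memLp T hT k).integrable (by norm_num)

lemma integrable_flux (hμ : IsDissipativeMVSolution Ω uin μ) (hB : IsAdmissible B) (hΩ : volume Ω ≠ ⊤) (hT : 0 < T)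
    (hS : Integrable (fun x => shannon (uin x)) (volume.restrict Ω))
    (hR : ∫⁻ x in Ω, ENNReal.ofReal (rao B (vec (uin x))) ≠ ⊤) (i : Fin n) (k : Fin d) :
    Integrable (flux μ i k) (volume.restrict (Ω ×ˢ Ioo 0 T)) := by
  have hfm := hμ.finiteMoments hB hT hS hR
  refine ((hμ.integrable_baryS hΩ i).add (hμ.raoProd_moment hT hR i).2.1).mono'
    (aestronglyMeasurable_integral_of_weakStar (hμ.weakStar_cylinder T)
      ((continuous_density i).mul (continuous_mulB_grad i k)) (hfm.mono fun z h => h.flux i k)) ?_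
  filter_upwards [hfm] with z h
  -- Again |q| ≤ 1 + |q|²: the averaged flux is bounded by the density plus the Rao production, both
  -- integrable on the cylinder.
  refine (norm_integral_le_integral_norm _).trans ?_
  rw [Pi.add_apply]
  change _ ≤ (∫ w : W B d, (w.1 i : ℝ) ∂(μ z : Measure (W B d))) + raoProdMoment μ i z
  rw [raoProdMoment, ← integral_add (h.density i) (h.raoProd i)]
  refine integral_mono (h.flux i k).norm ((h.density i).add (h.raoProd i)) fun w => ?_
  have h1 : |mulB B (w.2 k : E n) i| ≤ 1 + ∑ k, mulB B (w.2 k : E n) i ^ 2 := by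
    have := Finset.single_le_sum (f := fun k => mulB B (w.2 k : E n) i ^ 2)
      (fun _ _ => sq_nonneg _) (Finset.mem_univ k)
    rw [abs_le]; constructor <;> nlinarith [sq_nonneg (mulB B (w.2 k : E n) i - 1),
      sq_nonneg (mulB B (w.2 k : E n) i + 1)]
  have h2 := mul_le_mul_of_nonneg_left h1 (NNReal.coe_nonneg (w.1 i))
  rw [norm_mul, Real.norm_of_nonneg (NNReal.coe_nonneg _), Real.norm_eq_abs]
  linarith

lemma shannon_inequality (hμ : IsDissipativeMVSolution Ω uin μ) (hB : IsAdmissible B)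
    (hS : Integrable (fun x => shannon (uin x)) (volume.restrict Ω)) :
    ∀ᵐ t ∂(volume.restrict (Ioo 0 T)),
      Integrable (fun x => entMoment μ (x, t)) (volume.restrict Ω) ∧
      (∫ x in Ω, entMoment μ (x, t)) + ∫ z in Ω ×ˢ Ioo 0 t, shannonProdMoment μ z
        ≤ ∫ x in Ω, shannon (uin x) := by
  have hent := hμ.entropy_moment (T := T) hS
  have hsl : ∀ᵐ t ∂(volume.restrict (Ioo 0 T)),
      Integrable (fun x => entMoment μ (x, t)) (volume.restrict Ω) := by
    have := hent.2
    rw [restrict_cylinder] at this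
    exact this.prod_left_ae
  filter_upwards [hsl, ae_slice hent.1, ae_restrict_mem measurableSet_Ioo,
    ae_Ioo_of_ae_Ioi hμ.shannon_le]
    with t h1 h2 ht h3
  refine ⟨h1, ?_⟩
  rw [(hμ.shannonProd_moment hB ht.1 hS).2.2,
    ← ofReal_integral_eq_lintegral_ofReal hS (Filter.Eventually.of_forall fun x =>
      shannon_nonneg _)] at h3
  have e : (∫⁻ x in Ω, ∫⁻ w, ENNReal.ofReal (shannon w.1) ∂(μ (x, t) : Measure (W B d)))
      = ENNReal.ofReal (∫ x in Ω, entMoment μ (x, t)) := by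
    rw [ofReal_integral_eq_lintegral_ofReal h1 (Filter.Eventually.of_forall fun x =>
      integral_nonneg fun w => shannon_nonneg _)]
    refine lintegral_congr_ae ?_
    filter_upwards [h2] with x hx
    exact (ofReal_integral_eq_lintegral_ofReal hx (Filter.Eventually.of_forall fun w =>
      shannon_nonneg _)).symm
  have hH : 0 ≤ ∫ x in Ω, entMoment μ (x, t) :=
    integral_nonneg fun x => integral_nonneg fun w => shannon_nonneg _
  have hD : 0 ≤ ∫ z in Ω ×ˢ Ioo 0 t, shannonProdMoment μ z :=
    integral_nonneg fun z => integral_nonneg fun w => normSqSqrtB_nonneg hB _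
  rw [e, ← ENNReal.ofReal_add hH hD] at h3
  exact (ENNReal.ofReal_le_ofReal_iff (integral_nonneg fun x => shannon_nonneg _)).1 h3

lemma rao_inequality (hμ : IsDissipativeMVSolution Ω uin μ) (hB : IsAdmissible B) (hΩ : volume Ω ≠ ⊤)
    (hR : Integrable (fun x => rao B (vec (uin x))) (volume.restrict Ω)) :
    ∀ᵐ t ∂(volume.restrict (Ioo 0 T)),
      Integrable (fun x => rao B (baryS μ (x, t))) (volume.restrict Ω) ∧
      (∫ x in Ω, rao B (baryS μ (x, t))) + ∑ i, ∫ z in Ω ×ˢ Ioo 0 t, raoProdMoment μ i z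
        ≤ ∫ x in Ω, rao B (vec (uin x)) := by
  have hr0 : ∀ z : E n, 0 ≤ rao B z := fun z => by
    rw [rao_eq]; exact mul_nonneg (by norm_num) (quad_nonneg hB.posSemidef z)
  have hR' : ∫⁻ x in Ω, ENNReal.ofReal (rao B (vec (uin x))) ≠ ⊤ :=
    ((hasFiniteIntegral_iff_ofReal (Filter.Eventually.of_forall fun x => hr0 _)).1 hR.2).ne
  have hsl : ∀ᵐ t ∂(volume.restrict (Ioo 0 T)), ∀ i,
      Integrable (fun x => baryS μ (x, t) i) (volume.restrict Ω) := by
    refine ae_all_iff.2 fun i => ?_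
    have := hμ.integrable_baryS (T := T) hΩ i
    rw [restrict_cylinder] at this
    exact this.prod_left_ae
  filter_upwards [hsl, ae_restrict_mem measurableSet_Ioo,
    ae_Ioo_of_ae_Ioi hμ.rao_le]
    with t h1 ht h3
  have hm : AEStronglyMeasurable (fun x => rao B (baryS μ (x, t))) (volume.restrict Ω) := by
    refine AEStronglyMeasurable.const_mul ?_ _
    exact Finset.aestronglyMeasurable_fun_sum _ fun i _ =>
      Finset.aestronglyMeasurable_fun_sum _ fun j _ =>
        ((h1 i).1.const_mul _).mul (h1 j).1
  have hi : Integrable (fun x => rao B (baryS μ (x, t))) (volume.restrict Ω) := by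
    refine ⟨hm, ?_⟩
    rw [hasFiniteIntegral_iff_ofReal (Filter.Eventually.of_forall fun x => hr0 _)]
    exact (le_self_add.trans h3).trans_lt hR'.lt_top
  refine ⟨hi, ?_⟩
  have hc : ∀ i, 0 ≤ ∫ z in Ω ×ˢ Ioo 0 t, raoProdMoment μ i z := fun i =>
    integral_nonneg fun z => integral_nonneg fun w => raoProd_nonneg i w
  rw [Finset.sum_congr rfl fun i _ => (hμ.raoProd_moment ht.1 hR' i).2.2,
    ← ENNReal.ofReal_sum_of_nonneg fun i _ => hc i,
    ← ofReal_integral_eq_lintegral_ofReal hR (Filter.Eventually.of_forall fun x => hr0 _),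
    ← ofReal_integral_eq_lintegral_ofReal hi (Filter.Eventually.of_forall fun x => hr0 _),
    ← ENNReal.ofReal_add (integral_nonneg fun x => hr0 _) (Finset.sum_nonneg fun i _ => hc i)] at h3
  exact (ENNReal.ofReal_le_ofReal_iff (integral_nonneg fun x => hr0 _)).1 h3

end IsDissipativeMVSolution

end Moments


/-! ### Functions of class `C^1` up to the boundary of the space-time cylinder -/

section Regularity

variable {d : ℕ} {Ω : Set (E d)} {T : ℝ} {f g : E d × ℝ → ℝ}

lemma cylinder_subset (Ω : Set (E d)) (T : ℝ) : Ω ×ˢ Ioo 0 T ⊆ closure Ω ×ˢ Icc 0 T :=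
  prod_mono subset_closure Ioo_subset_Icc_self

lemma isCompact_closed_cylinder (hb : Bornology.IsBounded Ω) (T : ℝ) :
    IsCompact (closure Ω ×ˢ Icc 0 T) :=
  hb.isCompact_closure.prod isCompact_Icc

lemma contDiffAt_of_mem_cylinder (hΩ : IsOpen Ω)
    (hf : ContDiffOn ℝ 1 f (closure Ω ×ˢ Icc 0 T)) {z : E d × ℝ} (hz : z ∈ Ω ×ˢ Ioo 0 T) :
    ContDiffAt ℝ 1 f z :=
  hf.contDiffAt (Filter.mem_of_superset ((hΩ.prod isOpen_Ioo).mem_nhds hz) (cylinder_subset Ω T))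

lemma differentiableAt_of_mem_cylinder (hΩ : IsOpen Ω)
    (hf : ContDiffOn ℝ 1 f (closure Ω ×ˢ Icc 0 T)) {z : E d × ℝ} (hz : z ∈ Ω ×ˢ Ioo 0 T) :
    DifferentiableAt ℝ f z :=
  (contDiffAt_of_mem_cylinder hΩ hf hz).differentiableAt (by norm_num)

lemma continuousOn_fderiv_cylinder (hΩ : IsOpen Ω)
    (hf : ContDiffOn ℝ 1 f (closure Ω ×ˢ Icc 0 T)) :
    ContinuousOn (fderiv ℝ f) (Ω ×ˢ Ioo 0 T) :=
  (hf.mono (cylinder_subset Ω T)).continuousOn_fderiv_of_isOpen (hΩ.prod isOpen_Ioo) le_rfl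

lemma exists_bound_cylinder (hb : Bornology.IsBounded Ω)
    (hf : ContinuousOn f (closure Ω ×ˢ Icc 0 T)) :
    ∃ C, 0 ≤ C ∧ ∀ z ∈ closure Ω ×ˢ Icc 0 T, |f z| ≤ C := by
  obtain ⟨C, hC⟩ := (isCompact_closed_cylinder hb T).exists_bound_of_continuousOn hf
  exact ⟨max C 0, le_max_right _ _, fun z hz => (hC z hz).trans (le_max_left _ _)⟩

/-- Near each point of the closed cylinder there is a derivative along the set that is continuous up
to the boundary, hence locally bounded. At interior points it coincides with `fderiv`. Compactness
then gives one bound, with no statement about `fderiv` on the boundary. -/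
lemma exists_bound_fderiv_cylinder (hΩ : IsOpen Ω) (hb : Bornology.IsBounded Ω)
    (hf : ContDiffOn ℝ 1 f (closure Ω ×ˢ Icc 0 T)) :
    ∃ C, 0 ≤ C ∧ ∀ z ∈ Ω ×ˢ Ioo 0 T, ‖fderiv ℝ f z‖ ≤ C := by
  set K := closure Ω ×ˢ Icc 0 T
  have key : ∃ C, ∀ z ∈ K, z ∈ Ω ×ˢ Ioo 0 T → ‖fderiv ℝ f z‖ ≤ C := by
    refine (isCompact_closed_cylinder hb T).induction_on
      (p := fun s => ∃ C, ∀ z ∈ s, z ∈ Ω ×ˢ Ioo 0 T → ‖fderiv ℝ f z‖ ≤ C)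
      ⟨0, by simp⟩ (fun s t hst ⟨C, hC⟩ => ⟨C, fun z hz => hC z (hst hz)⟩) ?_ ?_
    · rintro s t ⟨C, hC⟩ ⟨D, hD⟩
      refine ⟨max C D, fun z hz hzQ => ?_⟩
      rcases hz with hz | hz
      · exact (hC z hz hzQ).trans (le_max_left _ _)
      · exact (hD z hz hzQ).trans (le_max_right _ _)
    · intro x hx
      have h1 : ContDiffWithinAt ℝ (0 + 1) f K x := by simpa using hf x hx
      rw [contDiffWithinAt_succ_iff_hasFDerivWithinAt (by simp)] at h1
      obtain ⟨u, hu, -, f', hf', hc⟩ := h1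
      rw [insert_eq_of_mem hx] at hu
      have hxu : x ∈ u := mem_of_mem_nhdsWithin hx hu
      have hcont : ContinuousWithinAt f' u x := hc.continuousWithinAt
      have hev : ∀ᶠ z in nhdsWithin x u, ‖f' z‖ < ‖f' x‖ + 1 :=
        hcont.norm.eventually (gt_mem_nhds (lt_add_one _))
      have hev2 : ∀ᶠ z in nhdsWithin x K, ‖f' z‖ < ‖f' x‖ + 1 :=
        (nhdsWithin_le_of_mem hu) hev
      obtain ⟨V, hVo, hxV, hV⟩ := mem_nhdsWithin.1 (Filter.inter_mem hu hev2)
      refine ⟨V ∩ K, mem_nhdsWithin.2 ⟨V, hVo, hxV, le_rfl⟩, ‖f' x‖ + 1, fun z hz hzQ => ?_⟩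
      have hzu : u ∈ nhds z := by
        refine Filter.mem_of_superset ((hVo.inter (hΩ.prod isOpen_Ioo)).mem_nhds ⟨hz.1, hzQ⟩) ?_
        exact fun y hy => (hV ⟨hy.1, cylinder_subset Ω T hy.2⟩).1
      rw [((hf' z (mem_of_mem_nhds hzu)).hasFDerivAt hzu).fderiv]
      exact (hV hz).2.le
  obtain ⟨C, hC⟩ := key
  exact ⟨max C 0, le_max_right _ _, fun z hz =>
    (hC z (cylinder_subset Ω T hz) hz).trans (le_max_left _ _)⟩

lemma norm_space_dir (k : Fin d) : ‖((EuclideanSpace.single k 1, 0) : E d × ℝ)‖ ≤ 1 := by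
  simp [Prod.norm_def]

lemma norm_time_dir : ‖((0, 1) : E d × ℝ)‖ ≤ 1 := by
  simp [Prod.norm_def]

/-- A bounded continuous function on the cylinder. -/
structure IsBddCont (Ω : Set (E d)) (T : ℝ) (f : E d × ℝ → ℝ) : Prop where
  cont : ContinuousOn f (Ω ×ˢ Ioo 0 T)
  bdd : ∃ C, 0 ≤ C ∧ ∀ z ∈ Ω ×ˢ Ioo 0 T, |f z| ≤ C

lemma isBddCont_of_continuousOn (hb : Bornology.IsBounded Ω)
    (hf : ContinuousOn f (closure Ω ×ˢ Icc 0 T)) : IsBddCont Ω T f := by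
  obtain ⟨C, h0, hC⟩ := exists_bound_cylinder hb hf
  exact ⟨hf.mono (cylinder_subset Ω T), C, h0, fun z hz => hC z (cylinder_subset Ω T hz)⟩

lemma isBddCont_fderiv (hΩ : IsOpen Ω) (hb : Bornology.IsBounded Ω)
    (hf : ContDiffOn ℝ 1 f (closure Ω ×ˢ Icc 0 T)) {e : E d × ℝ} (he : ‖e‖ ≤ 1) :
    IsBddCont Ω T (fun z => fderiv ℝ f z e) := by
  obtain ⟨C, h0, hC⟩ := exists_bound_fderiv_cylinder hΩ hb hf
  refine ⟨(continuousOn_fderiv_cylinder hΩ hf).clm_apply continuousOn_const, C, h0,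
    fun z hz => ?_⟩
  calc |fderiv ℝ f z e| ≤ ‖fderiv ℝ f z‖ * ‖e‖ := (fderiv ℝ f z).le_opNorm e
    _ ≤ C * 1 := mul_le_mul (hC z hz) he (norm_nonneg _) h0
    _ = C := mul_one C

lemma isBddCont_dt (hΩ : IsOpen Ω) (hb : Bornology.IsBounded Ω)
    (hf : ContDiffOn ℝ 1 f (closure Ω ×ˢ Icc 0 T)) : IsBddCont Ω T (dt f) :=
  isBddCont_fderiv hΩ hb hf norm_time_dir

lemma isBddCont_dx (hΩ : IsOpen Ω) (hb : Bornology.IsBounded Ω)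
    (hf : ContDiffOn ℝ 1 f (closure Ω ×ˢ Icc 0 T)) (k : Fin d) : IsBddCont Ω T (dx k f) :=
  isBddCont_fderiv hΩ hb hf (norm_space_dir k)

namespace IsBddCont

lemma mul (hf : IsBddCont Ω T f) (hg : IsBddCont Ω T g) : IsBddCont Ω T (fun z => f z * g z) := by
  obtain ⟨C, h0, hC⟩ := hf.bdd
  obtain ⟨D, h1, hD⟩ := hg.bdd
  refine ⟨hf.cont.mul hg.cont, C * D, mul_nonneg h0 h1, fun z hz => ?_⟩
  rw [abs_mul]
  exact mul_le_mul (hC z hz) (hD z hz) (abs_nonneg _) h0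

lemma add (hf : IsBddCont Ω T f) (hg : IsBddCont Ω T g) : IsBddCont Ω T (fun z => f z + g z) := by
  obtain ⟨C, h0, hC⟩ := hf.bdd
  obtain ⟨D, h1, hD⟩ := hg.bdd
  exact ⟨hf.cont.add hg.cont, C + D, add_nonneg h0 h1, fun z hz =>
    (abs_add_le _ _).trans (add_le_add (hC z hz) (hD z hz))⟩

lemma const (c : ℝ) : IsBddCont Ω T (fun _ => c) :=
  ⟨continuousOn_const, |c|, abs_nonneg _, fun _ _ => le_rfl⟩

lemma sub (hf : IsBddCont Ω T f) (hg : IsBddCont Ω T g) : IsBddCont Ω T (fun z => f z - g z) := by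
  have := hf.add ((const (-1)).mul hg)
  simpa [sub_eq_add_neg] using this

lemma sum {ι : Type*} {s : Finset ι} {f : ι → E d × ℝ → ℝ} (h : ∀ i ∈ s, IsBddCont Ω T (f i)) :
    IsBddCont Ω T (fun z => ∑ i ∈ s, f i z) := by
  classical
  induction s using Finset.induction_on with
  | empty => simpa using const 0
  | insert a s ha ih =>
    simp only [Finset.sum_insert ha]
    exact (h a (Finset.mem_insert_self _ _)).add
      (ih fun i hi => h i (Finset.mem_insert_of_mem hi))

lemma aestronglyMeasurable (hΩ : IsOpen Ω) (hf : IsBddCont Ω T f) :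
    AEStronglyMeasurable f (volume.restrict (Ω ×ˢ Ioo 0 T)) :=
  hf.cont.aestronglyMeasurable (hΩ.measurableSet.prod measurableSet_Ioo)

lemma integrable_mul (hΩ : IsOpen Ω) (hf : IsBddCont Ω T f)
    (hg : Integrable g (volume.restrict (Ω ×ˢ Ioo 0 T))) :
    Integrable (fun z => f z * g z) (volume.restrict (Ω ×ˢ Ioo 0 T)) := by
  obtain ⟨C, _, hC⟩ := hf.bdd
  refine hg.bdd_mul (c := C) (hf.aestronglyMeasurable hΩ) ?_
  filter_upwards [ae_restrict_mem (hΩ.measurableSet.prod measurableSet_Ioo)] with z hz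
  exact hC z hz

lemma integrable (hΩ : IsOpen Ω) (hb : Bornology.IsBounded Ω) (hf : IsBddCont Ω T f) :
    Integrable f (volume.restrict (Ω ×ˢ Ioo 0 T)) := by
  have : IsFiniteMeasure ((volume : Measure (E d × ℝ)).restrict (Ω ×ˢ Ioo 0 T)) := by
    have : IsFiniteMeasure ((volume : Measure (E d)).restrict Ω) :=
      ⟨by rw [Measure.restrict_apply_univ]; exact hb.measure_lt_top⟩
    rw [restrict_cylinder]
    infer_instance
  simpa using hf.integrable_mul hΩ (integrable_const (1 : ℝ))

end IsBddCont

lemma integrable_slice_of_continuousOn (hb : Bornology.IsBounded Ω)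
    (hf : ContinuousOn f (closure Ω ×ˢ Icc 0 T)) {t : ℝ} (ht : t ∈ Icc 0 T) :
    Integrable (fun x => f (x, t)) (volume.restrict Ω) := by
  have h : ContinuousOn (fun x => f (x, t)) (closure Ω) :=
    hf.comp (by fun_prop) fun x hx => ⟨hx, ht⟩
  exact (h.integrableOn_compact hb.isCompact_closure).mono_set subset_closure

end Regularity

/-! ### From the weak formulation to time slices -/

/-- The du Bois-Reymond lemma with an initial value. The test functions vanish near T but not at 0,
which is why the constant is c rather than unknown. -/
lemma ae_eq_of_weak_deriv {T : ℝ} (hT : 0 < T) {U A : ℝ → ℝ} (hU : IntegrableOn U (Ioo 0 T))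
    (hA : IntegrableOn A (Ioo 0 T)) {c : ℝ}
    (h : ∀ θ : ℝ → ℝ, ContDiff ℝ ∞ θ → (∃ T' < T, ∀ t, T' ≤ t → θ t = 0) →
      (∫ t in Ioo 0 T, U t * deriv θ t) + c * θ 0 + ∫ t in Ioo 0 T, A t * θ t = 0) :
    ∀ᵐ t ∂(volume.restrict (Ioo 0 T)), U t = c + ∫ τ in Ioo 0 t, A τ := by
  set ν : Measure ℝ := volume.restrict (Ioo 0 T)
  set P : ℝ → ℝ := fun t => ∫ τ in Ioo 0 t, A τ
  -- The primitive of A is written as an integral against a triangular kernel, so that Fubini can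
  -- move the integration onto the test function.
  set K : ℝ × ℝ → ℝ := {p : ℝ × ℝ | p.2 < p.1}.indicator fun p => A p.2
  have hK : Integrable K (ν.prod ν) :=
    (Integrable.comp_snd hA ν).indicator (measurableSet_lt measurable_snd measurable_fst)
  have hP : ∀ t ∈ Ioo 0 T, P t = ∫ τ, K (t, τ) ∂ν := fun t ht => by
    have h1 : ∀ τ, K (t, τ) = (Iio t).indicator A τ := fun τ => by
      simp [K, indicator_apply]
    simp only [h1]
    rw [setIntegral_indicator measurableSet_Iio, Ioo_inter_Iio, min_eq_right ht.2.le]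
  have hP' : (fun t => ∫ τ, K (t, τ) ∂ν) =ᵐ[ν] P := by
    filter_upwards [ae_restrict_mem measurableSet_Ioo] with t ht using (hP t ht).symm
  have hPi : Integrable P ν := hK.integral_prod_left.congr hP'
  have hfi : IntegrableOn (fun t => U t - (c + P t)) (Ioo 0 T) :=
    hU.sub ((integrable_const c).add hPi)
  have key := IsOpen.ae_eq_zero_of_integral_contDiff_smul_eq_zero (μ := volume)
    (isOpen_Ioo (a := (0 : ℝ)) (b := T)) (f := fun t => U t - (c + P t))
    hfi.locallyIntegrableOn ?_
  · rw [ae_restrict_iff' measurableSet_Ioo]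
    filter_upwards [key] with t ht hmem
    exact sub_eq_zero.1 (ht hmem)
  intro g hg hgc hgs
  have hg0 : ∀ t, t ∉ Ioo 0 T → g t = 0 := fun t ht =>
    image_eq_zero_of_notMem_tsupport fun h => ht (hgs h)
  obtain ⟨T', hT'T, hT'⟩ : ∃ T' < T, ∀ t, T' < t → g t = 0 := by
    rcases (tsupport g).eq_empty_or_nonempty with he | hne
    · exact ⟨0, hT, fun t _ => image_eq_zero_of_notMem_tsupport (by simp [he])⟩
    · obtain ⟨a, ha, hmax⟩ := hgc.isCompact.exists_isGreatest hne
      exact ⟨a, (hgs ha).2, fun t ht => image_eq_zero_of_notMem_tsupport fun h =>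
        absurd (hmax h) (not_le.2 ht)⟩
  -- The primitive of g normalised to vanish at T. As g has compact support in (0,T), it vanishes on
  -- a neighbourhood of T, and its value at 0 is -∫ g.
  set θ : ℝ → ℝ := fun t => (∫ τ in (0 : ℝ)..t, g τ) - ∫ τ in (0 : ℝ)..T, g τ
  have hgi : ∀ a b, IntervalIntegrable g volume a b := fun a b => hg.continuous.intervalIntegrable a b
  have hθ : ∀ t, θ t = -∫ τ in t..T, g τ := fun t => by
    rw [← intervalIntegral.integral_interval_sub_left (hgi 0 T) (hgi 0 t)]
    ring
  have hθd : ∀ t, HasDerivAt θ (g t) t := fun t =>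
    (intervalIntegral.integral_hasDerivAt_right (hgi 0 t)
      (hg.continuous.stronglyMeasurableAtFilter _ _) hg.continuous.continuousAt).sub_const _
  have hθ' : deriv θ = g := funext fun t => (hθd t).deriv
  have hθs : ContDiff ℝ ∞ θ := by
    rw [contDiff_infty_iff_deriv]
    exact ⟨fun t => (hθd t).differentiableAt, hθ' ▸ hg⟩
  have hθ0 : ∀ t, T' ≤ t → θ t = 0 := fun t ht => by
    rw [hθ, neg_eq_zero]
    refine intervalIntegral.integral_zero_ae (Filter.Eventually.of_forall fun τ hτ => hT' τ ?_)
    rcases le_total t T with h | h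
    · rw [uIoc_of_le h] at hτ; exact ht.trans_lt hτ.1
    · rw [uIoc_of_ge h] at hτ; exact hT'T.trans hτ.1
  have hθI : ∀ t ∈ Ioo 0 T, -θ t = ∫ τ, (Ioi t).indicator g τ ∂ν := fun t ht => by
    rw [hθ, neg_neg, intervalIntegral.integral_of_le ht.2.le, setIntegral_indicator measurableSet_Ioi,
      integral_Ioc_eq_integral_Ioo]
    congr 2
    ext τ; simp only [mem_Ioo, mem_inter_iff, mem_Ioi]
    exact ⟨fun h => ⟨⟨ht.1.trans h.1, h.2⟩, h.1⟩, fun h => ⟨h.2, h.1.2⟩⟩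
  have hmain := h θ hθs ⟨T', hT'T, hθ0⟩
  obtain ⟨M, hM⟩ := hgc.exists_bound_of_continuous hg.continuous
  have hgK : Integrable (fun p : ℝ × ℝ => g p.1 * K p) (ν.prod ν) :=
    hK.bdd_mul (c := M) (by fun_prop) (Filter.Eventually.of_forall fun p => hM p.1)
  have hswap : ∫ t, g t * P t ∂ν = -∫ t, A t * θ t ∂ν := by
    have e1 : ∫ t, g t * P t ∂ν = ∫ t, ∫ τ, g t * K (t, τ) ∂ν ∂ν := by
      refine integral_congr_ae ?_
      filter_upwards [hP'] with t ht
      rw [← ht, integral_const_mul]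
    rw [e1, integral_integral_swap hgK, ← integral_neg]
    refine setIntegral_congr_fun measurableSet_Ioo fun t ht => ?_
    have e2 : ∀ τ, g τ * K (τ, t) = A t * (Ioi t).indicator g τ := fun τ => by
      by_cases hτ : t < τ <;> simp [K, hτ, mul_comm]
    simp only [e2]
    rw [integral_const_mul, ← hθI t ht, mul_neg]
  have hθz : θ 0 = -∫ t, g t ∂ν := by
    rw [hθ, intervalIntegral.integral_of_le hT.le, integral_Ioc_eq_integral_Ioo]
  have hgU : Integrable (fun t => g t * U t) ν :=
    Integrable.bdd_mul hU (c := M) hg.continuous.aestronglyMeasurable (Filter.Eventually.of_forall hM)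
  have hgP : Integrable (fun t => g t * P t) ν :=
    Integrable.bdd_mul hPi (c := M) hg.continuous.aestronglyMeasurable (Filter.Eventually.of_forall hM)
  have hgc' : Integrable (fun t => g t * c) ν :=
    Integrable.bdd_mul (integrable_const c) (c := M) hg.continuous.aestronglyMeasurable (Filter.Eventually.of_forall hM)
  have e : ∫ t, g t • (U t - (c + P t)) = ∫ t, g t • (U t - (c + P t)) ∂ν :=
    (setIntegral_eq_integral_of_forall_compl_eq_zero fun t ht => by
      rw [hg0 t ht, zero_smul]).symm
  rw [e]
  have e3 : ∀ t, g t • (U t - (c + P t)) = g t * U t - (g t * c + g t * P t) := fun t => by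
    rw [smul_eq_mul]; ring
  simp only [e3]
  rw [integral_sub hgU (hgc'.fun_add hgP), integral_add hgc' hgP, integral_mul_const, hswap]
  rw [hθ', hθz] at hmain
  simp only [mul_comm (U _)] at hmain
  linarith

section TimeSlices

variable {d : ℕ} {Ω : Set (E d)} {T : ℝ}

lemma contDiff_cutoff_snd {θ : ℝ → ℝ} (hθ : ContDiff ℝ ∞ θ) :
    ContDiff ℝ ∞ (fun z : E d × ℝ => θ z.2) :=
  hθ.comp contDiff_snd

lemma isTest_of_contDiffOn (hb : Bornology.IsBounded Ω) {φ : E d × ℝ → ℝ}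
    (hφ : ContDiffOn ℝ 1 φ (closure Ω ×ˢ Icc 0 T))
    (h0 : ∃ T' < T, ∀ z, T' ≤ z.2 → φ z = 0) : IsTest Ω T φ := by
  refine ⟨hφ.mono (prod_mono le_rfl Ico_subset_Icc_self), ?_⟩
  obtain ⟨T', hT', hz⟩ := h0
  refine ⟨closure Ω ×ˢ Icc 0 T', isCompact_closed_cylinder hb T',
    prod_mono le_rfl fun t ht => ⟨ht.1, ht.2.trans_lt hT'⟩, fun z hz1 hz2 => hz z ?_⟩
  by_contra hlt
  exact hz2 ⟨hz1.1, hz1.2.1, (not_le.1 hlt).le⟩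

lemma hasFDerivAt_cutoff_mul {θ : ℝ → ℝ} (hθ : ContDiff ℝ ∞ θ) {ψ : E d × ℝ → ℝ} {z : E d × ℝ}
    (hψ : DifferentiableAt ℝ ψ z) (e : E d × ℝ) :
    fderiv ℝ (fun z : E d × ℝ => θ z.2 * ψ z) z e
      = θ z.2 * fderiv ℝ ψ z e + e.2 * deriv θ z.2 * ψ z := by
  have h1 : HasFDerivAt (fun z : E d × ℝ => θ z.2)
      ((ContinuousLinearMap.toSpanSingleton ℝ (deriv θ z.2)).comp
        (ContinuousLinearMap.snd ℝ (E d) ℝ)) z :=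
    ((hθ.differentiable (by simp)) z.2).hasDerivAt.hasFDerivAt.comp z hasFDerivAt_snd
  have h2 := h1.mul hψ.hasFDerivAt
  rw [show (fun z : E d × ℝ => θ z.2 * ψ z) = (fun z : E d × ℝ => θ z.2) * ψ from rfl, h2.fderiv]
  simp
  ring

/-- Testing a weak continuity equation with a `C^1` function on almost every time slice. -/
lemma IsWeakContinuityEq.ae_slice (hΩ : IsOpen Ω) (hb : Bornology.IsBounded Ω) (hT : 0 < T)
    {u : E d × ℝ → ℝ} {q : Fin d → E d × ℝ → ℝ} {u₀ : E d → ℝ}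
    (h : IsWeakContinuityEq Ω T u q u₀)
    (hu : Integrable u (volume.restrict (Ω ×ˢ Ioo 0 T)))
    (hq : ∀ k, Integrable (q k) (volume.restrict (Ω ×ˢ Ioo 0 T)))
    {ψ : E d × ℝ → ℝ} (hψ : ContDiffOn ℝ 1 ψ (closure Ω ×ˢ Icc 0 T)) :
    ∀ᵐ t ∂(volume.restrict (Ioo 0 T)),
      ∫ x in Ω, ψ (x, t) * u (x, t) = (∫ x in Ω, u₀ x * ψ (x, 0))
        + ∫ z in Ω ×ˢ Ioo 0 t, (dt ψ z * u z - ∑ k, dx k ψ z * q k z) := by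
  set Φ : E d × ℝ → ℝ := fun z => dt ψ z * u z - ∑ k, dx k ψ z * q k z
  have hψb : IsBddCont Ω T ψ := isBddCont_of_continuousOn hb hψ.continuousOn
  have hψu := hψb.integrable_mul hΩ hu
  have hdt := (isBddCont_dt hΩ hb hψ).integrable_mul hΩ hu
  have hdx : Integrable (fun z => ∑ k, dx k ψ z * q k z) (volume.restrict (Ω ×ˢ Ioo 0 T)) :=
    integrable_finsetSum _ fun k _ => (isBddCont_dx hΩ hb hψ k).integrable_mul hΩ (hq k)
  have hΦ : Integrable Φ (volume.restrict (Ω ×ˢ Ioo 0 T)) := hdt.fun_sub hdx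
  have hmain := ae_eq_of_weak_deriv hT (U := fun t => ∫ x in Ω, ψ (x, t) * u (x, t))
    (A := fun t => ∫ x in Ω, Φ (x, t)) (c := ∫ x in Ω, u₀ x * ψ (x, 0)) ?_ ?_ ?_
  · filter_upwards [hmain, ae_restrict_mem measurableSet_Ioo] with t ht htm
    rw [ht]
    congr 1
    have hΦt := hΦ.mono_measure (cylinder_mono (Ω := Ω) htm.2.le)
    rw [restrict_cylinder] at hΦt ⊢
    exact (integral_prod_symm _ hΦt).symm
  · rw [restrict_cylinder] at hψu
    exact hψu.integral_prod_right
  · rw [restrict_cylinder] at hΦ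
    exact hΦ.integral_prod_right
  rintro θ hθ ⟨T', hT', hθ0⟩
  have hθb : IsBddCont Ω T (fun z => θ z.2) :=
    isBddCont_of_continuousOn hb (contDiff_cutoff_snd hθ).continuous.continuousOn
  have hθdb : IsBddCont Ω T (fun z => deriv θ z.2) :=
    isBddCont_of_continuousOn hb
      ((hθ.continuous_deriv (by simp)).comp continuous_snd).continuousOn
  -- Testing with θ(t) ψ(x,t) separates time from space: the terms with θ' and θ give the weak time
  -- derivative of t ↦ ∫ ψ u dx.
  have hw := h (fun z => θ z.2 * ψ z) (isTest_of_contDiffOn hb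
    (((contDiff_cutoff_snd hθ).of_le (by simp)).contDiffOn.mul hψ)
    ⟨T', hT', fun z hz => by rw [hθ0 _ hz, zero_mul]⟩)
  have hms : MeasurableSet (Ω ×ˢ Ioo 0 T) := hΩ.measurableSet.prod measurableSet_Ioo
  have e1 : ∫ z in Ω ×ˢ Ioo 0 T, u z * dt (fun z => θ z.2 * ψ z) z
      = ∫ z in Ω ×ˢ Ioo 0 T, (θ z.2 * (dt ψ z * u z) + deriv θ z.2 * (ψ z * u z)) := by
    refine setIntegral_congr_fun hms fun z hz => ?_
    simp only [dt]
    rw [hasFDerivAt_cutoff_mul hθ (differentiableAt_of_mem_cylinder hΩ hψ hz)]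
    ring
  have e2 : ∫ z in Ω ×ˢ Ioo 0 T, ∑ k, q k z * dx k (fun z => θ z.2 * ψ z) z
      = ∫ z in Ω ×ˢ Ioo 0 T, θ z.2 * ∑ k, dx k ψ z * q k z := by
    refine setIntegral_congr_fun hms fun z hz => ?_
    rw [Finset.mul_sum]
    refine Finset.sum_congr rfl fun k _ => ?_
    simp only [dx]
    rw [hasFDerivAt_cutoff_mul hθ (differentiableAt_of_mem_cylinder hΩ hψ hz)]
    ring
  have e3 : ∫ x in Ω, u₀ x * (θ ((x, (0 : ℝ)) : E d × ℝ).2 * ψ (x, 0))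
      = (∫ x in Ω, u₀ x * ψ (x, 0)) * θ 0 := by
    rw [← integral_mul_const]
    exact integral_congr_ae (Filter.Eventually.of_forall fun x => by ring)
  have i1 := hθb.integrable_mul hΩ hdt
  have i2 := hθdb.integrable_mul hΩ hψu
  have i3 := hθb.integrable_mul hΩ hdx
  have i4 := hθb.integrable_mul hΩ hΦ
  have e4 : ∫ t in Ioo 0 T, (∫ x in Ω, ψ (x, t) * u (x, t)) * deriv θ t
      = ∫ z in Ω ×ˢ Ioo 0 T, deriv θ z.2 * (ψ z * u z) := by
    rw [restrict_cylinder] at i2 ⊢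
    rw [integral_prod_symm _ i2]
    simp only [integral_const_mul, mul_comm]
  have e5 : ∫ t in Ioo 0 T, (∫ x in Ω, Φ (x, t)) * θ t = ∫ z in Ω ×ˢ Ioo 0 T, θ z.2 * Φ z := by
    rw [restrict_cylinder] at i4 ⊢
    rw [integral_prod_symm _ i4]
    simp only [integral_const_mul]
    exact integral_congr_ae (Filter.Eventually.of_forall fun t => mul_comm _ _)
  have e6 : ∫ z in Ω ×ˢ Ioo 0 T, θ z.2 * Φ z = (∫ z in Ω ×ˢ Ioo 0 T, θ z.2 * (dt ψ z * u z))
      - ∫ z in Ω ×ˢ Ioo 0 T, θ z.2 * ∑ k, dx k ψ z * q k z := by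
    rw [← integral_sub i1 i3]
    simp only [Φ, mul_sub]
  rw [e1, e2, e3, integral_add i1 i2] at hw
  rw [e4, e5, e6]
  linarith

end TimeSlices


/-! ### Inward translations -/

/-- At a boundary point the epigraph direction works: moving along e leaves the projection onto its
orthogonal complement fixed and strictly raises the height, so points on or above the graph move
strictly above it. At an interior point no shift is needed. -/
lemma IsBoundedLipschitzDomain.exists_inward {d : ℕ} {Ω : Set (E d)}
    (hΩ : IsBoundedLipschitzDomain Ω) {x₀ : E d} (hx₀ : x₀ ∈ closure Ω) :
    ∃ (e : E d) (r : ℝ), 0 < r ∧ ∀ y ∈ closure Ω ∩ Metric.closedBall x₀ r, ∀ ε ∈ Ioo 0 r,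
      y + ε • e ∈ Ω := by
  by_cases hx : x₀ ∈ Ω
  · obtain ⟨r, hr, hball⟩ := Metric.isOpen_iff.1 hΩ.isOpen x₀ hx
    refine ⟨0, r / 2, by positivity, fun y hy ε _ => ?_⟩
    rw [smul_zero, add_zero]
    exact hball (Metric.closedBall_subset_ball (by linarith) hy.2)
  · have hfr : x₀ ∈ frontier Ω := ⟨hx₀, by rwa [hΩ.isOpen.interior_eq]⟩
    obtain ⟨e, R, K, γ, he, hR, hγ, hiff⟩ := hΩ.lipschitz x₀ hfr
    -- With radius and shift at most R/3, the shifted points stay in the ball where the graph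
    -- description is valid.
    refine ⟨e, R / 3, by positivity, fun y hy ε hε => ?_⟩
    have hyR : y ∈ Metric.ball x₀ R := Metric.closedBall_subset_ball (by linarith) hy.2
    have hcl : IsClosed {y : E d | γ ((ℝ ∙ e)ᗮ.orthogonalProjectionOnto y) ≤ ⟪e, y⟫} :=
      isClosed_le (hγ.continuous.comp (by fun_prop)) (by fun_prop)
    have hle : γ ((ℝ ∙ e)ᗮ.orthogonalProjectionOnto y) ≤ ⟪e, y⟫ := by
      have hsub : Metric.ball x₀ R ∩ Ω
          ⊆ {y : E d | γ ((ℝ ∙ e)ᗮ.orthogonalProjectionOnto y) ≤ ⟪e, y⟫} :=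
        fun z hz => ((hiff z hz.1).1 hz.2).le
      exact closure_minimal hsub hcl (Metric.isOpen_ball.inter_closure ⟨hyR, hy.1⟩)
    have hmem : y + ε • e ∈ Metric.ball x₀ R := by
      rw [Metric.mem_ball, dist_eq_norm]
      have h1 : ‖y - x₀‖ ≤ R / 3 := by rw [← dist_eq_norm]; exact hy.2
      calc ‖y + ε • e - x₀‖ = ‖(y - x₀) + ε • e‖ := by congr 1; abel
        _ ≤ ‖y - x₀‖ + ‖ε • e‖ := norm_add_le _ _
        _ = ‖y - x₀‖ + ε := by rw [norm_smul, he, mul_one, Real.norm_of_nonneg hε.1.le]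
        _ < R := by linarith [hε.2]
    rw [hiff _ hmem]
    have hpe : (ℝ ∙ e)ᗮ.orthogonalProjectionOnto e = 0 :=
      Submodule.orthogonalProjectionOnto_apply_of_mem_orthogonal
        (Submodule.le_orthogonal_orthogonal _ (Submodule.mem_span_singleton_self e))
    rw [map_add, map_smul, hpe, smul_zero, add_zero, inner_add_right, inner_smul_right,
      real_inner_self_eq_norm_sq, he]
    have := hε.1
    linarith

/-! ### Zero-flux fields and weak gradients -/

section ZeroFlux

variable {d : ℕ} {Ω : Set (E d)} {T : ℝ}

/-- Smooth functions of space-time supported in a compact time interval inside `(0, T)`. -/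
structure IsTimeTest (T : ℝ) (φ : E d × ℝ → ℝ) : Prop where
  smooth : ContDiff ℝ ∞ φ
  supp : ∃ a b, 0 < a ∧ b < T ∧ tsupport φ ⊆ univ ×ˢ Icc a b

/-- The field `F` on `Ω × (0,T)` has weak spatial divergence `g` and zero normal flux. -/
def IsZeroFlux (Ω : Set (E d)) (T : ℝ) (F : Fin d → E d × ℝ → ℝ) (g : E d × ℝ → ℝ) : Prop :=
  ∀ φ, IsTimeTest T φ →
    ∫ z in Ω ×ˢ Ioo 0 T, ∑ k, dx k φ z * F k z = -∫ z in Ω ×ˢ Ioo 0 T, φ z * g z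

/-- `y` is the weak spatial gradient of `w` in `Ω × (0,T)`. -/
def IsWeakSpaceGradient (Ω : Set (E d)) (T : ℝ) (w : E d × ℝ → ℝ) (y : Fin d → E d × ℝ → ℝ) :
    Prop :=
  ∀ φ : E d × ℝ → ℝ, ContDiff ℝ ∞ φ → HasCompactSupport φ → tsupport φ ⊆ Ω ×ˢ Ioo 0 T → ∀ k,
    ∫ z in Ω ×ˢ Ioo 0 T, dx k φ z * w z = -∫ z in Ω ×ˢ Ioo 0 T, φ z * y k z

lemma IsTimeTest.mul_smooth {φ ψ : E d × ℝ → ℝ} (hφ : IsTimeTest T φ) (hψ : ContDiff ℝ ∞ ψ) :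
    IsTimeTest T (fun z => φ z * ψ z) := by
  obtain ⟨a, b, ha, hb, hs⟩ := hφ.supp
  exact ⟨hφ.smooth.mul hψ, a, b, ha, hb, (tsupport_mul_subset_left).trans hs⟩

lemma isBddCont_of_contDiff (hb : Bornology.IsBounded Ω) {φ : E d × ℝ → ℝ}
    (hφ : ContDiff ℝ ∞ φ) : IsBddCont Ω T φ :=
  isBddCont_of_continuousOn hb hφ.continuous.continuousOn

lemma isBddCont_dx_of_contDiff (hb : Bornology.IsBounded Ω) {φ : E d × ℝ → ℝ}
    (hφ : ContDiff ℝ ∞ φ) (k : Fin d) : IsBddCont Ω T (dx k φ) :=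
  isBddCont_of_continuousOn hb
    (((hφ.continuous_fderiv (by simp)).clm_apply continuous_const).continuousOn)

lemma dx_mul {φ ψ : E d × ℝ → ℝ} {z : E d × ℝ} (hφ : DifferentiableAt ℝ φ z)
    (hψ : DifferentiableAt ℝ ψ z) (k : Fin d) :
    dx k (fun z => φ z * ψ z) z = φ z * dx k ψ z + dx k φ z * ψ z := by
  have h := (hφ.hasFDerivAt.mul hψ.hasFDerivAt).fderiv
  rw [dx, show (fun z => φ z * ψ z) = φ * ψ from rfl, h]
  simp [dx, mul_comm]

lemma dx_sub {φ ψ : E d × ℝ → ℝ} {z : E d × ℝ} (hφ : DifferentiableAt ℝ φ z)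
    (hψ : DifferentiableAt ℝ ψ z) (k : Fin d) :
    dx k (fun z => φ z - ψ z) z = dx k φ z - dx k ψ z := by
  have h := (hφ.hasFDerivAt.sub hψ.hasFDerivAt).fderiv
  rw [dx, show (fun z => φ z - ψ z) = φ - ψ from rfl, h]
  simp [dx]

/-! ### Mollification with inward shifted kernels -/

section Mollification

open scoped Convolution Pointwise Topology

instance : (volume : Measure (E d × ℝ)).IsAddHaarMeasure :=
  inferInstanceAs ((volume : Measure (E d)).prod (volume : Measure ℝ)).IsAddHaarMeasure

/-- The derivative of a mollification of an integrable function. -/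
lemma dx_convolution {κ G : E d × ℝ → ℝ} (hκ : ContDiff ℝ ∞ κ) (hκc : HasCompactSupport κ)
    (hG : Integrable G) (k : Fin d) (z : E d × ℝ) :
    dx k (κ ⋆[ContinuousLinearMap.lsmul ℝ ℝ, volume] G) z = ∫ t, dx k κ (z - t) * G t := by
  have h := (hκc.hasFDerivAt_convolution_left (ContinuousLinearMap.lsmul ℝ ℝ)
    (hκ.of_le (by simp)) hG.locallyIntegrable z).fderiv
  have h1 : Continuous (fun t => fderiv ℝ κ (z - t)) :=
    (hκ.continuous_fderiv (by simp)).comp (by fun_prop)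
  obtain ⟨C, hC⟩ := (hκc.fderiv (𝕜 := ℝ)).exists_bound_of_continuous
    (hκ.continuous_fderiv (by simp))
  have h2 : Integrable (fun t => G t • fderiv ℝ κ (z - t)) :=
    hG.smul_bdd C h1.aestronglyMeasurable (Filter.Eventually.of_forall fun t => hC _)
  rw [dx, h, convolution_eq_swap, ContinuousLinearMap.integral_apply]
  · rfl
  · refine h2.congr (Filter.Eventually.of_forall fun t => ?_)
    ext v <;> simp [ContinuousLinearMap.precompL_apply, mul_comm]

/-- Mollifying kernels adapted to inward translations of a compact set. -/
lemma exists_mollifiers {D S : Set (E d × ℝ)} (hD : IsOpen D) (hS : IsCompact S)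
    {c : ℕ → E d × ℝ} (hc : Filter.Tendsto c Filter.atTop (𝓝 0))
    (hin : ∀ n, ∀ s ∈ S, s + c n ∈ D) :
    ∃ κ : ℕ → E d × ℝ → ℝ, (∀ n, ContDiff ℝ ∞ (κ n)) ∧ (∀ n, HasCompactSupport (κ n)) ∧
      (∀ n z, 0 ≤ κ n z) ∧ (∀ n, ∫ z, κ n z = 1) ∧
      Filter.Tendsto (fun n => Function.support (κ n)) Filter.atTop (𝓝 0).smallSets ∧
      ∀ n, ∃ K ⊆ D, IsCompact K ∧ ∀ t ∈ Function.support (κ n), ∀ s ∈ S, t + s ∈ K := by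
  have hδ : ∀ n : ℕ, ∃ δ : ℝ, 0 < δ ∧ δ < 1 / (n + 1) ∧
      Metric.cthickening δ ((fun s => s + c n) '' S) ⊆ D := fun n => by
    obtain ⟨δ, h0, hsub⟩ := (hS.image (continuous_add_const (c n))).exists_cthickening_subset_open hD
      (by rintro _ ⟨s, hs, rfl⟩; exact hin n s hs)
    have hn : (0 : ℝ) < 1 / (n + 1) := Nat.one_div_pos_of_nat
    -- The additional halving makes the bound by 1/(n+1) strict, so that the supports shrink to the
    -- origin.
    exact ⟨min δ (1 / (n + 1) / 2), by positivity,
      (min_le_right _ _).trans_lt (by linarith), (Metric.cthickening_mono (min_le_left _ _) _).trans hsub⟩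
  choose δ hδ0 hδn hδD using hδ
  let f : ∀ n, ContDiffBump (c n) := fun n => ⟨δ n / 2, δ n, half_pos (hδ0 n), half_lt_self (hδ0 n)⟩
  refine ⟨fun n => (f n).normed volume, fun n => (f n).contDiff_normed,
    fun n => (f n).hasCompactSupport_normed, fun n z => (f n).nonneg_normed z,
    fun n => (f n).integral_normed, ?_, fun n => ⟨Metric.closedBall (c n) (δ n) + S, ?_,
      (isCompact_closedBall _ _).add hS, fun t ht s hs => add_mem_add ?_ hs⟩⟩
  · rw [Filter.tendsto_smallSets_iff]
    intro t ht
    obtain ⟨ε, hε, hball⟩ := Metric.mem_nhds_iff.1 ht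
    have h1 : ∀ᶠ n in Filter.atTop, dist (c n) 0 < ε / 2 :=
      (Metric.tendsto_nhds.1 hc) _ (half_pos hε)
    have h2 : ∀ᶠ n : ℕ in Filter.atTop, (1 : ℝ) / (n + 1) < ε / 2 :=
      tendsto_one_div_add_atTop_nhds_zero_nat.eventually (gt_mem_nhds (half_pos hε))
    filter_upwards [h1, h2] with n hn1 hn2
    rw [(f n).support_normed_eq]
    refine subset_trans (fun z hz => ?_) hball
    rw [Metric.mem_ball] at hz ⊢
    have hz' : dist z (c n) < δ n := hz
    linarith [dist_triangle z (c n) 0, hδn n]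
  · rintro _ ⟨b, hb, s, hs, rfl⟩
    -- Adding the kernel ball around c n to S stays within distance δ n of the translate of S by c
    -- n, which lies inside D.
    refine hδD n (Metric.mem_cthickening_of_dist_le (b + s) (s + c n) _ _ ⟨s, hs, rfl⟩ ?_)
    have : dist (b + s) (s + c n) = dist b (c n) := by
      rw [add_comm b s, dist_add_left]
    rw [this]
    exact hb
  · rw [(f n).support_normed_eq] at ht
    exact Metric.ball_subset_closedBall ht

variable {F : Fin d → E d × ℝ → ℝ} {g w : E d × ℝ → ℝ} {y : Fin d → E d × ℝ → ℝ}

/-- The product `χ F`, extended by zero. -/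
noncomputable def extField (Ω : Set (E d)) (T : ℝ) (χ f : E d × ℝ → ℝ) : E d × ℝ → ℝ :=
  (Ω ×ˢ Ioo 0 T).indicator fun z => χ z * f z

/-- The divergence of `χ F`, extended by zero. -/
noncomputable def extDiv (Ω : Set (E d)) (T : ℝ) (χ : E d × ℝ → ℝ) (F : Fin d → E d × ℝ → ℝ)
    (g : E d × ℝ → ℝ) : E d × ℝ → ℝ :=
  (Ω ×ˢ Ioo 0 T).indicator fun z => χ z * g z + ∑ k, dx k χ z * F k z

lemma IsBddCont.integrable_indicator (hΩ : IsOpen Ω) (hb : Bornology.IsBounded Ω)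
    {f : E d × ℝ → ℝ} (hf : IsBddCont Ω T f) : Integrable ((Ω ×ˢ Ioo 0 T).indicator f) :=
  (integrable_indicator_iff (hΩ.measurableSet.prod measurableSet_Ioo)).2 (hf.integrable hΩ hb)

lemma isBddCont_extDiv (hb : Bornology.IsBounded Ω) {χ : E d × ℝ → ℝ} (hχ : ContDiff ℝ ∞ χ)
    (hF : ∀ k, IsBddCont Ω T (F k)) (hg : IsBddCont Ω T g) :
    IsBddCont Ω T (fun z => χ z * g z + ∑ k, dx k χ z * F k z) :=
  ((isBddCont_of_contDiff hb hχ).mul hg).add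
    (IsBddCont.sum fun k _ => (isBddCont_dx_of_contDiff hb hχ k).mul (hF k))

/-- The divergence of a mollified zero-flux field. -/
lemma sum_dx_convolution (hΩ : IsOpen Ω) (hb : Bornology.IsBounded Ω)
    (hF : ∀ k, IsBddCont Ω T (F k)) (hg : IsBddCont Ω T g) (hFg : IsZeroFlux Ω T F g)
    {χ : E d × ℝ → ℝ} (hχ : IsTimeTest T χ) {κ : E d × ℝ → ℝ} (hκ : ContDiff ℝ ∞ κ)
    (hκc : HasCompactSupport κ) (z : E d × ℝ) :
    ∑ k, dx k (κ ⋆[ContinuousLinearMap.lsmul ℝ ℝ, volume] extField Ω T χ (F k)) z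
      = (κ ⋆[ContinuousLinearMap.lsmul ℝ ℝ, volume] extDiv Ω T χ F g) z := by
  have hm : MeasurableSet (Ω ×ˢ Ioo 0 T) := hΩ.measurableSet.prod measurableSet_Ioo
  have hχb := isBddCont_of_contDiff (T := T) hb hχ.smooth
  have hs : ContDiff ℝ ∞ (fun t : E d × ℝ => z - t) := contDiff_const.sub contDiff_id
  have hκz : ContDiff ℝ ∞ (fun t => κ (z - t)) := hκ.comp hs
  have hκb := isBddCont_of_contDiff (T := T) hb hκz
  have hdκ : ∀ k t, dx k (fun t => κ (z - t)) t = -dx k κ (z - t) := fun k t => by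
    have h1 : HasFDerivAt (fun t : E d × ℝ => z - t) (-ContinuousLinearMap.id ℝ (E d × ℝ)) t :=
      (hasFDerivAt_id t).const_sub z
    have h2 := ((hκ.differentiable (by simp) (z - t)).hasFDerivAt.comp t h1).fderiv
    change fderiv ℝ (κ ∘ fun t => z - t) t _ = _
    rw [h2]
    simp [dx]
  have hdκb : ∀ k, IsBddCont Ω T (fun t => dx k κ (z - t)) := fun k => by
    have := (IsBddCont.const (-1)).mul (isBddCont_dx_of_contDiff (T := T) hb hκz k)
    simpa [hdκ] using this
  have hdχb := fun k => isBddCont_dx_of_contDiff (T := T) hb hχ.smooth k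
  have hL : ∀ k, dx k (κ ⋆[ContinuousLinearMap.lsmul ℝ ℝ, volume] extField Ω T χ (F k)) z
      = ∫ t in Ω ×ˢ Ioo 0 T, dx k κ (z - t) * (χ t * F k t) := fun k => by
    rw [dx_convolution hκ hκc (G := extField Ω T χ (F k))
      ((hχb.mul (hF k)).integrable_indicator hΩ hb),
      ← integral_indicator hm]
    refine integral_congr_ae (Filter.Eventually.of_forall fun t => ?_)
    by_cases ht : t ∈ Ω ×ˢ Ioo 0 T <;> simp [extField, ht]
  have hR : (κ ⋆[ContinuousLinearMap.lsmul ℝ ℝ, volume] extDiv Ω T χ F g) z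
      = ∫ t in Ω ×ˢ Ioo 0 T, κ (z - t) * (χ t * g t + ∑ k, dx k χ t * F k t) := by
    rw [convolution_eq_swap, ← integral_indicator hm]
    refine integral_congr_ae (Filter.Eventually.of_forall fun t => ?_)
    by_cases ht : t ∈ Ω ×ˢ Ioo 0 T
    · simp only [extDiv, indicator_of_mem ht]; simp
    · simp only [extDiv, indicator_of_notMem ht]; simp
  -- As a function of t this need not vanish on ∂Ω. The zero normal flux makes it admissible, so
  -- extending χF by zero creates no surface divergence.
  have htest := hFg (fun t => χ t * κ (z - t)) (hχ.mul_smooth hκz)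
  have e : ∀ t, ∑ k, dx k (fun t => χ t * κ (z - t)) t * F k t
      = κ (z - t) * (∑ k, dx k χ t * F k t) - ∑ k, dx k κ (z - t) * (χ t * F k t) := fun t => by
    rw [Finset.mul_sum, ← Finset.sum_sub_distrib]
    refine Finset.sum_congr rfl fun k _ => ?_
    rw [dx_mul (hχ.smooth.differentiable (by simp) t) (hκz.differentiable (by simp) t), hdκ]
    ring
  have i1 : ∀ k, Integrable (fun t => dx k κ (z - t) * (χ t * F k t))
      (volume.restrict (Ω ×ˢ Ioo 0 T)) := fun k =>
    ((hdκb k).mul (hχb.mul (hF k))).integrable hΩ hb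
  have i2 : Integrable (fun t => κ (z - t) * (∑ k, dx k χ t * F k t))
      (volume.restrict (Ω ×ˢ Ioo 0 T)) :=
    (hκb.mul (IsBddCont.sum fun k _ => (hdχb k).mul (hF k))).integrable hΩ hb
  have i3 : Integrable (fun t => χ t * κ (z - t) * g t) (volume.restrict (Ω ×ˢ Ioo 0 T)) :=
    ((hχb.mul hκb).mul hg).integrable hΩ hb
  simp only [e] at htest
  rw [integral_sub i2 (integrable_finsetSum _ fun k _ => i1 k),
    integral_finsetSum _ fun k _ => i1 k] at htest
  rw [Finset.sum_congr rfl fun k _ => hL k, hR]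
  have e2 : ∀ t, κ (z - t) * (χ t * g t + ∑ k, dx k χ t * F k t)
      = χ t * κ (z - t) * g t + κ (z - t) * (∑ k, dx k χ t * F k t) := fun t => by ring
  simp only [e2]
  rw [integral_add i3 i2]
  linarith

lemma abs_convolution_le {κ h : E d × ℝ → ℝ} (hκc : HasCompactSupport κ) (h0 : ∀ z, 0 ≤ κ z)
    (h1 : ∫ z, κ z = 1) (hh : AEStronglyMeasurable h volume) {C : ℝ} (hC0 : 0 ≤ C)
    (hC : ∀ z, |h z| ≤ C) (z : E d × ℝ) :
    |(κ ⋆[ContinuousLinearMap.lsmul ℝ ℝ, volume] h) z| ≤ C := by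
  obtain ⟨R, hR⟩ := hκc.isCompact.isBounded.subset_ball 0
  have := dist_convolution_le (μ := volume) (x₀ := z) (z₀ := (0 : ℝ)) hC0
    ((subset_tsupport κ).trans hR) h0 h1 hh (fun x _ => by simpa using hC x)
  simpa using this

/-- Convergence of the integrals of mollified bounded functions. -/
lemma tendsto_integral_convolution (hΩ : IsOpen Ω) (hb : Bornology.IsBounded Ω)
    {κ : ℕ → E d × ℝ → ℝ} (hκs : ∀ n, ContDiff ℝ ∞ (κ n)) (hκc : ∀ n, HasCompactSupport (κ n))
    (h0 : ∀ n z, 0 ≤ κ n z) (h1 : ∀ n, ∫ z, κ n z = 1)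
    (hsmall : Filter.Tendsto (fun n => Function.support (κ n)) Filter.atTop (𝓝 0).smallSets)
    {f : E d × ℝ → ℝ} (hf : IsBddCont Ω T f)
    (hw : Integrable w (volume.restrict (Ω ×ˢ Ioo 0 T))) :
    Filter.Tendsto (fun n => ∫ z in Ω ×ˢ Ioo 0 T,
      (κ n ⋆[ContinuousLinearMap.lsmul ℝ ℝ, volume] (Ω ×ˢ Ioo 0 T).indicator f) z * w z)
      Filter.atTop (𝓝 (∫ z in Ω ×ˢ Ioo 0 T, f z * w z)) := by
  have hm : MeasurableSet (Ω ×ˢ Ioo 0 T) := hΩ.measurableSet.prod measurableSet_Ioo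
  have hfi := hf.integrable_indicator hΩ hb
  obtain ⟨C, hC0, hC⟩ := hf.bdd
  have hC' : ∀ z, |(Ω ×ˢ Ioo 0 T).indicator f z| ≤ C := fun z => by
    by_cases hz : z ∈ Ω ×ˢ Ioo 0 T
    · simpa [indicator_of_mem hz] using hC z hz
    · simpa [indicator_of_notMem hz] using hC0
  refine tendsto_integral_of_dominated_convergence (fun z => C * ‖w z‖) (fun n => ?_)
    (hw.norm.const_mul C) (fun n => Filter.Eventually.of_forall fun z => ?_) ?_
  · exact ((hκc n).continuous_convolution_left (ContinuousLinearMap.lsmul ℝ ℝ) (hκs n).continuous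
      hfi.locallyIntegrable).aestronglyMeasurable.mul hw.1
  · rw [norm_mul]
    exact mul_le_mul_of_nonneg_right
      (abs_convolution_le (hκc n) (h0 n) (h1 n) hfi.1 hC0 hC' z) (norm_nonneg _)
  · filter_upwards [ae_restrict_mem hm] with z hz
    -- The extension by zero is continuous at interior points, so its mollifications converge there
    -- pointwise. Boundedness of f supplies the dominating function although w is only integrable.
    refine Filter.Tendsto.mul_const _ ?_
    have hopen : Ω ×ˢ Ioo 0 T ∈ 𝓝 z := (hΩ.prod isOpen_Ioo).mem_nhds hz
    have hcont : ContinuousAt ((Ω ×ˢ Ioo 0 T).indicator f) z :=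
      (hf.cont.continuousAt hopen).congr
        (Filter.mem_of_superset hopen fun x hx => (indicator_of_mem hx f).symm)
    have hct : Filter.Tendsto ((Ω ×ˢ Ioo 0 T).indicator f) (𝓝 z) (𝓝 (f z)) := by
      have := hcont.tendsto
      rwa [indicator_of_mem hz] at this
    exact convolution_tendsto_right (g := fun _ => (Ω ×ˢ Ioo 0 T).indicator f)
      (k := fun _ => z) (Filter.Eventually.of_forall h0) (Filter.Eventually.of_forall h1) hsmall
      (Filter.Eventually.of_forall fun _ => hfi.1) (hct.comp Filter.tendsto_snd)
      tendsto_const_nhds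

/-- The integrand of the duality pairing of `div (χ F)` with `w`. -/
noncomputable def pairing (F : Fin d → E d × ℝ → ℝ) (g w : E d × ℝ → ℝ)
    (y : Fin d → E d × ℝ → ℝ) (χ : E d × ℝ → ℝ) (z : E d × ℝ) : ℝ :=
  (χ z * g z + ∑ k, dx k χ z * F k z) * w z + ∑ k, χ z * F k z * y k z

lemma integrable_pairing (hΩ : IsOpen Ω) (hb : Bornology.IsBounded Ω)
    (hF : ∀ k, IsBddCont Ω T (F k)) (hg : IsBddCont Ω T g)
    (hw : Integrable w (volume.restrict (Ω ×ˢ Ioo 0 T)))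
    (hy : ∀ k, Integrable (y k) (volume.restrict (Ω ×ˢ Ioo 0 T)))
    {χ : E d × ℝ → ℝ} (hχ : ContDiff ℝ ∞ χ) :
    Integrable (pairing F g w y χ) (volume.restrict (Ω ×ˢ Ioo 0 T)) :=
  ((isBddCont_extDiv hb hχ hF hg).integrable_mul hΩ hw).fun_add
    (integrable_finsetSum _ fun k _ =>
      ((isBddCont_of_contDiff hb hχ).mul (hF k)).integrable_mul hΩ (hy k))

/-- Integration by parts for test functions supported near a point with an inward direction. -/
lemma integral_pairing_eq_zero_of_inward (hΩ : IsOpen Ω) (hb : Bornology.IsBounded Ω)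
    (hF : ∀ k, IsBddCont Ω T (F k)) (hg : IsBddCont Ω T g) (hFg : IsZeroFlux Ω T F g)
    (hw : Integrable w (volume.restrict (Ω ×ˢ Ioo 0 T)))
    (hy : ∀ k, Integrable (y k) (volume.restrict (Ω ×ˢ Ioo 0 T)))
    (hwy : IsWeakSpaceGradient Ω T w y) {x₀ e : E d} {r : ℝ} (hr : 0 < r)
    (hin : ∀ x ∈ closure Ω ∩ Metric.closedBall x₀ r, ∀ ε ∈ Ioo 0 r, x + ε • e ∈ Ω)
    {χ : E d × ℝ → ℝ} (hχ : IsTimeTest T χ)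
    (hχs : tsupport χ ⊆ Metric.closedBall x₀ r ×ˢ univ) :
    ∫ z in Ω ×ˢ Ioo 0 T, pairing F g w y χ z = 0 := by
  obtain ⟨a, b, ha, hbT, hab⟩ := hχ.supp
  set S : Set (E d × ℝ) := tsupport χ ∩ closure Ω ×ˢ univ
  have hS : IsCompact S := by
    refine ((isCompact_closedBall x₀ r).prod (isCompact_Icc (a := a) (b := b))).of_isClosed_subset
      ((isClosed_tsupport χ).inter (isClosed_closure.prod isClosed_univ)) fun z hz => ?_
    exact ⟨(hχs hz.1).1, (hab hz.1).2⟩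
  -- With n + 2 in the denominator the shift lies strictly between 0 and r already for n = 0.
  set c : ℕ → E d × ℝ := fun n => ((r / (n + 2)) • e, 0)
  have hc : Filter.Tendsto c Filter.atTop (𝓝 0) := by
    have h1 : Filter.Tendsto (fun n : ℕ => r / ((n : ℝ) + 2)) Filter.atTop (𝓝 0) :=
      tendsto_const_nhds.div_atTop
        (Filter.tendsto_atTop_add_const_right _ _ tendsto_natCast_atTop_atTop)
    have h2 := (h1.smul_const e).prodMk_nhds (tendsto_const_nhds (x := (0 : ℝ)))
    rwa [zero_smul] at h2
  obtain ⟨κ, hκs, hκc, h0, h1, hsmall, hK⟩ := exists_mollifiers (hΩ.prod (isOpen_Ioo (a := (0 : ℝ))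
    (b := T))) hS hc fun n s hs => by
      have ht := (hab hs.1).2
      refine ⟨hin s.1 ⟨hs.2.1, (hχs hs.1).1⟩ _ ⟨by positivity, ?_⟩, ?_⟩
      · rw [div_lt_iff₀ (by positivity)]
        nlinarith [Nat.cast_nonneg (α := ℝ) n]
      · simpa [c] using (⟨ha.trans_le ht.1, ht.2.trans_lt hbT⟩ : s.2 ∈ Ioo 0 T)
  have hχb := isBddCont_of_contDiff (T := T) hb hχ.smooth
  have hGi : ∀ k, Integrable (extField Ω T χ (F k)) := fun k =>
    (hχb.mul (hF k)).integrable_indicator hΩ hb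
  have hdivb := isBddCont_extDiv hb hχ.smooth hF hg
  have hsupp : ∀ k z, z ∉ S → extField Ω T χ (F k) z = 0 := fun k z hz => by
    by_cases hzQ : z ∈ Ω ×ˢ Ioo 0 T
    · have : z ∉ tsupport χ := fun h => hz ⟨h, subset_closure hzQ.1, mem_univ _⟩
      simp [extField, image_eq_zero_of_notMem_tsupport this]
    · simp [extField, indicator_of_notMem hzQ]
  have hzero : ∀ n, (∫ z in Ω ×ˢ Ioo 0 T,
      (κ n ⋆[ContinuousLinearMap.lsmul ℝ ℝ, volume] extDiv Ω T χ F g) z * w z)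
      + ∑ k, ∫ z in Ω ×ˢ Ioo 0 T,
        (κ n ⋆[ContinuousLinearMap.lsmul ℝ ℝ, volume] extField Ω T χ (F k)) z * y k z = 0 := by
    intro n
    obtain ⟨K, hKD, hKc, hKS⟩ := hK n
    -- The shifted kernel moves the support of χF into a compact subset of the open cylinder. The
    -- mollified field may then be tested against the weak gradient.
    have hcs : ∀ k, Function.support
        (κ n ⋆[ContinuousLinearMap.lsmul ℝ ℝ, volume] extField Ω T χ (F k)) ⊆ K := fun k => by
      refine (support_convolution_subset_swap _).trans ?_
      rintro _ ⟨t, ht, s, hs, rfl⟩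
      have h2 : t ∈ S := by
        by_contra h; exact ht (hsupp k t h)
      change t + s ∈ K
      rw [add_comm]
      exact hKS s hs t h2
    have hts := fun k => closure_minimal (hcs k) hKc.isClosed
    have hsm : ∀ k, ContDiff ℝ ∞
        (κ n ⋆[ContinuousLinearMap.lsmul ℝ ℝ, volume] extField Ω T χ (F k)) := fun k =>
      (hκc n).contDiff_convolution_left _ (hκs n) (hGi k).locallyIntegrable
    have hi : ∀ k, Integrable (fun z => dx k
        (κ n ⋆[ContinuousLinearMap.lsmul ℝ ℝ, volume] extField Ω T χ (F k)) z * w z)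
        (volume.restrict (Ω ×ˢ Ioo 0 T)) := fun k =>
      (isBddCont_dx_of_contDiff hb (hsm k) k).integrable_mul hΩ hw
    have e : ∀ z, (κ n ⋆[ContinuousLinearMap.lsmul ℝ ℝ, volume] extDiv Ω T χ F g) z * w z
        = ∑ k, dx k (κ n ⋆[ContinuousLinearMap.lsmul ℝ ℝ, volume] extField Ω T χ (F k)) z * w z :=
      fun z => by
        rw [← sum_dx_convolution hΩ hb hF hg hFg hχ (hκs n) (hκc n), Finset.sum_mul]
    simp only [e]
    rw [integral_finsetSum _ fun k _ => hi k, ← Finset.sum_add_distrib]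
    refine Finset.sum_eq_zero fun k _ => ?_
    rw [hwy _ (hsm k) (hKc.of_isClosed_subset (isClosed_tsupport _) (hts k))
      ((hts k).trans hKD) k]
    ring
  have hlim := (tendsto_integral_convolution hΩ hb hκs hκc h0 h1 hsmall hdivb hw).add
    (tendsto_finsetSum Finset.univ fun k _ => tendsto_integral_convolution hΩ hb hκs hκc h0 h1
      hsmall (hχb.mul (hF k)) (hy k))
  have hz := tendsto_nhds_unique (hlim.congr hzero) tendsto_const_nhds
  have i1 := hdivb.integrable_mul hΩ hw
  have i2 := fun k => (hχb.mul (hF k)).integrable_mul hΩ (hy k)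
  rw [← integral_finsetSum _ fun k _ => i2 k, ← integral_add i1
    (integrable_finsetSum _ fun k _ => i2 k)] at hz
  exact hz

/-- Integration by parts against a zero-flux field on a bounded Lipschitz domain. -/
lemma integral_pairing_eq_zero (hΩ : IsBoundedLipschitzDomain Ω)
    (hF : ∀ k, IsBddCont Ω T (F k)) (hg : IsBddCont Ω T g) (hFg : IsZeroFlux Ω T F g)
    (hw : Integrable w (volume.restrict (Ω ×ˢ Ioo 0 T)))
    (hy : ∀ k, Integrable (y k) (volume.restrict (Ω ×ˢ Ioo 0 T)))
    (hwy : IsWeakSpaceGradient Ω T w y) {χ : E d × ℝ → ℝ} (hχ : IsTimeTest T χ) :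
    ∫ z in Ω ×ˢ Ioo 0 T, pairing F g w y χ z = 0 := by
  have hm : MeasurableSet (Ω ×ˢ Ioo 0 T) := hΩ.isOpen.measurableSet.prod measurableSet_Ioo
  have hdir : ∀ x : E d, ∃ (e : E d) (r : ℝ), 0 < r ∧ (x ∈ closure Ω →
      ∀ y ∈ closure Ω ∩ Metric.closedBall x r, ∀ ε ∈ Ioo 0 r, y + ε • e ∈ Ω) := fun x => by
    by_cases hx : x ∈ closure Ω
    · obtain ⟨e, r, hr, h⟩ := hΩ.exists_inward hx
      exact ⟨e, r, hr, fun _ => h⟩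
    · exact ⟨0, 1, one_pos, fun h => absurd h hx⟩
  choose e r hr hin using hdir
  let f : ∀ x : E d, ContDiffBump x := fun x => ⟨r x / 2, r x, half_pos (hr x), half_lt_self (hr x)⟩
  have hfs : ∀ x, ContDiff ℝ ∞ (fun z : E d × ℝ => f x z.1) := fun x =>
    (f x).contDiff.comp contDiff_fst
  have hint := fun {χ : E d × ℝ → ℝ} (hχ : ContDiff ℝ ∞ χ) =>
    integrable_pairing hΩ.isOpen hΩ.isBounded hF hg hw hy hχ
  -- The pairing is linear in χ, and the part χ f_x supported near x contributes nothing.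
  -- Multiplying χ by 1 - f_x therefore leaves the integral unchanged, which replaces a partition of
  -- unity.
  have hstep : ∀ x ∈ closure Ω, ∀ {χ : E d × ℝ → ℝ}, IsTimeTest T χ →
      ∫ z in Ω ×ˢ Ioo 0 T, pairing F g w y (fun z => χ z * (1 - f x z.1)) z
        = ∫ z in Ω ×ˢ Ioo 0 T, pairing F g w y χ z := by
    intro x hx χ hχ
    have hloc := integral_pairing_eq_zero_of_inward hΩ.isOpen hΩ.isBounded hF hg hFg hw hy hwy
      (hr x) (hin x hx) (hχ.mul_smooth (hfs x)) (by
        refine tsupport_mul_subset_right.trans (closure_minimal (fun z hz => ⟨?_, mem_univ _⟩)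
          (Metric.isClosed_closedBall.prod isClosed_univ))
        have : z.1 ∈ Function.support (f x) := hz
        rw [(f x).support_eq] at this
        exact Metric.ball_subset_closedBall this)
    have hsplit : ∀ z, pairing F g w y (fun z => χ z * (1 - f x z.1)) z
        = pairing F g w y χ z - pairing F g w y (fun z => χ z * f x z.1) z := fun z => by
      have e1 : (fun z : E d × ℝ => χ z * (1 - f x z.1)) = fun z => χ z - χ z * f x z.1 := by
        funext z; ring
      have e2 : ∀ k, dx k (fun z => χ z - χ z * f x z.1) z
          = dx k χ z - dx k (fun z => χ z * f x z.1) z := fun k =>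
        dx_sub (hχ.smooth.differentiable (by simp) z)
          ((hχ.smooth.mul (hfs x)).differentiable (by simp) z) k
      rw [e1]
      simp only [pairing, e2, sub_mul, add_mul, Finset.sum_sub_distrib]
      ring
    simp only [hsplit]
    rw [integral_sub (hint hχ.smooth) (hint (hχ.mul_smooth (hfs x)).smooth), hloc, sub_zero]
  have hprod : ∀ s : Finset (E d), (∀ x ∈ s, x ∈ closure Ω) → ∀ {χ : E d × ℝ → ℝ},
      IsTimeTest T χ → ∫ z in Ω ×ˢ Ioo 0 T, pairing F g w y
        (fun z => χ z * ∏ x ∈ s, (1 - f x z.1)) z = ∫ z in Ω ×ˢ Ioo 0 T, pairing F g w y χ z := by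
    classical
    intro s
    induction s using Finset.induction_on with
    | empty => intro _ χ _; simp
    | insert a s ha ih =>
      intro hs χ hχ
      have e1 : (fun z : E d × ℝ => χ z * ∏ x ∈ insert a s, (1 - f x z.1))
          = fun z => (χ z * (1 - f a z.1)) * ∏ x ∈ s, (1 - f x z.1) := by
        funext z
        rw [Finset.prod_insert ha, mul_assoc]
      rw [e1, ih (fun x hx => hs x (Finset.mem_insert_of_mem hx))
        (hχ.mul_smooth (contDiff_const.sub (hfs a))), hstep a (hs a (Finset.mem_insert_self _ _)) hχ]
  obtain ⟨s, hs, hcov⟩ := hΩ.isBounded.isCompact_closure.elim_nhds_subcover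
    (fun x => Metric.closedBall x (r x / 2))
    (fun x _ => Metric.closedBall_mem_nhds x (half_pos (hr x)))
  -- After finitely many such factors the cut-off vanishes throughout the cylinder, because every
  -- point lies in a ball where some f_x equals 1.
  rw [← hprod s hs hχ]
  have hz : ∀ z ∈ Ω ×ˢ Ioo 0 T, χ z * ∏ x ∈ s, (1 - f x z.1) = 0 := fun z hz => by
    obtain ⟨x, hxs, hx⟩ := mem_iUnion₂.1 (hcov (subset_closure hz.1))
    rw [Finset.prod_eq_zero hxs, mul_zero]
    rw [(f x).one_of_mem_closedBall hx, sub_self]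
  rw [setIntegral_congr_fun hm (g := fun _ => (0 : ℝ)), integral_zero]
  intro z hzQ
  have hev : (fun z => χ z * ∏ x ∈ s, (1 - f x z.1)) =ᶠ[𝓝 z] fun _ => 0 :=
    Filter.mem_of_superset ((hΩ.isOpen.prod isOpen_Ioo).mem_nhds hzQ) hz
  have hd : ∀ k, dx k (fun z => χ z * ∏ x ∈ s, (1 - f x z.1)) z = 0 := fun k => by
    rw [dx, hev.fderiv_eq]; simp
  simp [pairing, hd, hz z hzQ]

/-- Integration by parts on almost every time slice, integrated over `Ω × (0,t)`. -/
lemma integral_zeroFlux_cylinder (hΩ : IsBoundedLipschitzDomain Ω)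
    (hF : ∀ k, IsBddCont Ω T (F k)) (hg : IsBddCont Ω T g) (hFg : IsZeroFlux Ω T F g)
    (hw : Integrable w (volume.restrict (Ω ×ˢ Ioo 0 T)))
    (hy : ∀ k, Integrable (y k) (volume.restrict (Ω ×ˢ Ioo 0 T)))
    (hwy : IsWeakSpaceGradient Ω T w y) {t : ℝ} (ht : t ≤ T) :
    ∫ z in Ω ×ˢ Ioo 0 t, (g z * w z + ∑ k, F k z * y k z) = 0 := by
  have hm : MeasurableSet (Ω ×ˢ Ioo 0 T) := hΩ.isOpen.measurableSet.prod measurableSet_Ioo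
  have hP : Integrable (fun z => g z * w z + ∑ k, F k z * y k z)
      (volume.restrict (Ω ×ˢ Ioo 0 T)) :=
    (hg.integrable_mul hΩ.isOpen hw).fun_add
      (integrable_finsetSum _ fun k _ => (hF k).integrable_mul hΩ.isOpen (hy k))
  set J : ℝ → ℝ := fun t => ∫ x in Ω, (g (x, t) * w (x, t) + ∑ k, F k (x, t) * y k (x, t))
  have hJ : IntegrableOn J (Ioo 0 T) := by
    have := hP
    rw [restrict_cylinder] at this
    exact this.integral_prod_right
  have key := IsOpen.ae_eq_zero_of_integral_contDiff_smul_eq_zero (μ := volume)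
    (isOpen_Ioo (a := (0 : ℝ)) (b := T)) (f := J) hJ.locallyIntegrableOn ?_
  · have hPt := hP.mono_measure (cylinder_mono (Ω := Ω) ht)
    rw [restrict_cylinder] at hPt ⊢
    rw [integral_prod_symm _ hPt]
    have : ∀ᵐ s ∂(volume.restrict (Ioo 0 t)), J s = 0 := by
      rw [ae_restrict_iff' measurableSet_Ioo]
      filter_upwards [key] with s hs hst
      exact hs ⟨hst.1, hst.2.trans_le ht⟩
    exact integral_eq_zero_of_ae this
  intro θ hθ hθc hθs
  have hθ0 : ∀ t, t ∉ Ioo 0 T → θ t = 0 := fun t ht =>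
    image_eq_zero_of_notMem_tsupport fun h => ht (hθs h)
  have htest : IsTimeTest (d := d) T (fun z => θ z.2) := by
    refine ⟨hθ.comp contDiff_snd, ?_⟩
    have hsub : tsupport (fun z : E d × ℝ => θ z.2) ⊆ univ ×ˢ tsupport θ :=
      closure_minimal (fun z hz => ⟨mem_univ _, subset_tsupport _ hz⟩)
        (isClosed_univ.prod (isClosed_tsupport _))
    rcases (tsupport θ).eq_empty_or_nonempty with he | hne
    · refine ⟨1, T - 1, one_pos, by linarith, hsub.trans ?_⟩
      simp [he]
    · obtain ⟨a, ha, hmin⟩ := hθc.isCompact.exists_isLeast hne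
      obtain ⟨b, hb, hmax⟩ := hθc.isCompact.exists_isGreatest hne
      exact ⟨a, b, (hθs ha).1, (hθs hb).2, hsub.trans
        (prod_mono le_rfl fun t ht => ⟨hmin ht, hmax ht⟩)⟩
  -- A cut-off depending only on time has no spatial derivative, so the pairing reduces to θ times
  -- the desired integrand. Arbitrariness of θ gives the identity on almost every slice.
  have h := integral_pairing_eq_zero hΩ hF hg hFg hw hy hwy htest
  have hdx : ∀ k (z : E d × ℝ), dx k (fun z : E d × ℝ => θ z.2) z = 0 := fun k z => by
    have h1 := ((hθ.differentiable (by simp) z.2).hasFDerivAt.comp z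
      (hasFDerivAt_snd (𝕜 := ℝ) (E := E d) (F := ℝ))).fderiv
    change fderiv ℝ (θ ∘ Prod.snd) z _ = 0
    rw [h1]; simp
  have e : ∀ z : E d × ℝ, pairing F g w y (fun z => θ z.2) z
      = θ z.2 * (g z * w z + ∑ k, F k z * y k z) := fun z => by
    simp only [pairing, hdx, zero_mul, Finset.sum_const_zero, add_zero, mul_add, Finset.mul_sum,
      mul_assoc]
  simp only [e] at h
  have hθP := (isBddCont_of_contDiff (T := T) hΩ.isBounded htest.smooth).integrable_mul
    hΩ.isOpen hP
  rw [restrict_cylinder] at h hθP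
  rw [integral_prod_symm _ hθP] at h
  simp only [integral_const_mul] at h
  rw [← setIntegral_eq_integral_of_forall_compl_eq_zero (s := Ioo 0 T) fun t ht => by
      rw [hθ0 t ht, zero_smul]]
  exact h

end Mollification

end ZeroFlux


/-! ### Gronwall's inequality for integrable functions -/

/-- The primitive G of f need not be differentiable everywhere, so one more integration is made: K =
C ∫ G is C¹, G ≤ K, hence K' = C G ≤ C K with K(0) = 0. Gronwall forces K = 0, thus G = 0 and f = 0.
-/
lemma ae_eq_zero_of_le_mul_integral {T C : ℝ} (hT : 0 < T) (hC : 0 ≤ C) {f : ℝ → ℝ}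
    (hf : IntegrableOn f (Ioo 0 T)) (h0 : ∀ᵐ t ∂(volume.restrict (Ioo 0 T)), 0 ≤ f t)
    (h : ∀ᵐ t ∂(volume.restrict (Ioo 0 T)), f t ≤ C * ∫ τ in Ioo 0 t, f τ) :
    ∀ᵐ t ∂(volume.restrict (Ioo 0 T)), f t = 0 := by
  set f₀ : ℝ → ℝ := (Ioo 0 T).indicator f
  have hf₀ : Integrable f₀ := (integrable_indicator_iff measurableSet_Ioo).2 hf
  have hf₀n : ∀ᵐ t, 0 ≤ f₀ t := by
    filter_upwards [(ae_restrict_iff' measurableSet_Ioo).1 h0] with t ht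
    by_cases hm : t ∈ Ioo 0 T
    · simpa only [f₀, indicator_of_mem hm] using ht hm
    · simp only [f₀, indicator_of_notMem hm, le_refl]
  set G : ℝ → ℝ := fun t => ∫ τ in (0 : ℝ)..t, f₀ τ
  have hG : Continuous G := intervalIntegral.continuous_primitive (fun a b => hf₀.intervalIntegrable) 0
  have hG0 : ∀ t, 0 ≤ t → 0 ≤ G t := fun t ht =>
    intervalIntegral.integral_nonneg_of_ae ht hf₀n
  have hGeq : ∀ t ∈ Ioc 0 T, G t = ∫ τ in Ioo 0 t, f τ := fun t ht => by
    simp only [G]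
    rw [intervalIntegral.integral_of_le ht.1.le, integral_Ioc_eq_integral_Ioo]
    refine setIntegral_congr_fun measurableSet_Ioo fun τ hτ => ?_
    have hm : τ ∈ Ioo 0 T := ⟨hτ.1, hτ.2.trans_le ht.2⟩
    exact indicator_of_mem hm f
  set K : ℝ → ℝ := fun t => ∫ τ in (0 : ℝ)..t, C * G τ
  have hKd : ∀ t, HasDerivAt K (C * G t) t := fun t =>
    intervalIntegral.integral_hasDerivAt_right ((hG.const_mul C).intervalIntegrable _ _)
      ((hG.const_mul C).stronglyMeasurableAtFilter _ _) (hG.const_mul C).continuousAt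
  have hGK : ∀ t ∈ Icc 0 T, G t ≤ K t := fun t ht => by
    refine intervalIntegral.integral_mono_ae_restrict ht.1 hf₀.intervalIntegrable
      ((hG.const_mul C).intervalIntegrable _ _) ?_
    rw [Filter.EventuallyLE, ae_restrict_iff' measurableSet_Icc]
    filter_upwards [(ae_restrict_iff' measurableSet_Ioo).1 h] with τ hτ hm
    by_cases hτT : τ ∈ Ioo 0 T
    · simp only [f₀]
      rw [indicator_of_mem hτT, hGeq τ ⟨hτT.1, hτT.2.le⟩]
      exact hτ hτT
    · simp only [f₀]
      rw [indicator_of_notMem hτT]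
      exact mul_nonneg hC (hG0 τ hm.1)
  have hK0 := norm_le_gronwallBound_of_norm_deriv_right_le (f := K) (f' := fun t => C * G t)
    (δ := 0) (K := C) (ε := 0) (a := 0) (b := T)
    (fun t _ => (hKd t).continuousAt.continuousWithinAt)
    (fun t _ => (hKd t).hasDerivWithinAt) (by simp [K]) (fun t ht => by
      have h1 := hG0 t ht.1
      have h2 := hGK t ⟨ht.1, ht.2.le⟩
      rw [Real.norm_of_nonneg (mul_nonneg hC h1), Real.norm_of_nonneg (h1.trans h2), add_zero]
      exact mul_le_mul_of_nonneg_left h2 hC) T ⟨hT.le, le_rfl⟩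
  rw [gronwallBound_ε0_δ0, norm_le_zero_iff] at hK0
  have hGT : ∫ τ in Ioo 0 T, f τ = 0 := by
    rw [← hGeq T ⟨hT, le_rfl⟩]
    exact le_antisymm ((hGK T ⟨hT.le, le_rfl⟩).trans hK0.le) (hG0 T hT.le)
  exact (integral_eq_zero_iff_of_nonneg_ae h0 hf).1 hGT

/-! ### The fundamental theorem of calculus in time -/

section

variable {d : ℕ} {Ω : Set (E d)} {T : ℝ} {f g : E d × ℝ → ℝ}

lemma integral_dt_cylinder (hΩ : IsOpen Ω) (hb : Bornology.IsBounded Ω)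
    (hf : ContDiffOn ℝ 1 f (closure Ω ×ˢ Icc 0 T)) {t : ℝ} (ht : t ∈ Icc 0 T) :
    ∫ z in Ω ×ˢ Ioo 0 t, dt f z = (∫ x in Ω, f (x, t)) - ∫ x in Ω, f (x, 0) := by
  have h0 : (0 : ℝ) ∈ Icc 0 T := ⟨le_rfl, ht.1.trans ht.2⟩
  have hdt := isBddCont_dt hΩ hb hf
  have hi := (hdt.integrable hΩ hb).mono_measure (cylinder_mono (Ω := Ω) ht.2)
  rw [restrict_cylinder] at hi ⊢
  rw [integral_prod _ hi, ← integral_sub (integrable_slice_of_continuousOn hb hf.continuousOn ht)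
    (integrable_slice_of_continuousOn hb hf.continuousOn h0)]
  refine setIntegral_congr_fun hΩ.measurableSet fun x hx => ?_
  change ∫ s in Ioo 0 t, dt f (x, s) = _
  have hmaps : MapsTo (fun s : ℝ => ((x, s) : E d × ℝ)) (Icc 0 t) (closure Ω ×ˢ Icc 0 T) :=
    fun s hs => ⟨subset_closure hx, hs.1, hs.2.trans ht.2⟩
  rw [← integral_Ioc_eq_integral_Ioo, ← intervalIntegral.integral_of_le ht.1]
  refine intervalIntegral.integral_eq_sub_of_hasDerivAt_of_le ht.1
    (hf.continuousOn.comp (by fun_prop) hmaps) (fun s hs => ?_) ?_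
  · have hd := (differentiableAt_of_mem_cylinder hΩ hf
      (⟨hx, hs.1, hs.2.trans_le ht.2⟩ : (x, s) ∈ Ω ×ˢ Ioo 0 T)).hasFDerivAt
    exact hd.comp_hasDerivAt s ((hasDerivAt_const s x).prodMk (hasDerivAt_id s))
  · rw [intervalIntegrable_iff_integrableOn_Ioo_of_le ht.1]
    obtain ⟨C, _, hC⟩ := hdt.bdd
    have hmaps' : MapsTo (fun s : ℝ => ((x, s) : E d × ℝ)) (Ioo 0 t) (Ω ×ˢ Ioo 0 T) :=
      fun s hs => ⟨hx, hs.1, hs.2.trans_le ht.2⟩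
    refine Integrable.of_bound
      ((hdt.cont.comp (by fun_prop) hmaps').aestronglyMeasurable measurableSet_Ioo) C ?_
    filter_upwards [ae_restrict_mem measurableSet_Ioo] with s hs
    exact hC _ (hmaps' hs)

lemma fderiv_mul_apply {z : E d × ℝ} (hf : DifferentiableAt ℝ f z)
    (hg : DifferentiableAt ℝ g z) (e : E d × ℝ) :
    fderiv ℝ (fun z => f z * g z) z e = f z * fderiv ℝ g z e + fderiv ℝ f z e * g z := by
  have h := (hf.hasFDerivAt.mul hg.hasFDerivAt).fderiv
  rw [show (fun z => f z * g z) = f * g from rfl, h]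
  simp [mul_comm]

/-- Integration by parts in time. -/
lemma integral_mul_dt (hΩ : IsOpen Ω) (hb : Bornology.IsBounded Ω) (hT : 0 < T)
    (hf : ContDiffOn ℝ 1 f (closure Ω ×ˢ Icc 0 T)) (hg : ContDiffOn ℝ 1 g (closure Ω ×ˢ Icc 0 T))
    (h0 : ∀ x, g (x, 0) = 0) (h1 : ∀ x, g (x, T) = 0) :
    ∫ z in Ω ×ˢ Ioo 0 T, f z * dt g z = -∫ z in Ω ×ˢ Ioo 0 T, g z * dt f z := by
  have h := integral_dt_cylinder hΩ hb (hf.mul hg) (t := T) ⟨hT.le, le_rfl⟩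
  have e : ∫ z in Ω ×ˢ Ioo 0 T, dt (f * g) z
      = ∫ z in Ω ×ˢ Ioo 0 T, (f z * dt g z + g z * dt f z) := by
    refine setIntegral_congr_fun (hΩ.measurableSet.prod measurableSet_Ioo) fun z hz => ?_
    simp only [dt]
    rw [show f * g = fun z => f z * g z from rfl,
      fderiv_mul_apply (differentiableAt_of_mem_cylinder hΩ hf hz)
      (differentiableAt_of_mem_cylinder hΩ hg hz)]
    ring
  have hfb := isBddCont_of_continuousOn hb hf.continuousOn
  have hgb := isBddCont_of_continuousOn hb hg.continuousOn
  rw [show (fun z => f z * g z) = f * g from rfl, e,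
    integral_add ((hfb.mul (isBddCont_dt hΩ hb hg)).integrable hΩ hb)
    ((hgb.mul (isBddCont_dt hΩ hb hf)).integrable hΩ hb)] at h
  simp only [h0, h1, mul_zero, integral_zero, sub_self] at h
  linarith

end

/-! ### The strong solution -/

section StrongSolution

variable {n d : ℕ} {B : Matrix (Fin n) (Fin n) ℝ} {Ω : Set (E d)} {T : ℝ}
  {uin : E d → Fin n → ℝ≥0} {v : E d × ℝ → Fin n → ℝ≥0}

/-- The components of `v` as real functions. -/
noncomputable def comp (v : E d × ℝ → Fin n → ℝ≥0) (i : Fin n) (z : E d × ℝ) : ℝ := (v z i : ℝ)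

/-- The potential `(B v)_i`. -/
noncomputable def pot (B : Matrix (Fin n) (Fin n) ℝ) (v : E d × ℝ → Fin n → ℝ≥0) (i : Fin n)
    (z : E d × ℝ) : ℝ := mulB B (vec (v z)) i

/-- The logarithm `log v_i`. -/
noncomputable def logComp (v : E d × ℝ → Fin n → ℝ≥0) (i : Fin n) (z : E d × ℝ) : ℝ :=
  Real.log (comp v i z)

/-- The partial derivative `∂_k v` as a vector. -/
noncomputable def gradVec (v : E d × ℝ → Fin n → ℝ≥0) (k : Fin d) (z : E d × ℝ) : E n :=
  WithLp.toLp 2 fun i => dx k (comp v i) z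

/-- The time derivative `∂_t v` as a vector. -/
noncomputable def dtVec (v : E d × ℝ → Fin n → ℝ≥0) (z : E d × ℝ) : E n :=
  WithLp.toLp 2 fun i => dt (comp v i) z

/-- The Laplacian of the potential, `(∂_t v_i - ∇ v_i · ∇ (B v)_i) / v_i`. -/
noncomputable def lapPot (B : Matrix (Fin n) (Fin n) ℝ) (v : E d × ℝ → Fin n → ℝ≥0)
    (i : Fin n) (z : E d × ℝ) : ℝ :=
  dt (logComp v i) z - ∑ k, dx k (logComp v i) z * dx k (pot B v i) z

lemma pot_eq (i : Fin n) : pot B v i = fun z => ∑ j, B i j * comp v j z := rfl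

/-! ### Weak divergence and flux identities for v -/

namespace IsPositiveC1Solution

lemma contDiffOn_comp (hv : IsPositiveC1Solution B Ω T uin v) (i : Fin n) :
    ContDiffOn ℝ 1 (comp v i) (closure Ω ×ˢ Icc 0 T) := hv.contDiffOn i

lemma contDiffOn_pot (hv : IsPositiveC1Solution B Ω T uin v) (i : Fin n) :
    ContDiffOn ℝ 1 (pot B v i) (closure Ω ×ˢ Icc 0 T) := by
  rw [pot_eq]
  exact ContDiffOn.sum fun j _ => contDiffOn_const.mul (hv.contDiffOn_comp j)

lemma comp_pos (hv : IsPositiveC1Solution B Ω T uin v) {z : E d × ℝ}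
    (hz : z ∈ closure Ω ×ˢ Icc 0 T) (i : Fin n) : 0 < comp v i z :=
  NNReal.coe_pos.2 (hv.pos z hz i)

lemma contDiffOn_logComp (hv : IsPositiveC1Solution B Ω T uin v) (i : Fin n) :
    ContDiffOn ℝ 1 (logComp v i) (closure Ω ×ˢ Icc 0 T) :=
  (hv.contDiffOn_comp i).log fun _ hz => (hv.comp_pos hz i).ne'

lemma fderiv_pot (hv : IsPositiveC1Solution B Ω T uin v) (hΩ : IsOpen Ω) {z : E d × ℝ}
    (hz : z ∈ Ω ×ˢ Ioo 0 T) (i : Fin n) (e : E d × ℝ) :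
    fderiv ℝ (pot B v i) z e = ∑ j, B i j * fderiv ℝ (comp v j) z e := by
  have h : HasFDerivAt (fun z => ∑ j, B i j * comp v j z)
      (∑ j, B i j • fderiv ℝ (comp v j) z) z :=
    HasFDerivAt.fun_sum fun j _ => (differentiableAt_of_mem_cylinder hΩ (hv.contDiffOn_comp j)
      hz).hasFDerivAt.const_mul (B i j)
  rw [pot_eq, h.fderiv]
  simp

lemma dx_pot (hv : IsPositiveC1Solution B Ω T uin v) (hΩ : IsOpen Ω) {z : E d × ℝ}
    (hz : z ∈ Ω ×ˢ Ioo 0 T) (i : Fin n) (k : Fin d) :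
    dx k (pot B v i) z = mulB B (gradVec v k z) i :=
  hv.fderiv_pot hΩ hz i _

lemma dt_pot (hv : IsPositiveC1Solution B Ω T uin v) (hΩ : IsOpen Ω) {z : E d × ℝ}
    (hz : z ∈ Ω ×ˢ Ioo 0 T) (i : Fin n) :
    dt (pot B v i) z = mulB B (dtVec v z) i :=
  hv.fderiv_pot hΩ hz i _

lemma fderiv_logComp (hv : IsPositiveC1Solution B Ω T uin v) (hΩ : IsOpen Ω) {z : E d × ℝ}
    (hz : z ∈ Ω ×ˢ Ioo 0 T) (i : Fin n) (e : E d × ℝ) :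
    fderiv ℝ (logComp v i) z e = fderiv ℝ (comp v i) z e / comp v i z := by
  have h := ((differentiableAt_of_mem_cylinder hΩ (hv.contDiffOn_comp i) hz).hasFDerivAt.log
    (hv.comp_pos (cylinder_subset Ω T hz) i).ne').fderiv
  change fderiv ℝ (fun z => Real.log (comp v i z)) z e = _
  rw [h]
  simp [div_eq_inv_mul]

lemma gradHat_eq (hv : IsPositiveC1Solution B Ω T uin v) (hΩ : IsOpen Ω) {z : E d × ℝ}
    (hz : z ∈ Ω ×ˢ Ioo 0 T) : gradHat B v z = fun k => hat B (gradVec v k z) := by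
  funext k
  have h1 : ∀ i, HasFDerivAt (fun z' => (vec (v z') : E n) i) (fderiv ℝ (comp v i) z) z := fun i =>
    (differentiableAt_of_mem_cylinder hΩ (hv.contDiffOn_comp i) hz).hasFDerivAt
  have h2 : HasFDerivAt (fun z' => vec (v z')) (fderiv ℝ (fun z' => vec (v z')) z) z := by
    refine DifferentiableAt.hasFDerivAt ?_
    rw [differentiableAt_euclidean]
    exact fun i => (h1 i).differentiableAt
  have h3 := ((perpB B).orthogonalProjectionOnto.hasFDerivAt.comp z h2).fderiv
  rw [gradHat, dx]
  change fderiv ℝ ((perpB B).orthogonalProjectionOnto ∘ fun z' => vec (v z')) z _ = _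
  rw [h3, hat]
  change (perpB B).orthogonalProjectionOnto _ = _
  congr 1
  ext i
  have h4 := ((EuclideanSpace.proj i : E n →L[ℝ] ℝ).hasFDerivAt.comp z h2).unique (h1 i)
  have h5 := congrArg (fun L : (E d × ℝ) →L[ℝ] ℝ => L (EuclideanSpace.single k 1, 0)) h4
  simpa [gradVec, dx] using h5

/-- The flux of the strong solution has zero normal trace and divergence `∂_t v_i`. -/
lemma integral_flux (hv : IsPositiveC1Solution B Ω T uin v) (hΩ : IsOpen Ω)
    (hb : Bornology.IsBounded Ω) (hT : 0 < T) (i : Fin n) {φ : E d × ℝ → ℝ}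
    (hφ : ContDiffOn ℝ 1 φ (closure Ω ×ˢ Icc 0 T))
    (h0 : ∀ x, φ (x, 0) = 0) (h1 : ∃ b < T, ∀ z, b ≤ z.2 → φ z = 0) :
    ∫ z in Ω ×ˢ Ioo 0 T, ∑ k, dx k φ z * (comp v i z * dx k (pot B v i) z)
      = -∫ z in Ω ×ˢ Ioo 0 T, φ z * dt (comp v i) z := by
  have hw := hv.weak i φ (isTest_of_contDiffOn hb hφ h1)
  simp only [h0, mul_zero, integral_zero, add_zero] at hw
  obtain ⟨b, hbT, hz⟩ := h1
  rw [← integral_mul_dt hΩ hb hT (hv.contDiffOn_comp i) hφ h0 fun x => hz _ hbT.le]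
  refine Eq.trans ?_ hw.symm
  refine integral_congr_ae (Filter.Eventually.of_forall fun z => ?_)
  exact Finset.sum_congr rfl fun k _ => mul_comm _ _

lemma _root_.SegCD.IsTimeTest.vanish {φ : E d × ℝ → ℝ} (hφ : IsTimeTest T φ) :
    (∀ x, φ (x, 0) = 0) ∧ ∃ b < T, ∀ z, b ≤ z.2 → φ z = 0 := by
  obtain ⟨a, b, ha, hb, hs⟩ := hφ.supp
  refine ⟨fun x => image_eq_zero_of_notMem_tsupport fun h => ?_, (b + T) / 2, by linarith,
    fun z hz => image_eq_zero_of_notMem_tsupport fun h => ?_⟩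
  · exact absurd (hs h).2.1 (not_le.2 ha)
  · have := (hs h).2.2
    linarith

lemma isZeroFlux_flux (hv : IsPositiveC1Solution B Ω T uin v) (hΩ : IsOpen Ω)
    (hb : Bornology.IsBounded Ω) (hT : 0 < T) (i : Fin n) :
    IsZeroFlux Ω T (fun k z => comp v i z * dx k (pot B v i) z) (dt (comp v i)) := fun φ hφ =>
  hv.integral_flux hΩ hb hT i (hφ.smooth.of_le (by simp)).contDiffOn hφ.vanish.1 hφ.vanish.2

/-- Positivity of v and the C¹ class of the test functions allow φ/vᵢ in the weak equation. The
factor vᵢ of the flux cancels, and the derivative of 1/vᵢ produces the term ∇ log vᵢ · ∇(Bv)ᵢ in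
`lapPot`. No second derivative of v is needed. -/
lemma isZeroFlux_pot (hv : IsPositiveC1Solution B Ω T uin v) (hΩ : IsOpen Ω)
    (hb : Bornology.IsBounded Ω) (hT : 0 < T) (i : Fin n) :
    IsZeroFlux Ω T (fun k => dx k (pot B v i)) (lapPot B v i) := by
  intro φ hφ
  have hm : MeasurableSet (Ω ×ˢ Ioo 0 T) := hΩ.measurableSet.prod measurableSet_Ioo
  have hφ1 : ContDiffOn ℝ 1 φ (closure Ω ×ˢ Icc 0 T) := (hφ.smooth.of_le (by simp)).contDiffOn
  have hinv : ContDiffOn ℝ 1 (fun z => (comp v i z)⁻¹) (closure Ω ×ˢ Icc 0 T) :=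
    (hv.contDiffOn_comp i).inv fun z hz => (hv.comp_pos hz i).ne'
  obtain ⟨b, hbT, hbz⟩ := hφ.vanish.2
  have h := hv.integral_flux hΩ hb hT i (φ := fun z => φ z * (comp v i z)⁻¹) (hφ1.mul hinv)
    (fun x => by rw [hφ.vanish.1, zero_mul]) ⟨b, hbT, fun z hz => by rw [hbz z hz, zero_mul]⟩
  have e1 : ∫ z in Ω ×ˢ Ioo 0 T, ∑ k, dx k (fun z => φ z * (comp v i z)⁻¹) z
        * (comp v i z * dx k (pot B v i) z)
      = ∫ z in Ω ×ˢ Ioo 0 T, (∑ k, dx k φ z * dx k (pot B v i) z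
        - φ z * ∑ k, dx k (logComp v i) z * dx k (pot B v i) z) := by
    refine setIntegral_congr_fun hm fun z hz => ?_
    have hpos := hv.comp_pos (cylinder_subset Ω T hz) i
    have hd := differentiableAt_of_mem_cylinder hΩ (hv.contDiffOn_comp i) hz
    have hdi : HasFDerivAt (fun z => (comp v i z)⁻¹)
        (-(comp v i z ^ 2)⁻¹ • fderiv ℝ (comp v i) z) z :=
      (hasDerivAt_inv hpos.ne').comp_hasFDerivAt z hd.hasFDerivAt
    rw [Finset.mul_sum, ← Finset.sum_sub_distrib]
    refine Finset.sum_congr rfl fun k _ => ?_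
    simp only [dx]
    rw [fderiv_mul_apply (hφ.smooth.differentiable (by simp) z) hdi.differentiableAt,
      hdi.fderiv, hv.fderiv_logComp hΩ hz]
    simp only [_root_.smul_apply, smul_eq_mul]
    field_simp
    ring
  have e2 : ∫ z in Ω ×ˢ Ioo 0 T, φ z * (comp v i z)⁻¹ * dt (comp v i) z
      = ∫ z in Ω ×ˢ Ioo 0 T, φ z * dt (logComp v i) z := by
    refine setIntegral_congr_fun hm fun z hz => ?_
    simp only [dt]
    rw [hv.fderiv_logComp hΩ hz, div_eq_inv_mul]
    ring
  have hφb := isBddCont_of_contDiff (T := T) hb hφ.smooth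
  have hpb := fun k => isBddCont_dx hΩ hb (hv.contDiffOn_pot i) k
  have hlb := fun k => isBddCont_dx hΩ hb (hv.contDiffOn_logComp i) k
  have i1 : IsBddCont Ω T (fun z => ∑ k, dx k φ z * dx k (pot B v i) z) :=
    IsBddCont.sum fun k _ => (isBddCont_dx hΩ hb hφ1 k).mul (hpb k)
  have i2 : IsBddCont Ω T (fun z => φ z * ∑ k, dx k (logComp v i) z * dx k (pot B v i) z) :=
    hφb.mul (IsBddCont.sum fun k _ => (hlb k).mul (hpb k))
  have i3 : IsBddCont Ω T (fun z => φ z * dt (logComp v i) z) :=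
    hφb.mul (isBddCont_dt hΩ hb (hv.contDiffOn_logComp i))
  rw [e1, e2, integral_sub (i1.integrable hΩ hb) (i2.integrable hΩ hb)] at h
  simp only [lapPot, mul_sub]
  rw [integral_sub (i3.integrable hΩ hb) (i2.integrable hΩ hb)]
  linarith

lemma isBddCont_lapPot (hv : IsPositiveC1Solution B Ω T uin v) (hΩ : IsOpen Ω)
    (hb : Bornology.IsBounded Ω) (i : Fin n) : IsBddCont Ω T (lapPot B v i) :=
  (isBddCont_dt hΩ hb (hv.contDiffOn_logComp i)).sub (IsBddCont.sum fun k _ =>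
    (isBddCont_dx hΩ hb (hv.contDiffOn_logComp i) k).mul
      (isBddCont_dx hΩ hb (hv.contDiffOn_pot i) k))

/-- The Laplacian of the potential is orthogonal to the kernel of `B`. -/
lemma sum_mul_lapPot_eq_zero (hv : IsPositiveC1Solution B Ω T uin v) (hB : B.IsHermitian)
    (hΩ : IsOpen Ω) (hb : Bornology.IsBounded Ω) (hT : 0 < T) {ξ : E n} (hξ : ξ ∈ kerB B) :
    ∀ᵐ z ∂(volume.restrict (Ω ×ˢ Ioo 0 T)), ∑ i, ξ i * lapPot B v i z = 0 := by
  have hm : MeasurableSet (Ω ×ˢ Ioo 0 T) := hΩ.measurableSet.prod measurableSet_Ioo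
  have hbc : IsBddCont Ω T (fun z => ∑ i, ξ i * lapPot B v i z) :=
    IsBddCont.sum fun i _ => (IsBddCont.const (ξ i)).mul (hv.isBddCont_lapPot hΩ hb i)
  rw [ae_restrict_iff' hm]
  refine IsOpen.ae_eq_zero_of_integral_contDiff_smul_eq_zero (hΩ.prod isOpen_Ioo)
    (IntegrableOn.locallyIntegrableOn (hbc.integrable hΩ hb)) fun φ hφ hφc hφs => ?_
  have htest : IsTimeTest T φ := by
    refine ⟨hφ, ?_⟩
    rcases (tsupport φ).eq_empty_or_nonempty with he | hne
    · exact ⟨1, T - 1, one_pos, by linarith, by simp [he]⟩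
    · have hc := hφc.isCompact.image continuous_snd
      obtain ⟨a, ⟨za, hza, rfl⟩, hmin⟩ := hc.exists_isLeast (hne.image _)
      obtain ⟨b, ⟨zb, hzb, rfl⟩, hmax⟩ := hc.exists_isGreatest (hne.image _)
      exact ⟨za.2, zb.2, (hφs hza).2.1, (hφs hzb).2.2, fun z hz =>
        ⟨mem_univ _, hmin (mem_image_of_mem _ hz), hmax (mem_image_of_mem _ hz)⟩⟩
  have hφb := isBddCont_of_contDiff (T := T) hb hφ
  rw [← setIntegral_eq_integral_of_forall_compl_eq_zero (s := Ω ×ˢ Ioo 0 T) fun z hz => by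
    rw [image_eq_zero_of_notMem_tsupport fun h => hz (hφs h), zero_smul]]
  have e1 : ∀ z, φ z • ∑ i, ξ i * lapPot B v i z = ∑ i, ξ i * (φ z * lapPot B v i z) := fun z => by
    rw [smul_eq_mul, Finset.mul_sum]
    exact Finset.sum_congr rfl fun i _ => by ring
  simp only [e1]
  have i1 : ∀ i, Integrable (fun z => ξ i * (φ z * lapPot B v i z))
      (volume.restrict (Ω ×ˢ Ioo 0 T)) := fun i =>
    ((IsBddCont.const (ξ i)).mul (hφb.mul (hv.isBddCont_lapPot hΩ hb i))).integrable hΩ hb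
  have i2 : ∀ i, Integrable (fun z => ξ i * ∑ k, dx k φ z * dx k (pot B v i) z)
      (volume.restrict (Ω ×ˢ Ioo 0 T)) := fun i =>
    ((IsBddCont.const (ξ i)).mul (IsBddCont.sum fun k _ => (isBddCont_dx_of_contDiff hb hφ k).mul
      (isBddCont_dx hΩ hb (hv.contDiffOn_pot i) k))).integrable hΩ hb
  have e2 : ∀ i, ∫ z in Ω ×ˢ Ioo 0 T, ξ i * (φ z * lapPot B v i z)
      = -∫ z in Ω ×ˢ Ioo 0 T, ξ i * ∑ k, dx k φ z * dx k (pot B v i) z := fun i => by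
    rw [integral_const_mul, integral_const_mul, hv.isZeroFlux_pot hΩ hb hT i φ htest]
    ring
  rw [integral_finsetSum _ fun i _ => i1 i, Finset.sum_congr rfl fun i _ => e2 i,
    Finset.sum_neg_distrib, ← integral_finsetSum _ fun i _ => i2 i, neg_eq_zero,
    setIntegral_congr_fun hm (g := fun _ => (0 : ℝ)), integral_zero]
  intro z hz
  -- By symmetry of B, ∑ᵢ ξᵢ ∂ₖ(Bv)ᵢ = ∑ᵢ (Bξ)ᵢ ∂ₖvᵢ = 0, so the corresponding weak divergence
  -- vanishes too.
  have e3 : ∀ k, ∑ i, ξ i * dx k (pot B v i) z = 0 := fun k => by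
    simp only [hv.dx_pot hΩ hz]
    rw [Finset.sum_congr rfl fun i _ => mul_comm _ _, sum_mulB_comm hB]
    exact Finset.sum_eq_zero fun i _ => by rw [mem_kerB_iff.1 hξ i, zero_mul]
  simp only [Finset.mul_sum]
  rw [Finset.sum_comm]
  refine Finset.sum_eq_zero fun k _ => ?_
  rw [← mul_zero (dx k φ z), ← e3 k, Finset.mul_sum]
  exact Finset.sum_congr rfl fun i _ => by ring

/-- Allows u to be replaced by û, the only part of u with a weak gradient, in the pairing with the
divergence of ∇(Bv). -/
lemma sum_mul_lapPot_hat (hv : IsPositiveC1Solution B Ω T uin v) (hB : B.IsHermitian)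
    (hΩ : IsOpen Ω) (hb : Bornology.IsBounded Ω) (hT : 0 < T) :
    ∀ᵐ z ∂(volume.restrict (Ω ×ˢ Ioo 0 T)), ∀ u : E n,
      ∑ i, lapPot B v i z * (hat B u : E n) i = ∑ i, lapPot B v i z * u i := by
  -- Orthogonality is taken only for the finitely many projected coordinate vectors, so that one
  -- null set serves all vectors u.
  filter_upwards [ae_all_iff.2 fun j : Fin n => hv.sum_mul_lapPot_eq_zero hB hΩ hb hT
    ((kerB B).starProjection_apply_mem (EuclideanSpace.single j 1))] with z hz u
  have h1 : (hat B u : E n) = u - (kerB B).starProjection u := by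
    have := (kerB B).starProjection_orthogonal_val u
    rw [← this]
    rfl
  have h2 : (kerB B).starProjection u
      = ∑ j, u j • (kerB B).starProjection (EuclideanSpace.single j 1) := by
    have hu : u = ∑ j, u j • (EuclideanSpace.single j (1 : ℝ) : E n) := by
      ext i
      simp [Finset.sum_apply, Pi.single_apply]
    conv_lhs => rw [hu]
    rw [map_sum]
    exact Finset.sum_congr rfl fun j _ => map_smul _ _ _
  have h3 : ∑ i, lapPot B v i z * (kerB B).starProjection u i = 0 := by
    rw [h2]
    simp only [WithLp.ofLp_sum, Finset.sum_apply, PiLp.smul_apply, smul_eq_mul, Finset.mul_sum]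
    rw [Finset.sum_comm]
    refine Finset.sum_eq_zero fun j _ => ?_
    rw [← mul_zero (u j), ← hz j, Finset.mul_sum]
    exact Finset.sum_congr rfl fun i _ => by ring
  rw [h1]
  simp only [PiLp.sub_apply, mul_sub, Finset.sum_sub_distrib, h3, sub_zero]

end IsPositiveC1Solution

end StrongSolution


/-! ### The relative entropy inequality -/

section RelativeEntropy

variable {n d : ℕ} {B : Matrix (Fin n) (Fin n) ℝ} {Ω : Set (E d)} {T : ℝ}
  {uin : E d → Fin n → ℝ≥0} {v : E d × ℝ → Fin n → ℝ≥0}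
  {μ : E d × ℝ → ProbabilityMeasure (W B d)}

lemma eq_sum_single (u : E n) : u = ∑ j, u j • (EuclideanSpace.single j (1 : ℝ) : E n) := by
  ext i
  simp [Finset.sum_apply, Pi.single_apply]

lemma IsDissipativeMVSolution.integrable_hat_baryS (hμ : IsDissipativeMVSolution Ω uin μ)
    (hΩ : volume Ω ≠ ⊤) :
    Integrable (fun z => hat B (baryS μ z)) (volume.restrict (Ω ×ˢ Ioo 0 T)) := by
  have h : Integrable (fun z => baryS μ z) (volume.restrict (Ω ×ˢ Ioo 0 T)) := by
    have e : (fun z => baryS μ z)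
        = fun z => ∑ j, baryS μ z j • (EuclideanSpace.single j (1 : ℝ) : E n) :=
      funext fun z => eq_sum_single _
    rw [e]
    exact integrable_finsetSum _ fun j _ => (hμ.integrable_baryS hΩ j).smul_const _
  exact (perpB B).orthogonalProjectionOnto.integrable_comp h

/-- Scalar components of y = ∇û on the finite cylinder: test functions supported in (0,T) see
nothing of the remaining times, and ℓ commutes with the integrals. -/
lemma IsDissipativeMVSolution.isWeakSpaceGradient (hμ : IsDissipativeMVSolution Ω uin μ)
    (hΩ : IsOpen Ω) (hb : Bornology.IsBounded Ω) (hT : 0 < T) (ℓ : perpB B →L[ℝ] ℝ) :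
    IsWeakSpaceGradient Ω T (fun z => ℓ (hat B (baryS μ z))) (fun k z => ℓ (baryP μ k z)) := by
  intro φ hφ hφc hφs k
  have hm : MeasurableSet (Ω ×ˢ Ioo 0 T) := hΩ.measurableSet.prod measurableSet_Ioo
  have hsub : Ω ×ˢ Ioo 0 T ⊆ Ω ×ˢ Ioi (0 : ℝ) := prod_mono le_rfl Ioo_subset_Ioi_self
  have hvol : volume Ω ≠ ⊤ := hb.measure_lt_top.ne
  have h := hμ.gradient_eq φ hφ hφc (hφs.trans hsub) k
  have hφ0 : ∀ z, z ∉ Ω ×ˢ Ioo 0 T → φ z = 0 := fun z hz =>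
    image_eq_zero_of_notMem_tsupport fun h => hz (hφs h)
  have hdφ0 : ∀ z, z ∉ Ω ×ˢ Ioo 0 T → dx k φ z = 0 := fun z hz => by
    have : fderiv ℝ φ z = 0 := image_eq_zero_of_notMem_tsupport fun h =>
      hz (hφs (tsupport_fderiv_subset ℝ h))
    rw [dx, this]; rfl
  rw [setIntegral_eq_of_subset_of_forall_sdiff_eq_zero
      (hΩ.measurableSet.prod measurableSet_Ioi) hsub fun z hz => by rw [hdφ0 z hz.2, zero_smul],
    setIntegral_eq_of_subset_of_forall_sdiff_eq_zero
      (hΩ.measurableSet.prod measurableSet_Ioi) hsub fun z hz => by rw [hφ0 z hz.2, zero_smul]]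
    at h
  have hbd : ∀ {X : Type} [NormedAddCommGroup X] [NormedSpace ℝ X] {f : E d × ℝ → ℝ}
      {g : E d × ℝ → X}, IsBddCont Ω T f → Integrable g (volume.restrict (Ω ×ˢ Ioo 0 T)) →
      Integrable (fun z => f z • g z) (volume.restrict (Ω ×ˢ Ioo 0 T)) := by
    intro X _ _ f g hf hg
    obtain ⟨C, _, hC⟩ := hf.bdd
    refine hg.bdd_smul C (hf.aestronglyMeasurable hΩ) ?_
    filter_upwards [ae_restrict_mem hm] with z hz
    exact hC z hz
  have i1 := hbd (isBddCont_dx_of_contDiff hb hφ k) (hμ.integrable_hat_baryS (T := T) hvol)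
  have i2 := hbd (isBddCont_of_contDiff hb hφ) (hμ.integrable_baryP hvol hT k)
  have h2 := congrArg ℓ h
  rw [map_neg, ← ℓ.integral_comp_comm i1, ← ℓ.integral_comp_comm i2] at h2
  simpa only [map_smul, smul_eq_mul] using h2

/-- Functions of the initial datum are integrable, and may be evaluated along `v`. -/
lemma IsPositiveC1Solution.initial_integral (hv : IsPositiveC1Solution B Ω T uin v)
    (hb : Bornology.IsBounded Ω) (hT : 0 < T) {f : E d → (Fin n → ℝ≥0) → ℝ}
    {F : E d × ℝ → ℝ} (hF : ContinuousOn F (closure Ω ×ˢ Icc 0 T))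
    (hfF : ∀ x, f x (v (x, 0)) = F (x, 0)) :
    Integrable (fun x => f x (uin x)) (volume.restrict Ω) ∧
      ∫ x in Ω, f x (uin x) = ∫ x in Ω, F (x, 0) := by
  have hae : (fun x => F (x, 0)) =ᵐ[volume.restrict Ω] fun x => f x (uin x) := by
    filter_upwards [hv.initial] with x hx
    rw [← hfF, hx]
  exact ⟨(integrable_slice_of_continuousOn hb hF ⟨le_rfl, hT.le⟩).congr hae,
    (integral_congr_ae hae).symm⟩

/-- Summed time slices of weak continuity equations starting from `v(0)`. -/
lemma IsPositiveC1Solution.ae_slice_sum (hv : IsPositiveC1Solution B Ω T uin v)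
    (hΩ : IsOpen Ω) (hb : Bornology.IsBounded Ω) (hT : 0 < T)
    {u : Fin n → E d × ℝ → ℝ} {q : Fin n → Fin d → E d × ℝ → ℝ}
    (h : ∀ i, IsWeakContinuityEq Ω T (u i) (q i) (fun x => (uin x i : ℝ)))
    (hu : ∀ i, Integrable (u i) (volume.restrict (Ω ×ˢ Ioo 0 T)))
    (hq : ∀ i k, Integrable (q i k) (volume.restrict (Ω ×ˢ Ioo 0 T)))
    {ψ : Fin n → E d × ℝ → ℝ} (hψ : ∀ i, ContDiffOn ℝ 1 (ψ i) (closure Ω ×ˢ Icc 0 T)) :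
    ∀ᵐ t ∂(volume.restrict (Ioo 0 T)),
      Integrable (fun x => ∑ i, ψ i (x, t) * u i (x, t)) (volume.restrict Ω) ∧
      ∫ x in Ω, ∑ i, ψ i (x, t) * u i (x, t) = (∫ x in Ω, ∑ i, ψ i (x, 0) * comp v i (x, 0))
        + ∫ z in Ω ×ˢ Ioo 0 t, ∑ i, (dt (ψ i) z * u i z - ∑ k, dx k (ψ i) z * q i k z) := by
  have hsl : ∀ᵐ t ∂(volume.restrict (Ioo 0 T)), ∀ i,
      Integrable (fun x => ψ i (x, t) * u i (x, t)) (volume.restrict Ω) := by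
    refine ae_all_iff.2 fun i => ?_
    have := (isBddCont_of_continuousOn hb (hψ i).continuousOn).integrable_mul hΩ (hu i)
    rw [restrict_cylinder] at this
    exact this.prod_left_ae
  have hall := ae_all_iff.2 fun i => (h i).ae_slice hΩ hb hT (hu i) (hq i) (hψ i)
  filter_upwards [hsl, hall, ae_restrict_mem measurableSet_Ioo] with t h1 h2 ht
  refine ⟨integrable_finsetSum _ fun i _ => h1 i, ?_⟩
  have i1 : ∀ i, Integrable (fun x => ψ i (x, 0) * comp v i (x, 0)) (volume.restrict Ω) := fun i =>
    integrable_slice_of_continuousOn hb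
      ((hψ i).continuousOn.mul (hv.contDiffOn_comp i).continuousOn) ⟨le_rfl, hT.le⟩
  have i2 : ∀ i, Integrable (fun z => dt (ψ i) z * u i z - ∑ k, dx k (ψ i) z * q i k z)
      (volume.restrict (Ω ×ˢ Ioo 0 t)) := fun i =>
    (((isBddCont_dt hΩ hb (hψ i)).integrable_mul hΩ (hu i)).fun_sub
      (integrable_finsetSum _ fun k _ =>
        (isBddCont_dx hΩ hb (hψ i) k).integrable_mul hΩ (hq i k))).mono_measure
      (cylinder_mono ht.2.le)
  rw [integral_finsetSum _ fun i _ => h1 i, integral_finsetSum _ fun i _ => i1 i,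
    integral_finsetSum _ fun i _ => i2 i, ← Finset.sum_add_distrib]
  refine Finset.sum_congr rfl fun i _ => ?_
  rw [h2 i, (hv.initial_integral hb hT (f := fun x s => (s i : ℝ) * ψ i (x, 0))
    (F := fun z => ψ i z * comp v i z)
    ((hψ i).continuousOn.mul (hv.contDiffOn_comp i).continuousOn) fun x => mul_comm _ _).2]

lemma IsPositiveC1Solution.continuousOn_shannon (hv : IsPositiveC1Solution B Ω T uin v) :
    ContinuousOn (fun z => shannon (v z)) (closure Ω ×ˢ Icc 0 T) :=
  continuousOn_finsetSum _ fun i _ => ((hv.contDiffOn_comp i).continuousOn.mul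
    ((hv.contDiffOn_logComp i).continuousOn.sub continuousOn_const)).add continuousOn_const

lemma rao_vec (z : E d × ℝ) : rao B (vec (v z)) = 1 / 2 * ∑ i, pot B v i z * comp v i z := by
  rw [rao_eq]; rfl

lemma IsPositiveC1Solution.contDiffOn_rao (hv : IsPositiveC1Solution B Ω T uin v) :
    ContDiffOn ℝ 1 (fun z => rao B (vec (v z))) (closure Ω ×ˢ Icc 0 T) := by
  simp only [rao_vec]
  exact contDiffOn_const.mul
    (ContDiffOn.sum fun i _ => (hv.contDiffOn_pot i).mul (hv.contDiffOn_comp i))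

lemma IsPositiveC1Solution.integrable_shannon_initial (hv : IsPositiveC1Solution B Ω T uin v)
    (hb : Bornology.IsBounded Ω) (hT : 0 < T) :
    Integrable (fun x => shannon (uin x)) (volume.restrict Ω) :=
  (hv.initial_integral hb hT (f := fun _ s => shannon s) hv.continuousOn_shannon fun _ => rfl).1

lemma IsPositiveC1Solution.integrable_rao_initial (hv : IsPositiveC1Solution B Ω T uin v)
    (hb : Bornology.IsBounded Ω) (hT : 0 < T) :
    Integrable (fun x => rao B (vec (uin x))) (volume.restrict Ω) :=
  (hv.initial_integral hb hT (f := fun _ s => rao B (vec s)) hv.contDiffOn_rao.continuousOn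
    fun _ => rfl).1

lemma rao_nonneg (hB : IsAdmissible B) (z : E n) : 0 ≤ rao B z := by
  rw [rao_eq]
  exact mul_nonneg (by norm_num) (quad_nonneg hB.posSemidef z)

lemma lintegral_rao_ne_top (hB : IsAdmissible B)
    (h : Integrable (fun x => rao B (vec (uin x))) (volume.restrict Ω)) :
    ∫⁻ x in Ω, ENNReal.ofReal (rao B (vec (uin x))) ≠ ⊤ :=
  ((hasFiniteIntegral_iff_ofReal (Filter.Eventually.of_forall fun _ => rao_nonneg hB _)).1 h.2).ne

/-- The averaged relative Shannon entropy density. -/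
noncomputable def relEntMoment (v : E d × ℝ → Fin n → ℝ≥0)
    (μ : E d × ℝ → ProbabilityMeasure (W B d)) (z : E d × ℝ) : ℝ :=
  entMoment μ z - ∑ i, logComp v i z * baryS μ z i + ∑ i, (comp v i z - 1)

lemma ae_slice_flux_strong (hv : IsPositiveC1Solution B Ω T uin v)
    (hΩ : IsOpen Ω) (hb : Bornology.IsBounded Ω) (hT : 0 < T)
    {ψ : Fin n → E d × ℝ → ℝ} (hψ : ∀ i, ContDiffOn ℝ 1 (ψ i) (closure Ω ×ˢ Icc 0 T)) :
    ∀ᵐ t ∂(volume.restrict (Ioo 0 T)),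
      ∫ x in Ω, ∑ i, ψ i (x, t) * comp v i (x, t) = (∫ x in Ω, ∑ i, ψ i (x, 0) * comp v i (x, 0))
        + ∫ z in Ω ×ˢ Ioo 0 t, ∑ i, (dt (ψ i) z * comp v i z
          - ∑ k, dx k (ψ i) z * (comp v i z * dx k (pot B v i) z)) := by
  have hcb := fun i => isBddCont_of_continuousOn hb (hv.contDiffOn_comp i).continuousOn
  filter_upwards [hv.ae_slice_sum hΩ hb hT hv.weak (fun i => (hcb i).integrable hΩ hb)
    (fun i k => ((hcb i).mul (isBddCont_dx hΩ hb (hv.contDiffOn_pot i) k)).integrable hΩ hb) hψ]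
    with t ht using ht.2

lemma ae_slice_flux_weak (hB : IsAdmissible B) (hv : IsPositiveC1Solution B Ω T uin v)
    (hμ : IsDissipativeMVSolution Ω uin μ)
    (hΩ : IsOpen Ω) (hb : Bornology.IsBounded Ω) (hT : 0 < T)
    {ψ : Fin n → E d × ℝ → ℝ} (hψ : ∀ i, ContDiffOn ℝ 1 (ψ i) (closure Ω ×ˢ Icc 0 T)) :
    ∀ᵐ t ∂(volume.restrict (Ioo 0 T)),
      Integrable (fun x => ∑ i, ψ i (x, t) * baryS μ (x, t) i) (volume.restrict Ω) ∧
      ∫ x in Ω, ∑ i, ψ i (x, t) * baryS μ (x, t) i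
        = (∫ x in Ω, ∑ i, ψ i (x, 0) * comp v i (x, 0))
          + ∫ z in Ω ×ˢ Ioo 0 t, ∑ i, (dt (ψ i) z * baryS μ z i
            - ∑ k, dx k (ψ i) z * flux μ i k z) :=
  hv.ae_slice_sum hΩ hb hT (fun i => hμ.evolution T hT i)
    (fun i => hμ.integrable_baryS hb.measure_lt_top.ne i)
    (fun i k => hμ.integrable_flux hB hb.measure_lt_top.ne hT (hv.integrable_shannon_initial hb hT)
      (lintegral_rao_ne_top hB (hv.integrable_rao_initial hb hT)) i k) hψ

/-- The relative Shannon entropy inequality. -/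
lemma relative_shannon_le (hB : IsAdmissible B) (hv : IsPositiveC1Solution B Ω T uin v)
    (hμ : IsDissipativeMVSolution Ω uin μ)
    (hΩ : IsOpen Ω) (hb : Bornology.IsBounded Ω) (hT : 0 < T) :
    ∀ᵐ t ∂(volume.restrict (Ioo 0 T)),
      ∫ x in Ω, relEntMoment v μ (x, t) ≤ -(∫ z in Ω ×ˢ Ioo 0 t, shannonProdMoment μ z)
        - ∫ z in Ω ×ˢ Ioo 0 t, ∑ i, (dt (logComp v i) z * baryS μ z i
          - ∑ k, dx k (logComp v i) z * flux μ i k z) := by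
  have hS := hv.integrable_shannon_initial hb hT
  have h0 : (0 : ℝ) ∈ Icc 0 T := ⟨le_rfl, hT.le⟩
  filter_upwards [hμ.shannon_inequality hB hS,
    ae_slice_flux_weak hB hv hμ hΩ hb hT hv.contDiffOn_logComp,
    ae_slice_flux_strong hv hΩ hb hT (ψ := fun _ _ => 1) (fun _ => contDiffOn_const),
    ae_restrict_mem measurableSet_Ioo] with t h1 h2 h3 ht
  have hcl : ContinuousOn (fun z => ∑ i, logComp v i z * comp v i z) (closure Ω ×ˢ Icc 0 T) :=
    continuousOn_finsetSum _ fun i _ => (hv.contDiffOn_logComp i).continuousOn.mul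
      (hv.contDiffOn_comp i).continuousOn
  have hc : ContinuousOn (fun z => ∑ i, comp v i z) (closure Ω ×ˢ Icc 0 T) :=
    continuousOn_finsetSum _ fun i _ => (hv.contDiffOn_comp i).continuousOn
  -- Testing the equation of v with the constant 1 gives conservation of mass, so the terms ∑ᵢ (vᵢ -
  -- 1) in the relative entropy do not change in time.
  have hmass : ∫ x in Ω, ∑ i, comp v i (x, t) = ∫ x in Ω, ∑ i, comp v i (x, 0) := by
    have e : ∀ z : E d × ℝ, ∑ i, (dt (fun _ => (1 : ℝ)) z * comp v i z
        - ∑ k, dx k (fun _ => (1 : ℝ)) z * (comp v i z * dx k (pot B v i) z)) = 0 := fun z => by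
      simp [dt, dx]
    simpa only [one_mul, e, integral_zero, add_zero] using h3
  have hfin : IsFiniteMeasure ((volume : Measure (E d)).restrict Ω) :=
    ⟨by rw [Measure.restrict_apply_univ]; exact hb.measure_lt_top⟩
  have hsplit : ∀ s ∈ Icc 0 T, ∫ x in Ω, ∑ i, (comp v i (x, s) - 1)
      = (∫ x in Ω, ∑ i, comp v i (x, s)) - ∫ _ in Ω, (n : ℝ) := fun s hs => by
    rw [← integral_sub (integrable_slice_of_continuousOn hb hc hs) (integrable_const _)]
    simp [Finset.sum_sub_distrib]
  have hci : ∀ s ∈ Icc 0 T, Integrable (fun x => ∑ i, (comp v i (x, s) - 1))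
      (volume.restrict Ω) := fun s hs =>
    integrable_slice_of_continuousOn (f := fun z => ∑ i, (comp v i z - 1)) hb
      (continuousOn_finsetSum _ fun i _ =>
        (hv.contDiffOn_comp i).continuousOn.sub continuousOn_const) hs
  have hE : ∫ x in Ω, relEntMoment v μ (x, t) = (∫ x in Ω, entMoment μ (x, t))
      - (∫ x in Ω, ∑ i, logComp v i (x, t) * baryS μ (x, t) i)
      + ∫ x in Ω, ∑ i, (comp v i (x, t) - 1) := by
    simp only [relEntMoment]
    rw [integral_add (h1.1.fun_sub h2.1) (hci t ⟨ht.1.le, ht.2.le⟩), integral_sub h1.1 h2.1]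
  -- The relative entropy is zero at time 0, because the initial datum is v(0).
  have hinit : ∫ x in Ω, shannon (uin x) = (∫ x in Ω, ∑ i, logComp v i (x, 0) * comp v i (x, 0))
      - ∫ x in Ω, ∑ i, (comp v i (x, 0) - 1) := by
    rw [(hv.initial_integral hb hT (f := fun _ s => shannon s) hv.continuousOn_shannon
      fun _ => rfl).2, ← integral_sub (integrable_slice_of_continuousOn hb hcl h0) (hci 0 h0)]
    refine integral_congr_ae (Filter.Eventually.of_forall fun x => ?_)
    simp only [shannon, logComp, comp]
    rw [← Finset.sum_sub_distrib]
    exact Finset.sum_congr rfl fun i _ => by ring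
  rw [hE, h2.2, hsplit t ⟨ht.1.le, ht.2.le⟩, hmass, ← hsplit 0 h0]
  have := h1.2
  rw [hinit] at this
  linarith

/-- The energy identity of the strong solution. -/
lemma rao_strong (hB : IsAdmissible B) (hv : IsPositiveC1Solution B Ω T uin v)
    (hΩ : IsOpen Ω) (hb : Bornology.IsBounded Ω) (hT : 0 < T) :
    ∀ᵐ t ∂(volume.restrict (Ioo 0 T)),
      ∫ x in Ω, rao B (vec (v (x, t))) = (∫ x in Ω, rao B (vec (v (x, 0))))
        - ∫ z in Ω ×ˢ Ioo 0 t, ∑ i, ∑ k, comp v i z * dx k (pot B v i) z ^ 2 := by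
  -- Two expressions are compared. Testing with (Bv)ᵢ evaluates the change of 2h_R, while the time
  -- derivative of h_R is ∑ᵢ ∂ₜ(Bv)ᵢ vᵢ by symmetry of B. Their difference is the dissipation.
  filter_upwards [ae_slice_flux_strong hv hΩ hb hT hv.contDiffOn_pot,
    ae_restrict_mem measurableSet_Ioo] with t h1 ht
  have hcyl := cylinder_mono (Ω := Ω) ht.2.le
  have h2 := integral_dt_cylinder hΩ hb hv.contDiffOn_rao ⟨ht.1.le, ht.2.le⟩
  have hm : MeasurableSet (Ω ×ˢ Ioo 0 t) := hΩ.measurableSet.prod measurableSet_Ioo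
  have e1 : ∫ z in Ω ×ˢ Ioo 0 t, dt (fun z => rao B (vec (v z))) z
      = ∫ z in Ω ×ˢ Ioo 0 t, ∑ i, dt (pot B v i) z * comp v i z := by
    refine setIntegral_congr_fun hm fun z hz => ?_
    have hzQ : z ∈ Ω ×ˢ Ioo 0 T := ⟨hz.1, hz.2.1, hz.2.2.trans ht.2⟩
    have hd : HasFDerivAt (fun z => 1 / 2 * ∑ i, pot B v i z * comp v i z)
        ((1 / 2 : ℝ) • ∑ i, (pot B v i z • fderiv ℝ (comp v i) z
          + comp v i z • fderiv ℝ (pot B v i) z)) z :=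
      (HasFDerivAt.fun_sum fun i _ =>
        (differentiableAt_of_mem_cylinder hΩ (hv.contDiffOn_pot i) hzQ).hasFDerivAt.mul
        (differentiableAt_of_mem_cylinder hΩ (hv.contDiffOn_comp i) hzQ).hasFDerivAt).const_mul _
    have hsym : ∑ i, pot B v i z * dt (comp v i) z = ∑ i, dt (pot B v i) z * comp v i z := by
      simp only [hv.dt_pot hΩ hzQ]
      exact sum_mulB_comm hB.posSemidef.1 (vec (v z)) (dtVec v z)
    simp only [rao_vec]
    rw [dt, hd.fderiv]
    have e : ((1 / 2 : ℝ) • ∑ i, (pot B v i z • fderiv ℝ (comp v i) z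
          + comp v i z • fderiv ℝ (pot B v i) z)) (0, 1)
        = 1 / 2 * (∑ i, pot B v i z * dt (comp v i) z + ∑ i, dt (pot B v i) z * comp v i z) := by
      simp [dt, Finset.sum_add_distrib, mul_add]
      exact Finset.sum_congr rfl fun i _ => mul_comm _ _
    rw [e, hsym]
    ring
  have hcb := fun i => isBddCont_of_continuousOn hb (hv.contDiffOn_comp i).continuousOn
  have hpb := fun i k => isBddCont_dx hΩ hb (hv.contDiffOn_pot i) k
  have i1 : Integrable (fun z => ∑ i, dt (pot B v i) z * comp v i z)
      (volume.restrict (Ω ×ˢ Ioo 0 t)) :=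
    ((IsBddCont.sum fun i _ => (isBddCont_dt hΩ hb (hv.contDiffOn_pot i)).mul (hcb i)).integrable
      hΩ hb).mono_measure hcyl
  have i2 : Integrable (fun z => ∑ i, ∑ k, dx k (pot B v i) z * (comp v i z * dx k (pot B v i) z))
      (volume.restrict (Ω ×ˢ Ioo 0 t)) :=
    ((IsBddCont.sum fun i _ => IsBddCont.sum fun k _ =>
      (hpb i k).mul ((hcb i).mul (hpb i k))).integrable hΩ hb).mono_measure hcyl
  simp only [Finset.sum_sub_distrib] at h1
  rw [integral_sub i1 i2, ← e1, h2] at h1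
  have e2 : ∀ z, ∑ i, ∑ k, comp v i z * dx k (pot B v i) z ^ 2
      = ∑ i, ∑ k, dx k (pot B v i) z * (comp v i z * dx k (pot B v i) z) := fun z =>
    Finset.sum_congr rfl fun i _ => Finset.sum_congr rfl fun k _ => by ring
  simp only [e2]
  have e3 : ∀ s, ∫ x in Ω, ∑ i, pot B v i (x, s) * comp v i (x, s)
      = 2 * ∫ x in Ω, rao B (vec (v (x, s))) := fun s => by
    rw [← integral_const_mul]
    refine integral_congr_ae (Filter.Eventually.of_forall fun x => ?_)
    simp only [rao_vec]; ring
  rw [e3, e3] at h1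
  linarith

/-- The relative Rao entropy inequality. -/
lemma relative_rao_le (hB : IsAdmissible B) (hv : IsPositiveC1Solution B Ω T uin v)
    (hμ : IsDissipativeMVSolution Ω uin μ)
    (hΩ : IsOpen Ω) (hb : Bornology.IsBounded Ω) (hT : 0 < T) :
    ∀ᵐ t ∂(volume.restrict (Ioo 0 T)),
      0 ≤ -(∑ i, ∫ z in Ω ×ˢ Ioo 0 t, raoProdMoment μ i z)
        - (∫ z in Ω ×ˢ Ioo 0 t, ∑ i, (dt (pot B v i) z * baryS μ z i
          - ∑ k, dx k (pot B v i) z * flux μ i k z))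
        - ∫ z in Ω ×ˢ Ioo 0 t, ∑ i, ∑ k, comp v i z * dx k (pot B v i) z ^ 2 := by
  have hR := hv.integrable_rao_initial hb hT
  filter_upwards [hμ.rao_inequality hB hb.measure_lt_top.ne hR,
    ae_slice_flux_weak hB hv hμ hΩ hb hT hv.contDiffOn_pot,
    rao_strong hB hv hΩ hb hT, ae_restrict_mem measurableSet_Ioo] with t h1 h2 h3 ht
  -- The integrand is ½(u-v)ᵀB(u-v). Only its sign is kept. The barycenter suffices here because the
  -- Rao entropy of the solution is evaluated at u.
  have hnn : 0 ≤ ∫ x in Ω, (rao B (baryS μ (x, t)) - ∑ i, pot B v i (x, t) * baryS μ (x, t) i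
      + rao B (vec (v (x, t)))) := by
    refine integral_nonneg fun x => ?_
    have h := quad_nonneg hB.posSemidef (baryS μ (x, t) - vec (v (x, t)))
    rw [quad_sub hB.posSemidef.1, sum_mulB_comm hB.posSemidef.1] at h
    simp only [rao_eq, Pi.zero_apply]
    have e : ∑ i, mulB B (vec (v (x, t))) i * baryS μ (x, t) i
        = ∑ i, pot B v i (x, t) * baryS μ (x, t) i := rfl
    rw [e] at h
    linarith
  have hvi : Integrable (fun x => rao B (vec (v (x, t)))) (volume.restrict Ω) :=
    integrable_slice_of_continuousOn (f := fun z => rao B (vec (v z))) hb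
      hv.contDiffOn_rao.continuousOn ⟨ht.1.le, ht.2.le⟩
  rw [integral_add (h1.1.fun_sub h2.1) hvi, integral_sub h1.1 h2.1, h2.2, h3] at hnn
  have e3 : ∫ x in Ω, ∑ i, pot B v i (x, 0) * comp v i (x, 0)
      = 2 * ∫ x in Ω, rao B (vec (v (x, 0))) := by
    rw [← integral_const_mul]
    refine integral_congr_ae (Filter.Eventually.of_forall fun x => ?_)
    simp only [rao_vec]; ring
  have h4 := h1.2
  rw [(hv.initial_integral hb hT (f := fun _ s => rao B (vec s)) hv.contDiffOn_rao.continuousOn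
    fun _ => rfl).2] at h4
  linarith

end RelativeEntropy


/-! ### Weak-strong uniqueness -/

section WeakStrong

variable {n d : ℕ} {B : Matrix (Fin n) (Fin n) ℝ} {Ω : Set (E d)} {T : ℝ}
  {uin : E d → Fin n → ℝ≥0} {v : E d × ℝ → Fin n → ℝ≥0}
  {μ : E d × ℝ → ProbabilityMeasure (W B d)}

/-- The averaged entropy production relative to `v`, written with barycenters. -/
noncomputable def prodMoment (v : E d × ℝ → Fin n → ℝ≥0)
    (μ : E d × ℝ → ProbabilityMeasure (W B d)) (z : E d × ℝ) : ℝ :=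
  -shannonProdMoment μ z + ∑ k, ∑ i, mulB B (baryP μ k z : E n) i * gradVec v k z i
    + ∑ i, ∑ k, (flux μ i k z - baryS μ z i * mulB B (gradVec v k z) i)
        * (gradVec v k z i / comp v i z)
    - ∑ i, raoProdMoment μ i z + ∑ i, ∑ k, flux μ i k z * mulB B (gradVec v k z) i
    + ∑ i, ∑ k, comp v i z * mulB B (gradVec v k z) i
        * (mulB B (baryP μ k z : E n) i - mulB B (gradVec v k z) i)

/-- The averaged relative dissipation. -/
noncomputable def dissMoment (v : E d × ℝ → Fin n → ℝ≥0)
    (μ : E d × ℝ → ProbabilityMeasure (W B d)) (z : E d × ℝ) : ℝ :=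
  ∫ w : W B d, ∑ k, quad B ((w.2 k : E n) - gradVec v k z) ∂(μ z : Measure (W B d))

lemma mulB_hat (u : E n) (i : Fin n) : mulB B (hat B u : E n) i = mulB B u i := by
  have h : u - (hat B u : E n) ∈ kerB B := by
    have h1 : u - (perpB B).starProjection u ∈ (perpB B)ᗮ :=
      (perpB B).sub_starProjection_mem_orthogonal u
    rwa [Submodule.orthogonal_orthogonal] at h1
  have := mem_kerB_iff.1 h i
  rw [mulB_sub] at this
  linarith

/-- Integration by parts of ∇(Bv)ᵢ against ûᵢ. Only after summing over i does orthogonality to ker B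
allow û to be replaced by u. -/
lemma integral_lapPot_add (hB : IsAdmissible B) (hv : IsPositiveC1Solution B Ω T uin v)
    (hμ : IsDissipativeMVSolution Ω uin μ) (hΩ : IsBoundedLipschitzDomain Ω) (hT : 0 < T)
    {t : ℝ} (ht : t ≤ T) :
    Integrable (fun z => ∑ i, (lapPot B v i z * baryS μ z i
      + ∑ k, dx k (pot B v i) z * (baryP μ k z : E n) i)) (volume.restrict (Ω ×ˢ Ioo 0 T)) ∧
    ∫ z in Ω ×ˢ Ioo 0 t, ∑ i, (lapPot B v i z * baryS μ z i
      + ∑ k, dx k (pot B v i) z * (baryP μ k z : E n) i) = 0 := by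
  have hb := hΩ.isBounded
  have hvol : volume Ω ≠ ⊤ := hb.measure_lt_top.ne
  set ℓ : Fin n → (perpB B →L[ℝ] ℝ) := fun i =>
    (EuclideanSpace.proj i : E n →L[ℝ] ℝ).comp (perpB B).subtypeL
  have hw : ∀ i, Integrable (fun z => ℓ i (hat B (baryS μ z))) (volume.restrict (Ω ×ˢ Ioo 0 T)) :=
    fun i => (ℓ i).integrable_comp (hμ.integrable_hat_baryS hvol)
  have hy : ∀ i k, Integrable (fun z => ℓ i (baryP μ k z)) (volume.restrict (Ω ×ˢ Ioo 0 T)) :=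
    fun i k => (ℓ i).integrable_comp (hμ.integrable_baryP hvol hT k)
  have hF := fun i k => isBddCont_dx hΩ.isOpen hb (hv.contDiffOn_pot i) k
  have hg := fun i => hv.isBddCont_lapPot hΩ.isOpen hb i
  have hzero := fun i => integral_zeroFlux_cylinder hΩ (hF i) (hg i)
    (hv.isZeroFlux_pot hΩ.isOpen hb hT i) (hw i) (hy i)
    (hμ.isWeakSpaceGradient hΩ.isOpen hb hT (ℓ i)) ht
  have hi : ∀ i, Integrable (fun z => lapPot B v i z * ℓ i (hat B (baryS μ z))
      + ∑ k, dx k (pot B v i) z * ℓ i (baryP μ k z)) (volume.restrict (Ω ×ˢ Ioo 0 T)) := fun i =>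
    ((hg i).integrable_mul hΩ.isOpen (hw i)).fun_add
      (integrable_finsetSum _ fun k _ => (hF i k).integrable_mul hΩ.isOpen (hy i k))
  have hae : (fun z => ∑ i, (lapPot B v i z * ℓ i (hat B (baryS μ z))
      + ∑ k, dx k (pot B v i) z * ℓ i (baryP μ k z)))
      =ᵐ[volume.restrict (Ω ×ˢ Ioo 0 T)] fun z => ∑ i, (lapPot B v i z * baryS μ z i
      + ∑ k, dx k (pot B v i) z * (baryP μ k z : E n) i) := by
    filter_upwards [hv.sum_mul_lapPot_hat hB.posSemidef.1 hΩ.isOpen hb hT] with z hz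
    rw [Finset.sum_add_distrib, Finset.sum_add_distrib, ← hz (baryS μ z)]
    rfl
  refine ⟨(integrable_finsetSum _ fun i _ => hi i).congr hae, ?_⟩
  rw [← integral_congr_ae (ae_mono (cylinder_mono ht) hae),
    integral_finsetSum _ fun i _ => (hi i).mono_measure (cylinder_mono ht)]
  exact Finset.sum_eq_zero fun i _ => hzero i

/-- The flux vᵢ∇(Bv)ᵢ has divergence ∂ₜvᵢ and is integrated by parts against (Bû)ᵢ = (Bu)ᵢ. Symmetry
of B then moves B onto ∂ₜv. -/
lemma integral_dt_add (hB : IsAdmissible B) (hv : IsPositiveC1Solution B Ω T uin v)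
    (hμ : IsDissipativeMVSolution Ω uin μ) (hΩ : IsBoundedLipschitzDomain Ω) (hT : 0 < T)
    {t : ℝ} (ht : t ≤ T) :
    Integrable (fun z => ∑ i, (dt (pot B v i) z * baryS μ z i
      + ∑ k, comp v i z * dx k (pot B v i) z * mulB B (baryP μ k z : E n) i))
      (volume.restrict (Ω ×ˢ Ioo 0 T)) ∧
    ∫ z in Ω ×ˢ Ioo 0 t, ∑ i, (dt (pot B v i) z * baryS μ z i
      + ∑ k, comp v i z * dx k (pot B v i) z * mulB B (baryP μ k z : E n) i) = 0 := by
  have hb := hΩ.isBounded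
  have hvol : volume Ω ≠ ⊤ := hb.measure_lt_top.ne
  have hm : MeasurableSet (Ω ×ˢ Ioo 0 T) := hΩ.isOpen.measurableSet.prod measurableSet_Ioo
  set ℓ : Fin n → (perpB B →L[ℝ] ℝ) := fun i => (mulBL B i).comp (perpB B).subtypeL
  have hℓ : ∀ i (p : perpB B), ℓ i p = mulB B (p : E n) i := fun i p => mulBL_apply i _
  have hw : ∀ i, Integrable (fun z => ℓ i (hat B (baryS μ z))) (volume.restrict (Ω ×ˢ Ioo 0 T)) :=
    fun i => (ℓ i).integrable_comp (hμ.integrable_hat_baryS hvol)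
  have hy : ∀ i k, Integrable (fun z => ℓ i (baryP μ k z)) (volume.restrict (Ω ×ˢ Ioo 0 T)) :=
    fun i k => (ℓ i).integrable_comp (hμ.integrable_baryP hvol hT k)
  have hF := fun i k => (isBddCont_of_continuousOn hb (hv.contDiffOn_comp i).continuousOn).mul
    (isBddCont_dx hΩ.isOpen hb (hv.contDiffOn_pot i) k)
  have hg := fun i => isBddCont_dt hΩ.isOpen hb (hv.contDiffOn_comp i)
  have hzero := fun i => integral_zeroFlux_cylinder hΩ (hF i) (hg i)
    (hv.isZeroFlux_flux hΩ.isOpen hb hT i) (hw i) (hy i)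
    (hμ.isWeakSpaceGradient hΩ.isOpen hb hT (ℓ i)) ht
  have hi : ∀ i, Integrable (fun z => dt (comp v i) z * ℓ i (hat B (baryS μ z))
      + ∑ k, comp v i z * dx k (pot B v i) z * ℓ i (baryP μ k z))
      (volume.restrict (Ω ×ˢ Ioo 0 T)) := fun i =>
    ((hg i).integrable_mul hΩ.isOpen (hw i)).fun_add
      (integrable_finsetSum _ fun k _ => (hF i k).integrable_mul hΩ.isOpen (hy i k))
  have hae : (fun z => ∑ i, (dt (comp v i) z * ℓ i (hat B (baryS μ z))
      + ∑ k, comp v i z * dx k (pot B v i) z * ℓ i (baryP μ k z)))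
      =ᵐ[volume.restrict (Ω ×ˢ Ioo 0 T)] fun z => ∑ i, (dt (pot B v i) z * baryS μ z i
      + ∑ k, comp v i z * dx k (pot B v i) z * mulB B (baryP μ k z : E n) i) := by
    filter_upwards [ae_restrict_mem hm] with z hz
    rw [Finset.sum_add_distrib, Finset.sum_add_distrib]
    simp only [hℓ, mulB_hat, hv.dt_pot hΩ.isOpen hz]
    rw [sum_mulB_comm hB.posSemidef.1 (dtVec v z) (baryS μ z)]
    congr 1
    exact Finset.sum_congr rfl fun i _ => mul_comm _ _
  refine ⟨(integrable_finsetSum _ fun i _ => hi i).congr hae, ?_⟩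
  rw [← integral_congr_ae (ae_mono (cylinder_mono ht) hae),
    integral_finsetSum _ fun i _ => (hi i).mono_measure (cylinder_mono ht)]
  exact Finset.sum_eq_zero fun i _ => hzero i

/-- The relative entropy is controlled by the entropy production. -/
lemma relative_entropy_le (hB : IsAdmissible B) (hv : IsPositiveC1Solution B Ω T uin v)
    (hμ : IsDissipativeMVSolution Ω uin μ) (hΩ : IsBoundedLipschitzDomain Ω) (hT : 0 < T) :
    Integrable (prodMoment v μ) (volume.restrict (Ω ×ˢ Ioo 0 T)) ∧
    ∀ᵐ t ∂(volume.restrict (Ioo 0 T)),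
      ∫ x in Ω, relEntMoment v μ (x, t) ≤ ∫ z in Ω ×ˢ Ioo 0 t, prodMoment v μ z := by
  have hb := hΩ.isBounded
  have ho := hΩ.isOpen
  have hvol : volume Ω ≠ ⊤ := hb.measure_lt_top.ne
  have hS := hv.integrable_shannon_initial hb hT
  have hR := lintegral_rao_ne_top hB (hv.integrable_rao_initial hb hT)
  have hm : MeasurableSet (Ω ×ˢ Ioo 0 T) := ho.measurableSet.prod measurableSet_Ioo
  set f₂ : E d × ℝ → ℝ := fun z => ∑ i, (dt (logComp v i) z * baryS μ z i
    - ∑ k, dx k (logComp v i) z * flux μ i k z)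
  set f₄ : E d × ℝ → ℝ := fun z => ∑ i, (dt (pot B v i) z * baryS μ z i
    - ∑ k, dx k (pot B v i) z * flux μ i k z)
  set f₅ : E d × ℝ → ℝ := fun z => ∑ i, ∑ k, comp v i z * dx k (pot B v i) z ^ 2
  set f₆ : E d × ℝ → ℝ := fun z => ∑ i, (lapPot B v i z * baryS μ z i
      + ∑ k, dx k (pot B v i) z * (baryP μ k z : E n) i)
  set f₇ : E d × ℝ → ℝ := fun z => ∑ i, (dt (pot B v i) z * baryS μ z i
      + ∑ k, comp v i z * dx k (pot B v i) z * mulB B (baryP μ k z : E n) i)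
  have hf : ∀ {ψ : Fin n → E d × ℝ → ℝ}, (∀ i, ContDiffOn ℝ 1 (ψ i) (closure Ω ×ˢ Icc 0 T)) →
      Integrable (fun z => ∑ i, (dt (ψ i) z * baryS μ z i - ∑ k, dx k (ψ i) z * flux μ i k z))
        (volume.restrict (Ω ×ˢ Ioo 0 T)) := fun hψ =>
    integrable_finsetSum _ fun i _ =>
      ((isBddCont_dt ho hb (hψ i)).integrable_mul ho (hμ.integrable_baryS hvol i)).fun_sub
      (integrable_finsetSum _ fun k _ => (isBddCont_dx ho hb (hψ i) k).integrable_mul ho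
        (hμ.integrable_flux hB hvol hT hS hR i k))
  have i1 := (hμ.shannonProd_moment hB hT hS).2.1
  have i2 : Integrable f₂ (volume.restrict (Ω ×ˢ Ioo 0 T)) := hf hv.contDiffOn_logComp
  have i3' := fun i => (hμ.raoProd_moment hT hR i).2.1
  have i3 : Integrable (fun z => ∑ i, raoProdMoment μ i z) (volume.restrict (Ω ×ˢ Ioo 0 T)) :=
    integrable_finsetSum _ fun i _ => i3' i
  have i4 : Integrable f₄ (volume.restrict (Ω ×ˢ Ioo 0 T)) := hf hv.contDiffOn_pot
  have i5 : Integrable f₅ (volume.restrict (Ω ×ˢ Ioo 0 T)) := by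
    simp only [f₅, pow_two]
    exact (IsBddCont.sum fun i _ => IsBddCont.sum fun k _ =>
      (isBddCont_of_continuousOn hb (hv.contDiffOn_comp i).continuousOn).mul
      ((isBddCont_dx ho hb (hv.contDiffOn_pot i) k).mul
        (isBddCont_dx ho hb (hv.contDiffOn_pot i) k))).integrable ho hb
  have i6 := (integral_lapPot_add hB hv hμ hΩ hT (t := T) le_rfl).1
  have i7 := (integral_dt_add hB hv hμ hΩ hT (t := T) le_rfl).1
  have hsum := (((((i1.fun_neg.fun_sub i2).fun_sub i3).fun_sub i4).fun_sub i5).fun_add i6).fun_add i7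
  -- The two integrations by parts contribute zero and are added to remove the time derivatives: ∂ₜ
  -- log vᵢ cancels through `lapPot`, and ∂ₜ(Bv)ᵢ cancels directly. What remains is the averaged
  -- `production`.
  have hae : (fun z => -shannonProdMoment μ z - f₂ z - (∑ i, raoProdMoment μ i z) - f₄ z - f₅ z
      + f₆ z + f₇ z) =ᵐ[volume.restrict (Ω ×ˢ Ioo 0 T)] prodMoment v μ := by
    filter_upwards [ae_restrict_mem hm] with z hz
    have hlog : ∀ i k, dx k (logComp v i) z = gradVec v k z i / comp v i z := fun i k =>
      hv.fderiv_logComp ho hz i _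
    have hsym : ∑ k, ∑ i, mulB B (baryP μ k z : E n) i * gradVec v k z i
        = ∑ i, ∑ k, mulB B (gradVec v k z) i * (baryP μ k z : E n) i := by
      rw [Finset.sum_comm (f := fun i k => mulB B (gradVec v k z) i * (baryP μ k z : E n) i)]
      exact Finset.sum_congr rfl fun k _ => sum_mulB_comm hB.posSemidef.1 _ _
    simp only [f₂, f₄, f₅, f₆, f₇, prodMoment, hsym, lapPot, hv.dx_pot ho hz, hlog]
    rw [← sub_eq_zero]
    have hdist : ∀ i, (∑ k, gradVec v k z i / comp v i z * mulB B (gradVec v k z) i)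
        * baryS μ z i = ∑ k, gradVec v k z i / comp v i z * mulB B (gradVec v k z) i
        * baryS μ z i := fun i => Finset.sum_mul _ _ _
    simp only [sub_mul, hdist, mul_sub, Finset.sum_sub_distrib, Finset.sum_add_distrib]
    have e1 : ∑ i, ∑ k, gradVec v k z i / comp v i z * mulB B (gradVec v k z) i * baryS μ z i
        = ∑ i, ∑ k, baryS μ z i * mulB B (gradVec v k z) i * (gradVec v k z i / comp v i z) :=
      Finset.sum_congr rfl fun i _ => Finset.sum_congr rfl fun k _ => by ring
    have e2 : ∑ i, ∑ k, gradVec v k z i / comp v i z * flux μ i k z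
        = ∑ i, ∑ k, flux μ i k z * (gradVec v k z i / comp v i z) :=
      Finset.sum_congr rfl fun i _ => Finset.sum_congr rfl fun k _ => by ring
    have e3 : ∑ i, ∑ k, mulB B (gradVec v k z) i * flux μ i k z
        = ∑ i, ∑ k, flux μ i k z * mulB B (gradVec v k z) i :=
      Finset.sum_congr rfl fun i _ => Finset.sum_congr rfl fun k _ => by ring
    have e4 : ∑ i, ∑ k, comp v i z * mulB B (gradVec v k z) i ^ 2
        = ∑ i, ∑ k, comp v i z * mulB B (gradVec v k z) i * mulB B (gradVec v k z) i :=
      Finset.sum_congr rfl fun i _ => Finset.sum_congr rfl fun k _ => by ring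
    rw [e1, e2, e3, e4]
    ring
  refine ⟨hsum.congr hae, ?_⟩
  filter_upwards [relative_shannon_le hB hv hμ ho hb hT, relative_rao_le hB hv hμ ho hb hT,
    ae_restrict_mem measurableSet_Ioo] with t h1 h2 ht
  have hc := cylinder_mono (Ω := Ω) ht.2.le
  have h6 := (integral_lapPot_add hB hv hμ hΩ hT ht.2.le).2
  have h7 := (integral_dt_add hB hv hμ hΩ hT ht.2.le).2
  rw [← integral_finsetSum _ fun i _ => (i3' i).mono_measure hc] at h2
  replace i1 := i1.mono_measure hc
  replace i2 := i2.mono_measure hc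
  replace i3 := i3.mono_measure hc
  replace i4 := i4.mono_measure hc
  replace i5 := i5.mono_measure hc
  replace i6 := i6.mono_measure hc
  replace i7 := i7.mono_measure hc
  rw [← integral_congr_ae (ae_mono hc hae),
    integral_add (((((i1.fun_neg.fun_sub i2).fun_sub i3).fun_sub i4).fun_sub i5).fun_add i6) i7,
    integral_add ((((i1.fun_neg.fun_sub i2).fun_sub i3).fun_sub i4).fun_sub i5) i6,
    integral_sub (((i1.fun_neg.fun_sub i2).fun_sub i3).fun_sub i4) i5,
    integral_sub ((i1.fun_neg.fun_sub i2).fun_sub i3) i4,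
    integral_sub (i1.fun_neg.fun_sub i2) i3, integral_sub i1.fun_neg i2, integral_neg]
  linarith

lemma relEntMoment_eq {z : E d × ℝ} (h : FiniteMoments (μ z : Measure (W B d))) :
    relEntMoment v μ z
      = ∫ w : W B d, ∑ i, relEnt (w.1 i) (comp v i z) ∂(μ z : Measure (W B d)) := by
  rw [h.integral_relEnt_sum, relEntMoment, entMoment]
  congr 2
  exact Finset.sum_congr rfl fun i _ => mul_comm _ _

lemma integrable_relEntMoment (hv : IsPositiveC1Solution B Ω T uin v)
    (hμ : IsDissipativeMVSolution Ω uin μ) (hΩ : IsOpen Ω) (hb : Bornology.IsBounded Ω)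
    (hT : 0 < T) : Integrable (relEntMoment v μ) (volume.restrict (Ω ×ˢ Ioo 0 T)) :=
  ((hμ.entropy_moment (hv.integrable_shannon_initial hb hT)).2.fun_sub
    (integrable_finsetSum _ fun i _ =>
      (isBddCont_of_continuousOn hb (hv.contDiffOn_logComp i).continuousOn).integrable_mul hΩ
        (hμ.integrable_baryS hb.measure_lt_top.ne i))).fun_add
    ((IsBddCont.sum fun i _ => (isBddCont_of_continuousOn hb
      (hv.contDiffOn_comp i).continuousOn).sub (IsBddCont.const 1)).integrable hΩ hb)

/-- Expanding the square leaves the Shannon production, terms linear in p with bounded coefficients,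
and a bounded function. -/
lemma integrable_dissMoment (hB : IsAdmissible B) (hv : IsPositiveC1Solution B Ω T uin v)
    (hμ : IsDissipativeMVSolution Ω uin μ) (hΩ : IsOpen Ω) (hb : Bornology.IsBounded Ω)
    (hT : 0 < T) : Integrable (dissMoment v μ) (volume.restrict (Ω ×ˢ Ioo 0 T)) := by
  have hS := hv.integrable_shannon_initial hb hT
  have hR := lintegral_rao_ne_top hB (hv.integrable_rao_initial hb hT)
  have hG : ∀ i k, IsBddCont Ω T (fun z => gradVec v k z i) := fun i k =>
    isBddCont_dx hΩ hb (hv.contDiffOn_comp i) k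
  have hq : ∀ k, IsBddCont Ω T (fun z => quad B (gradVec v k z)) := fun k =>
    IsBddCont.sum fun i _ => (IsBddCont.sum fun j _ => (IsBddCont.const _).mul (hG j k)).mul
      (hG i k)
  have hy : ∀ i k, Integrable (fun z => mulB B (baryP μ k z : E n) i)
      (volume.restrict (Ω ×ˢ Ioo 0 T)) := fun i k => by
    have := ((mulBL B i).comp (perpB B).subtypeL).integrable_comp
      (hμ.integrable_baryP hb.measure_lt_top.ne hT k)
    simpa [mulBL_apply] using this
  have hi := ((hμ.shannonProd_moment hB hT hS).2.1.fun_sub (integrable_finsetSum Finset.univ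
    fun k _ => (integrable_finsetSum Finset.univ fun i _ =>
      (hG i k).integrable_mul hΩ (hy i k)).const_mul 2)).fun_add
      ((IsBddCont.sum (s := Finset.univ) fun k _ => hq k).integrable hΩ hb)
  refine hi.congr ?_
  filter_upwards [hμ.finiteMoments hB hT hS hR] with z hz
  have e : ∀ w : W B d, ∑ k, quad B ((w.2 k : E n) - gradVec v k z) = normSqSqrtB B w.2
      - ∑ k, 2 * ∑ i, mulB B (w.2 k : E n) i * gradVec v k z i
      + ∑ k, quad B (gradVec v k z) := fun w => by
    rw [normSqSqrtB_eq, ← Finset.sum_sub_distrib, ← Finset.sum_add_distrib]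
    exact Finset.sum_congr rfl fun k _ => quad_sub hB.posSemidef.1 _ _
  have j1 : ∀ k, Integrable (fun w : W B d => ∑ i, mulB B (w.2 k : E n) i * gradVec v k z i)
      (μ z : Measure (W B d)) := fun k =>
    integrable_finsetSum _ fun i _ => (hz.mulB_grad i k).mul_const _
  simp only [dissMoment, e]
  rw [integral_add (hz.shannonProd.fun_sub (integrable_finsetSum _ fun k _ => (j1 k).const_mul 2))
    (integrable_const _), integral_sub hz.shannonProd
    (integrable_finsetSum _ fun k _ => (j1 k).const_mul 2),
    integral_finsetSum _ fun k _ => (j1 k).const_mul 2]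
  simp only [integral_const, probReal_univ, one_smul]
  congr 2
  refine Finset.sum_congr rfl fun k _ => ?_
  rw [integral_const_mul, integral_finsetSum _ fun i _ => (hz.mulB_grad i k).mul_const _]
  congr 1
  refine Finset.sum_congr rfl fun i _ => ?_
  rw [integral_mul_const, hz.integral_mulB_grad, mul_comm]
  rfl

/-- Uniform constants for the strong solution. -/
lemma exists_prodMoment_le (hB : IsAdmissible B) (hv : IsPositiveC1Solution B Ω T uin v)
    (hμ : IsDissipativeMVSolution Ω uin μ) (hΩ : IsOpen Ω) (hb : Bornology.IsBounded Ω)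
    (hT : 0 < T) : ∃ C, 0 ≤ C ∧ ∀ᵐ z ∂(volume.restrict (Ω ×ˢ Ioo 0 T)),
      prodMoment v μ z ≤ -(1 / 2 * dissMoment v μ z) + C * relEntMoment v μ z := by
  have hS := hv.integrable_shannon_initial hb hT
  have hR := lintegral_rao_ne_top hB (hv.integrable_rao_initial hb hT)
  have hm : MeasurableSet (Ω ×ˢ Ioo 0 T) := hΩ.measurableSet.prod measurableSet_Ioo
  -- M bounds vᵢ and N bounds ∂ₖ(log vᵢ - (Bv)ᵢ). Sums over the indices serve below as uniform
  -- bounds.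
  choose M hM0 hM using fun i => exists_bound_cylinder hb (hv.contDiffOn_comp i).continuousOn
  choose N hN0 hN using fun (i : Fin n) (k : Fin d) =>
    ((isBddCont_dx hΩ hb (hv.contDiffOn_logComp i) k).sub
      (isBddCont_dx hΩ hb (hv.contDiffOn_pot i) k)).bdd
  obtain ⟨C, hC0, hC⟩ := exists_production_le (d := d) hB (M := ∑ i, M i) (N := ∑ i, ∑ k, N i k)
    (Finset.sum_nonneg fun i _ => hM0 i)
  refine ⟨C, hC0, ?_⟩
  filter_upwards [ae_restrict_mem hm, hμ.finiteMoments hB hT hS hR] with z hz hfm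
  have hzK := cylinder_subset Ω T hz
  have h := hfm.averaged_production_le hB (V := fun i => comp v i z)
    (fun i => hv.comp_pos hzK i) (fun k => gradVec v k z)
    (hC _ _ (fun i => hv.comp_pos hzK i) (fun i => ?_) fun i k => ?_)
  · rw [← relEntMoment_eq hfm] at h
    exact h
  · exact (le_abs_self _).trans ((hM i z hzK).trans
      (Finset.single_le_sum (f := M) (fun i _ => hM0 i) (Finset.mem_univ i)))
  · have h1 := hN i k z hz
    rw [hv.dx_pot hΩ hz, show dx k (logComp v i) z = gradVec v k z i / comp v i z from
      hv.fderiv_logComp hΩ hz i _] at h1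
    refine h1.trans ((Finset.single_le_sum (f := fun k => N i k) (fun k _ => hN0 i k)
      (Finset.mem_univ k)).trans ?_)
    exact Finset.single_le_sum (f := fun i => ∑ k, N i k)
      (fun i _ => Finset.sum_nonneg fun k _ => hN0 i k) (Finset.mem_univ i)

lemma relEntMoment_nonneg (hv : IsPositiveC1Solution B Ω T uin v) {z : E d × ℝ}
    (hz : z ∈ Ω ×ˢ Ioo 0 T) (h : FiniteMoments (μ z : Measure (W B d))) :
    0 ≤ relEntMoment v μ z := by
  rw [relEntMoment_eq h]
  exact integral_nonneg fun w => Finset.sum_nonneg fun i _ =>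
    relEnt_nonneg (w.1 i).2 (hv.comp_pos (cylinder_subset Ω T hz) i)

lemma dissMoment_nonneg (hB : IsAdmissible B) (z : E d × ℝ) : 0 ≤ dissMoment v μ z :=
  integral_nonneg fun _ => Finset.sum_nonneg fun _ _ => quad_nonneg hB.posSemidef _

lemma exists_between_of_ae_Ioo {P : ℝ → Prop} (h : ∀ᵐ t ∂(volume.restrict (Ioo 0 T)), P t)
    {s : ℝ} (hs : 0 ≤ s) (hsT : s < T) : ∃ t ∈ Ioo s T, P t := by
  have h2 : ∀ᵐ t ∂(volume.restrict (Ioo s T)), P t :=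
    ae_mono (Measure.restrict_mono (Ioo_subset_Ioo_left hs) le_rfl) h
  have : (ae (volume.restrict (Ioo s T))).NeBot := by
    rw [ae_neBot, Ne, Measure.restrict_eq_zero, Real.volume_Ioo]
    simpa using hsT
  obtain ⟨t, ht⟩ := (h2.and (ae_restrict_mem measurableSet_Ioo)).exists
  exact ⟨t, ht.2, ht.1⟩

/-- The relative entropy and the relative dissipation vanish almost everywhere. -/
lemma relEntMoment_dissMoment_eq_zero (hB : IsAdmissible B)
    (hv : IsPositiveC1Solution B Ω T uin v) (hμ : IsDissipativeMVSolution Ω uin μ)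
    (hΩ : IsBoundedLipschitzDomain Ω) (hT : 0 < T) :
    ∀ᵐ z ∂(volume.restrict (Ω ×ˢ Ioo 0 T)), relEntMoment v μ z = 0 ∧ dissMoment v μ z = 0 := by
  have hb := hΩ.isBounded
  have ho := hΩ.isOpen
  have hS := hv.integrable_shannon_initial hb hT
  have hR := lintegral_rao_ne_top hB (hv.integrable_rao_initial hb hT)
  have hm : MeasurableSet (Ω ×ˢ Ioo 0 T) := ho.measurableSet.prod measurableSet_Ioo
  have he := integrable_relEntMoment hv hμ ho hb hT
  have hD := integrable_dissMoment hB hv hμ ho hb hT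
  obtain ⟨C, hC0, hC⟩ := exists_prodMoment_le hB hv hμ ho hb hT
  obtain ⟨hp, hle⟩ := relative_entropy_le hB hv hμ hΩ hT
  have he0 : ∀ᵐ z ∂(volume.restrict (Ω ×ˢ Ioo 0 T)), 0 ≤ relEntMoment v μ z := by
    filter_upwards [ae_restrict_mem hm, hμ.finiteMoments hB hT hS hR] with z hz hfm
    exact relEntMoment_nonneg hv hz hfm
  have hmain : ∀ᵐ t ∂(volume.restrict (Ioo 0 T)), ∫ x in Ω, relEntMoment v μ (x, t)
      ≤ -(1 / 2 * ∫ z in Ω ×ˢ Ioo 0 t, dissMoment v μ z)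
        + C * ∫ z in Ω ×ˢ Ioo 0 t, relEntMoment v μ z := by
    filter_upwards [hle, ae_restrict_mem measurableSet_Ioo] with t h1 ht
    have hc := cylinder_mono (Ω := Ω) ht.2.le
    refine h1.trans ((integral_mono_ae (hp.mono_measure hc)
      (((hD.mono_measure hc).const_mul (1 / 2)).fun_neg.fun_add
        ((he.mono_measure hc).const_mul C)) (ae_mono hc hC)).trans (le_of_eq ?_))
    rw [integral_add ((hD.mono_measure hc).const_mul (1 / 2)).fun_neg
      ((he.mono_measure hc).const_mul C), integral_neg, integral_const_mul, integral_const_mul]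
  have hfub : ∀ t ≤ T, ∫ z in Ω ×ˢ Ioo 0 t, relEntMoment v μ z
      = ∫ τ in Ioo 0 t, ∫ x in Ω, relEntMoment v μ (x, τ) := fun t ht => by
    have := he.mono_measure (cylinder_mono (Ω := Ω) ht)
    rw [restrict_cylinder] at this ⊢
    exact integral_prod_symm _ this
  have hEi : IntegrableOn (fun t => ∫ x in Ω, relEntMoment v μ (x, t)) (Ioo 0 T) := by
    have := he
    rw [restrict_cylinder] at this
    exact this.integral_prod_right
  have hE0 : ∀ᵐ t ∂(volume.restrict (Ioo 0 T)), 0 ≤ ∫ x in Ω, relEntMoment v μ (x, t) := by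
    filter_upwards [ae_slice he0] with t ht using integral_nonneg_of_ae ht
  have hD0 : ∀ t, 0 ≤ ∫ z in Ω ×ˢ Ioo 0 t, dissMoment v μ z := fun t =>
    integral_nonneg fun z => dissMoment_nonneg hB z
  -- Gronwall is applied after dropping the dissipation, which is recovered afterwards from the same
  -- inequality with vanishing entropy.
  have hE := ae_eq_zero_of_le_mul_integral hT hC0 hEi hE0 (by
    filter_upwards [hmain, ae_restrict_mem measurableSet_Ioo] with t h1 ht
    rw [hfub t ht.2.le] at h1
    linarith [hD0 t])
  have heT : ∫ z in Ω ×ˢ Ioo 0 T, relEntMoment v μ z = 0 := by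
    rw [hfub T le_rfl]
    exact integral_eq_zero_of_ae hE
  have hez := (integral_eq_zero_iff_of_nonneg_ae he0 he).1 heT
  have hDz : ∀ᵐ t ∂(volume.restrict (Ioo 0 T)),
      ∀ᵐ z ∂(volume.restrict (Ω ×ˢ Ioo 0 t)), dissMoment v μ z = 0 := by
    filter_upwards [hmain, hE, ae_restrict_mem measurableSet_Ioo] with t h1 h2 ht
    have hc := cylinder_mono (Ω := Ω) ht.2.le
    rw [h2, integral_eq_zero_of_ae (ae_mono hc hez), mul_zero, add_zero] at h1
    have h3 : ∫ z in Ω ×ˢ Ioo 0 t, dissMoment v μ z = 0 := le_antisymm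
      (by linarith) (hD0 t)
    exact (integral_eq_zero_iff_of_nonneg (fun z => dissMoment_nonneg hB z)
      (hD.mono_measure hc)).1 h3
  -- The dissipation vanishes on Ω × (0,t) for almost every t < T. Such times approaching T exhaust
  -- the cylinder.
  have hseq : ∀ N : ℕ, ∃ t ∈ Ioo (T - T / (N + 1)) T,
      ∀ᵐ z ∂(volume.restrict (Ω ×ˢ Ioo 0 t)), dissMoment v μ z = 0 := fun N => by
    refine exists_between_of_ae_Ioo hDz ?_ ?_
    · rw [sub_nonneg, div_le_iff₀ (by positivity)]
      nlinarith [Nat.cast_nonneg (α := ℝ) N]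
    · have : 0 < T / ((N : ℝ) + 1) := by positivity
      linarith
  choose τ hτ hτz using hseq
  have hunion : Ω ×ˢ Ioo 0 T ⊆ ⋃ N, Ω ×ˢ Ioo 0 (τ N) := fun z hz => by
    obtain ⟨N, hN⟩ := exists_nat_gt (T / (T - z.2))
    have hpos : 0 < T - z.2 := sub_pos.2 hz.2.2
    refine mem_iUnion.2 ⟨N, hz.1, hz.2.1, lt_of_le_of_lt ?_ (hτ N).1⟩
    rw [div_lt_iff₀ hpos] at hN
    have : T / ((N : ℝ) + 1) ≤ T - z.2 := by
      rw [div_le_iff₀ (by positivity)]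
      nlinarith
    linarith
  have hDall : ∀ᵐ z ∂(volume.restrict (Ω ×ˢ Ioo 0 T)), dissMoment v μ z = 0 :=
    ae_mono (Measure.restrict_mono hunion le_rfl) (ae_restrict_iUnion_iff _ _ |>.2 hτz)
  filter_upwards [hez, hDall] with z h1 h2 using ⟨h1, h2⟩

end WeakStrong

end SegCD

theorem theorem2p3 {n d : ℕ} (hn : 1 ≤ n) (hd : 1 ≤ d)
    (B : Matrix (Fin n) (Fin n) ℝ) (hB : IsAdmissible B)
    (Ω : Set (E d)) (hΩ : IsBoundedLipschitzDomain Ω)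
    (T : ℝ) (hT : 0 < T)
    (uin : E d → Fin n → ℝ≥0)
    (v : E d × ℝ → Fin n → ℝ≥0) (hv : IsPositiveC1Solution B Ω T uin v)
    (μ : E d × ℝ → ProbabilityMeasure (W B d)) (hμ : IsDissipativeMVSolution Ω uin μ) :
    ∀ᵐ z ∂(volume.restrict (Ω ×ˢ Ioo 0 T)),
      (μ z : Measure (W B d)) = (Measure.dirac (v z)).prod (Measure.dirac (gradHat B v z)) := by
  have hb := hΩ.isBounded
  filter_upwards [relEntMoment_dissMoment_eq_zero hB hv hμ hΩ hT,
    hμ.finiteMoments hB hT (hv.integrable_shannon_initial hb hT)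
      (lintegral_rao_ne_top hB (hv.integrable_rao_initial hb hT)),
    ae_restrict_mem (hΩ.isOpen.measurableSet.prod measurableSet_Ioo)] with z h hfm hz
  -- The projection commutes with differentiation, so the second Dirac mass sits at the projection
  -- of ∇v.
  rw [hv.gradHat_eq hΩ.isOpen hz]
  refine hfm.eq_dirac hB (fun i => hv.pos z (cylinder_subset Ω T hz) i) _ ?_ h.2
  rw [← h.1, relEntMoment_eq hfm]
  rfl
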